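/- A diagram $D$ of a link in $\mathbb{R}\mathrm{P}^3$ is a closed disc $D^2$ in the plane with finitely many immersed arcs, closed or with boundary. The end points of the arcs with boundary are distinct points of $\partial D^2$, are divided into antipodal pairs, and are the only points of the arcs on $\partial D^2$. The arcs have finitely many multiple points, each of which is a transverse double point carrying an over/under-crossing structure (a crossing). Identifying antipodal points of $\partial D^2$ turns $D^2$ into $\mathbb{R}\mathrm{P}^2$ and the arcs into closed curves in $\mathbb{R}\mathrm{P}^2$, the components of $D$. The diagram $D$ is null-homologous if each of its components is trivial in $H_1(\mathbb{R}\mathrm{P}^2)=\mathbb{Z}_2$. The regions of $D$ are the connected components of the complement of these curves in $\mathbb{R}\mathrm{P}^2$. The diagram $D$ is checkerboard colourable if its regions can be coloured black and white so that the two sides of every arc, at each point that is not a crossing, have different colours; in particular no region lies on both sides of an arc. A state of $D$ is obtained by choosing the $A$-splicing or the $B$-splicing at each crossing $c$, and placing on the two resulting arcs marking arrows that are labelled by $c$, directed consistently with an orientation of the disc between the two arcs, and signed $-$ for an $A$-splicing and $+$ for a $B$-splicing. A state is thus a signed arrow presentation: a finite set of closed curves with disjoint labelled arrows on them, each label appearing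 on exactly two arrows and carrying a sign. It describes a signed ribbon graph, whose vertices are discs bounded by the curves and whose edges are discs glued along the two arrows with a common label. Two signed arrow presentations describe the same signed ribbon graph if they agree up to homeomorphism of the (unoriented) closed curves, relabelling, and reversal of both arrows with a common label. Let $\mathbb{G}_D$ be the set of signed ribbon graphs described by the states of $D$. Corollary. Let $D$ and $D'$ be checkerboard colourable diagrams of links in $\mathbb{R}\mathrm{P}^3$ such that $\mathbb{G}_D=\mathbb{G}_{D'}$. Then $D$ is null-homologous if and only if $D'$ is null-homologous. -/

import Mathlib

open scoped ComplexConjugate Topology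

noncomputable section

/-! ### Signed arrow presentations and signed ribbon graphs -/

/-- A signed arrow presentation: finitely many closed curves carrying disjoint labelled marking
arrows, each label being used by exactly two arrows and carrying a sign.  It is recorded through
the ends (head and tail) of its arrows: `opp` is the other end of the same arrow, and `along` is
the arrow end reached by leaving an arrow end along its curve, away from the arrow.  The closed
curves carrying arrows are thus the orbits of `opp` and `along`; the curves that carry no arrow
are counted by `bare`. -/
structure SignedArrowPresentation : Type 1 where
  Label : Type
  End : Type
  finiteEnd : Finite End
  label : End → Label
  isHead : End → Bool
  opp : End → End
  along : End → End
  sign : Label → ℤˣ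
  bare : ℕ
  opp_opp : ∀ e, opp (opp e) = e
  isHead_opp : ∀ e, isHead (opp e) = !isHead e
  label_opp : ∀ e, label (opp e) = label e
  along_along : ∀ e, along (along e) = e
  along_ne : ∀ e, along e ≠ e
  /-- each label appears on precisely two arrows -/
  two_arrows : ∀ l, {e | label e = l ∧ isHead e = true}.ncard = 2

namespace SignedArrowPresentation

/-- Two signed arrow presentations describe equivalent signed ribbon graphs: they agree up to
relabelling, homeomorphism of the (unoriented) closed curves, and reversal of both arrows carrying
a common label. -/
def Equivalent (P Q : SignedArrowPresentation) : Prop :=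
  ∃ (f : P.End ≃ Q.End) (g : P.Label ≃ Q.Label) (flip : P.Label → Bool),
    (∀ e, Q.label (f e) = g (P.label e)) ∧
    (∀ e, Q.isHead (f e) = xor (P.isHead e) (flip (P.label e))) ∧
    (∀ e, Q.opp (f e) = f (P.opp e)) ∧
    (∀ e, Q.along (f e) = f (P.along e)) ∧
    (∀ l, Q.sign (g l) = P.sign l) ∧
    Q.bare = P.bare

theorem Equivalent.refl (P : SignedArrowPresentation) : P.Equivalent P :=
  ⟨Equiv.refl _, Equiv.refl _, fun _ => false, by simp⟩

theorem Equivalent.symm {P Q : SignedArrowPresentation} (h : P.Equivalent Q) :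
    Q.Equivalent P := by
  obtain ⟨f, g, flip, h1, h2, h3, h4, h5, h6⟩ := h
  have hl : ∀ e, P.label (f.symm e) = g.symm (Q.label e) := by
    intro e
    rw [Equiv.eq_symm_apply, ← h1, Equiv.apply_symm_apply]
  refine ⟨f.symm, g.symm, fun l => flip (g.symm l), hl, ?_, ?_, ?_, ?_, h6.symm⟩
  · intro e
    have := h2 (f.symm e)
    rw [Equiv.apply_symm_apply, hl] at this
    rw [this]
    simp
  · intro e
    rw [Equiv.eq_symm_apply, ← h3, Equiv.apply_symm_apply]
  · intro e
    rw [Equiv.eq_symm_apply, ← h4, Equiv.apply_symm_apply]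
  · intro l
    rw [← h5, Equiv.apply_symm_apply]

theorem Equivalent.trans {P Q R : SignedArrowPresentation} (h : P.Equivalent Q)
    (h' : Q.Equivalent R) : P.Equivalent R := by
  obtain ⟨f, g, flip, h1, h2, h3, h4, h5, h6⟩ := h
  obtain ⟨f', g', flip', h1', h2', h3', h4', h5', h6'⟩ := h'
  exact ⟨f.trans f', g.trans g', fun l => xor (flip l) (flip' (g l)),
    by simp [h1, h1'], by simp [h1, h2, h2'], by simp [h3, h3'], by simp [h4, h4'],
    by simp [h5, h5'], h6'.trans h6⟩

instance setoid : Setoid SignedArrowPresentation :=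
  ⟨Equivalent, Equivalent.refl, Equivalent.symm, Equivalent.trans⟩

end SignedArrowPresentation

/-- Signed ribbon graphs, up to equivalence, described by arrow presentations. -/
def SignedRibbonGraph : Type 1 := Quotient SignedArrowPresentation.setoid

/-! ### The projective plane as a disc with antipodal boundary points identified -/

/-- The closed unit disc in the plane. -/
abbrev Disc : Type := Metric.closedBall (0 : ℂ) 1

/-- Identification of antipodal points of the boundary circle. -/
instance Disc.antipodal : Setoid Disc where
  r x y := x = y ∨ (‖(x : ℂ)‖ = 1 ∧ (y : ℂ) = -(x : ℂ))
  iseqv :=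
    { refl := fun _ => Or.inl rfl
      symm := by
        rintro x y (h | ⟨h, h'⟩)
        · exact Or.inl h.symm
        · exact Or.inr ⟨by rw [h', norm_neg, h], by rw [h', neg_neg]⟩
      trans := by
        rintro x y z (h | ⟨h, h'⟩) (k | ⟨k, k'⟩)
        · exact Or.inl (h.trans k)
        · subst h; exact Or.inr ⟨k, k'⟩
        · subst k; exact Or.inr ⟨h, h'⟩
        · exact Or.inl (Subtype.ext (by rw [k', h', neg_neg])) }

/-- The real projective plane. -/
abbrev ProjPlane : Type := Quotient Disc.antipodal

/-- The quotient map from the disc to the projective plane. -/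
def ProjPlane.mk (z : Disc) : ProjPlane := Quotient.mk _ z

/-! ### Diagrams of links in real projective 3-space -/

/-- Finitely many arcs immersed in the unit disc, each parametrised on `[0, 1]` (values elsewhere
are irrelevant, except that closed arcs are parametrised periodically).  Closed arcs lie in the open
disc; any other arc has its end points, and nothing else, on the boundary circle.  The arcs are
directed coherently along the closed curves that they form in `ℝP²`: `next a` starts at the
antipode of the point where `a` ends, so the end points come in antipodal pairs. -/
structure ArcSystem : Type 1 where
  Arc : Type
  [fintypeArc : Fintype Arc]
  γ : Arc → ℝ → ℂ
  IsClosedArc : Arc → Prop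
  next : Equiv.Perm Arc
  contDiff : ∀ a, ContDiff ℝ 1 (γ a)
  immersed : ∀ a, ∀ t ∈ Set.Icc (0 : ℝ) 1, deriv (γ a) t ≠ 0
  closed_periodic : ∀ a, IsClosedArc a → Function.Periodic (γ a) 1
  closed_interior : ∀ a, IsClosedArc a → ∀ t, ‖γ a t‖ < 1
  closed_next : ∀ a, IsClosedArc a → next a = a
  open_interior : ∀ a, ¬ IsClosedArc a → ∀ t ∈ Set.Ioo (0 : ℝ) 1, ‖γ a t‖ < 1
  open_start : ∀ a, ¬ IsClosedArc a → ‖γ a 0‖ = 1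
  open_end : ∀ a, ¬ IsClosedArc a → ‖γ a 1‖ = 1
  open_next : ∀ a, ¬ IsClosedArc a → γ (next a) 0 = -γ a 1

namespace ArcSystem

variable (D : ArcSystem)

instance : Fintype D.Arc := D.fintypeArc

/-- The parametrising 1-manifold: a half-open interval, standing for a circle, for each closed
arc, and a closed interval for each other arc. -/
def params : Set (D.Arc × ℝ) := {p | 0 ≤ p.2 ∧ p.2 ≤ 1 ∧ (D.IsClosedArc p.1 → p.2 < 1)}

def point (p : D.Arc × ℝ) : ℂ := D.γ p.1 p.2

def velocity (p : D.Arc × ℝ) : ℂ := deriv (D.γ p.1) p.2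

/-- Two distinct parameters with the same image. -/
def Meet (p q : D.Arc × ℝ) : Prop :=
  p ∈ D.params ∧ q ∈ D.params ∧ p ≠ q ∧ D.point p = D.point q

end ArcSystem

/-- A diagram of a link in `ℝP³`: generically immersed arcs in the disc (the multiple points are
finitely many transverse double points, and they are off the boundary circle since the end points
of the arcs are distinct), with an over/under structure at each double point. -/
structure LinkDiagram : Type 1 extends ArcSystem where
  meet_interior : ∀ p q, toArcSystem.Meet p q → ‖toArcSystem.point p‖ < 1
  meet_transverse : ∀ p q, toArcSystem.Meet p q →
    LinearIndependent ℝ ![toArcSystem.velocity p, toArcSystem.velocity q]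
  meet_double : ∀ p q r, toArcSystem.Meet p q → toArcSystem.Meet p r → q = r
  finite_meet : {p | ∃ q, toArcSystem.Meet p q}.Finite
  /-- Whether the strand through a double point is the over-crossing one. -/
  overStrand : Arc × ℝ → Bool
  overStrand_meet : ∀ p q, toArcSystem.Meet p q → overStrand q = !overStrand p

namespace LinkDiagram

variable (D : LinkDiagram)

/-! #### Components, the net, null-homologous diagrams -/

/-- The components: classes of arcs that form a single closed curve in the projective plane. -/
def Component : Type := Quotient (Equiv.Perm.SameCycle.setoid D.next)

def componentOf (a : D.Arc) : D.Component := Quotient.mk _ a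

theorem norm_le_one (p : D.Arc × ℝ) (h0 : 0 ≤ p.2) (h1 : p.2 ≤ 1) : ‖D.point p‖ ≤ 1 := by
  obtain ⟨a, t⟩ := p
  by_cases h : D.IsClosedArc a
  · exact (D.closed_interior a h t).le
  · rcases h0.eq_or_lt with h0 | h0
    · simp only at h0
      subst h0
      exact (D.open_start a h).le
    · rcases h1.eq_or_lt with h1 | h1
      · simp only at h1
        subst h1
        exact (D.open_end a h).le
      · exact (D.open_interior a h t ⟨h0, h1⟩).le

/-- An arc, as a singular 1-simplex of the projective plane. -/
def arcSimplex (a : D.Arc) : C(stdSimplex ℝ (Fin 2), ProjPlane) where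
  toFun x := ProjPlane.mk ⟨D.γ a (x 1), mem_closedBall_zero_iff.2
    (D.norm_le_one (a, x 1) (stdSimplex.zero_le x 1) (stdSimplex.le_one x 1))⟩
  continuous_toFun := by
    refine continuous_quotient_mk'.comp (Continuous.subtype_mk ?_ _)
    exact (D.contDiff a).continuous.comp ((continuous_apply 1).comp continuous_subtype_val)

/-- The singular simplicial set of the projective plane. -/
abbrev singularProjPlane : SSet.{0} := TopCat.toSSet.obj (TopCat.of ProjPlane)

/-- The integral singular chains of the projective plane. -/
abbrev chains : ChainComplex (ModuleCat.{0} ℤ) ℕ :=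
  singularProjPlane.chainComplex (ModuleCat.of ℤ ℤ)

/-- A singular 1-simplex as a singular 1-chain. -/
def simplexChain (σ : C(stdSimplex ℝ (Fin 2), ProjPlane)) : chains.X 1 :=
  (singularProjPlane.ιChainComplex (R := ModuleCat.of ℤ ℤ)
    (((TopCat.of ProjPlane).toSSetObjEquiv (.op (SimplexCategory.mk 1))).symm σ)).hom (1 : ℤ)

open Classical in
/-- The singular 1-cycle given by the closed curve of a component. -/
def componentCycle (c : D.Component) : chains.X 1 :=
  ∑ a : D.Arc with D.componentOf a = c, simplexChain (D.arcSimplex a)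

/-- Each component is trivial in the first singular homology group of the projective plane. -/
def IsNullHomologous : Prop :=
  ∀ c : D.Component, ∃ b : chains.X 2, (chains.d 2 1).hom b = D.componentCycle c

/-! #### Regions and checkerboard colourings -/

/-- The union of the curves of the diagram in the projective plane. -/
def curves : Set ProjPlane :=
  {x | ∃ z : Disc, ProjPlane.mk z = x ∧ ∃ p ∈ D.params, D.point p = z}

/-- The regions: the connected components of the complement of the curves in the projective
plane. -/
def Region : Type := ConnectedComponents {x : ProjPlane // x ∉ D.curves}

/-- The region `r` is the one entered on leaving the curves at the parameter `p` in the
direction `w`. -/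
def Enters (p : D.Arc × ℝ) (w : ℂ) (r : D.Region) : Prop :=
  ∀ᶠ ε : ℝ in 𝓝[>] 0, ∃ (z : Disc) (hz : ProjPlane.mk z ∉ D.curves),
    (z : ℂ) = D.point p + ε * w ∧ ConnectedComponents.mk ⟨ProjPlane.mk z, hz⟩ = r

/-- Two regions are adjacent if they are the regions on the two sides of a curve at some point
that is not a double point. A region can be adjacent to itself. -/
def Adjacent (r s : D.Region) : Prop :=
  ∃ p : D.Arc × ℝ, 0 < p.2 ∧ p.2 < 1 ∧ (∀ q, ¬ D.Meet p q) ∧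
    D.Enters p (Complex.I * D.velocity p) r ∧ D.Enters p (-(Complex.I * D.velocity p)) s

def IsCheckerboardColourable : Prop :=
  ∃ colour : D.Region → Bool, ∀ r s, D.Adjacent r s → colour r ≠ colour s

/-! #### Passages through crossings -/

/-- A passage of a strand through a crossing. -/
def Passage : Type := {p : D.Arc × ℝ // ∃ q, D.Meet p q}

instance : Finite D.Passage := D.finite_meet.to_subtype

/-- The crossings. -/
def Crossing : Type := {z : ℂ // ∃ p q, D.Meet p q ∧ D.point p = z}

variable {D}

theorem Meet_symm {p q : D.Arc × ℝ} (h : D.Meet p q) : D.Meet q p :=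
  ⟨h.2.1, h.1, h.2.2.1.symm, h.2.2.2.symm⟩

namespace Passage

def crossing (p : D.Passage) : D.Crossing :=
  ⟨D.point p.1, p.1, p.2.choose, p.2.choose_spec, rfl⟩

/-- The other passage through the same crossing. -/
def partner (p : D.Passage) : D.Passage :=
  ⟨p.2.choose, p.1, Meet_symm p.2.choose_spec⟩

theorem meet_partner (p : D.Passage) : D.Meet p.1 p.partner.1 := p.2.choose_spec

theorem partner_partner (p : D.Passage) : p.partner.partner = p :=
  Subtype.ext (D.meet_double _ _ _ p.partner.meet_partner (Meet_symm p.meet_partner))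

theorem partner_ne (p : D.Passage) : p.partner ≠ p :=
  fun h => p.meet_partner.2.2.1 (congrArg Subtype.val h).symm

theorem crossing_partner (p : D.Passage) : p.partner.crossing = p.crossing :=
  Subtype.ext p.meet_partner.2.2.2.symm

theorem eq_or_eq_partner {p q : D.Passage} (h : q.crossing = p.crossing) :
    q = p ∨ q = p.partner := by
  by_cases hpq : q = p
  · exact Or.inl hpq
  · refine Or.inr (Subtype.ext (D.meet_double p.1 _ _ ?_ p.meet_partner))
    exact ⟨p.meet_partner.1, q.meet_partner.1, fun h' => hpq (Subtype.ext h'.symm),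
      (congrArg Subtype.val h).symm⟩

def isOver (p : D.Passage) : Bool := D.overStrand p.1

theorem isOver_partner (p : D.Passage) : p.partner.isOver = !p.isOver :=
  D.overStrand_meet _ _ p.meet_partner

theorem time_nonneg (p : D.Passage) : 0 ≤ p.1.2 := p.meet_partner.1.1

theorem time_lt_one (p : D.Passage) : p.1.2 < 1 := by
  obtain ⟨⟨a, t⟩, hp⟩ := p
  obtain ⟨q, hq⟩ := hp
  by_cases h : D.IsClosedArc a
  · exact hq.1.2.2 h
  · refine lt_of_le_of_ne hq.1.2.1 fun h1 => ?_
    have := D.meet_interior _ _ hq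
    simp only at h1
    subst h1
    exact this.ne (D.open_end a h)

/-- Following the closed curve of a component in its direction, starting from the initial point of
the arc `a` and spending one unit of time on each arc, the passage `q` is made at time `τ`. -/
def MadeAt (a : D.Arc) (q : D.Passage) (τ : ℝ) : Prop :=
  ∃ n : ℕ, q.1.1 = (D.next ^ n) a ∧ τ = n + q.1.2

/-- `q` is the first passage made after `p` on following the closed curve through `p`. -/
def Follows (p q : D.Passage) : Prop :=
  ∃ τ, p.1.2 < τ ∧ MadeAt p.1.1 q τ ∧ ∀ r τ', p.1.2 < τ' → MadeAt p.1.1 r τ' → τ ≤ τ'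

theorem madeAt_unique {a : D.Arc} {q q' : D.Passage} {τ : ℝ} (h : MadeAt a q τ)
    (h' : MadeAt a q' τ) : q = q' := by
  obtain ⟨n, hn, hτ⟩ := h
  obtain ⟨m, hm, hτ'⟩ := h'
  have h1 := q.time_nonneg
  have h2 := q.time_lt_one
  have h3 := q'.time_nonneg
  have h4 := q'.time_lt_one
  have hnm : n = m := by
    have e : (n : ℝ) + q.1.2 = m + q'.1.2 := hτ ▸ hτ'
    have a1 : (n : ℝ) < m + 1 := by linarith
    have a2 : (m : ℝ) < n + 1 := by linarith
    have b1 : n < m + 1 := by exact_mod_cast a1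
    have b2 : m < n + 1 := by exact_mod_cast a2
    omega
  subst hnm
  exact Subtype.ext (Prod.ext (hn.trans hm.symm) (by linarith))

theorem exists_follows (p : D.Passage) : ∃ q, Follows p q := by
  obtain ⟨N, hN, hN1⟩ : ∃ N : ℕ, 0 < N ∧ (D.next ^ N) p.1.1 = p.1.1 :=
    ⟨orderOf D.next, orderOf_pos _, by rw [pow_orderOf_eq_one]; rfl⟩
  let S : Set (ℕ × D.Passage) :=
    {x | x.1 ≤ N ∧ x.2.1.1 = (D.next ^ x.1) p.1.1 ∧ p.1.2 < x.1 + x.2.1.2}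
  have hfin : S.Finite :=
    ((Set.finite_Iic N).prod (Set.finite_univ (α := D.Passage))).subset
      fun x hx => ⟨hx.1, trivial⟩
  have hne : S.Nonempty := ⟨(N, p), le_rfl, hN1.symm, by
    have : (0 : ℝ) < N := by exact_mod_cast hN
    simp only
    linarith⟩
  obtain ⟨⟨n, q⟩, hq, hmin⟩ := hfin.exists_minimalFor (fun x => (x.1 : ℝ) + x.2.1.2) S hne
  refine ⟨q, n + q.1.2, hq.2.2, ⟨n, hq.2.1, rfl⟩, ?_⟩
  rintro r τ' hr ⟨m, hm, rfl⟩
  by_contra hlt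
  push Not at hlt
  have hmN : m ≤ N := by
    have h1 := r.time_nonneg
    have h2 := q.time_lt_one
    have h3 : (n : ℝ) ≤ N := by exact_mod_cast hq.1
    have h4 : (m : ℝ) < N + 1 := by linarith
    have h5 : m < N + 1 := by exact_mod_cast h4
    omega
  exact absurd (hmin (j := (m, r)) ⟨hmN, hm, hr⟩ hlt.le) (not_le.2 hlt)

theorem Follows.unique {p q q' : D.Passage} (h : Follows p q) (h' : Follows p q') : q = q' := by
  obtain ⟨τ, h1, h2, h3⟩ := h
  obtain ⟨τ', h1', h2', h3'⟩ := h'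
  obtain rfl : τ = τ' := le_antisymm (h3 _ _ h1' h2') (h3' _ _ h1 h2)
  exact madeAt_unique h2 h2'

theorem Follows.injective {p p' q : D.Passage} (h : Follows p q) (h' : Follows p' q) :
    p = p' := by
  obtain ⟨τ, h1, ⟨n, hn, hτ⟩, h3⟩ := h
  obtain ⟨τ', h1', ⟨n', hn', hτ'⟩, h3'⟩ := h'
  -- the statement for `n ≤ n'`, used in both orders
  have key : ∀ (p p' : D.Passage) (n n' : ℕ) (τ' : ℝ), n ≤ n' → q.1.1 = (D.next ^ n) p.1.1 →
      q.1.1 = (D.next ^ n') p'.1.1 → p.1.2 < n + q.1.2 → τ' = n' + q.1.2 →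
      (∀ r τ'', p'.1.2 < τ'' → MadeAt p'.1.1 r τ'' → τ' ≤ τ'') →
      n' = n ∧ p.1.2 ≤ p'.1.2 := by
    intro p p' n n' τ' hle hn hn' hlt hτ' hmin
    obtain ⟨k, rfl⟩ := Nat.exists_eq_add_of_le hle
    have hp : p.1.1 = (D.next ^ k) p'.1.1 := by
      rw [pow_add, Equiv.Perm.mul_apply, hn] at hn'
      exact (D.next ^ n).injective hn'
    have hnot : ¬ p'.1.2 < (k : ℝ) + p.1.2 := by
      intro hk
      have := hmin p _ hk ⟨k, hp, rfl⟩
      rw [hτ'] at this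
      push_cast at this
      linarith
    have h1 := p.time_nonneg
    have h2 := p'.time_lt_one
    have hk : (k : ℝ) < 1 := by linarith
    have hk0 : k = 0 := by
      have : k < 1 := by exact_mod_cast hk
      omega
    subst hk0
    refine ⟨rfl, ?_⟩
    simpa using hnot
  have main : n = n' ∧ p.1.2 = p'.1.2 := by
    rcases le_total n n' with hle | hle
    · obtain ⟨e, l⟩ := key p p' n n' τ' hle hn hn' (hτ ▸ h1) hτ' h3'
      obtain ⟨-, l'⟩ := key p' p n' n τ e.le hn' hn (hτ' ▸ h1') hτ h3
      exact ⟨e.symm, le_antisymm l l'⟩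
    · obtain ⟨e, l⟩ := key p' p n' n τ hle hn' hn (hτ' ▸ h1') hτ h3
      obtain ⟨-, l'⟩ := key p p' n n' τ' e.le hn hn' (hτ ▸ h1) hτ' h3'
      exact ⟨e, le_antisymm l' l⟩
  obtain ⟨e, e'⟩ := main
  subst e
  exact Subtype.ext (Prod.ext ((D.next ^ n).injective (hn.symm.trans hn')) e')

/-- The next passage along the closed curve of a component. -/
def nextPassage : Equiv.Perm D.Passage :=
  Equiv.ofBijective (fun p => (exists_follows p).choose) (Finite.injective_iff_bijective.1
    fun p p' h => Follows.injective (exists_follows p).choose_spec (by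
      have h' : (exists_follows p).choose = (exists_follows p').choose := h
      rw [h']
      exact (exists_follows p').choose_spec))

theorem follows_nextPassage (p : D.Passage) : Follows p (nextPassage p) :=
  (exists_follows p).choose_spec

/-- Whether, at the crossing of `p`, the basis formed by the directions of the over- and the
under-crossing strand is positively oriented. -/
def IsPositiveBasis (p : D.Passage) : Prop :=
  if p.isOver then 0 < (conj (D.velocity p.1) * D.velocity p.partner.1).im
  else 0 < (conj (D.velocity p.partner.1) * D.velocity p.1).im

theorem isPositiveBasis_partner (p : D.Passage) :
    p.partner.IsPositiveBasis ↔ p.IsPositiveBasis := by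
  unfold IsPositiveBasis
  rw [partner_partner, isOver_partner]
  cases p.isOver <;> simp

end Passage

/-! #### States and ribbon graphs of a diagram -/

/-- The two kinds of marked splicing of a crossing. -/
inductive Splicing
  | A
  | B
  deriving DecidableEq

/-- The sign carried by a marked splicing. -/
def Splicing.sign : Splicing → ℤˣ
  | .A => -1
  | .B => 1

/-- The half-edges at the crossings: `(p, true)` leaves the crossing in the direction of the strand
through `p`, and `(p, false)` leaves it backwards. -/
abbrev HalfEdge (D : LinkDiagram) : Type := D.Passage × Bool

variable (σ : D.Crossing → Splicing)

open Classical in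
/-- The half-edge to which a half-edge is joined by the splicing. Counterclockwise around a crossing
the half-edges alternate between over and under. Each of the two arcs of the A-splicing joins an
over half-edge to the under half-edge preceding it counterclockwise; each of the two arcs of the
B-splicing joins an over half-edge to the under half-edge following it. -/
def spliced (h : D.HalfEdge) : D.HalfEdge :=
  (h.1.partner,
    if (σ h.1.crossing = Splicing.A ↔ h.1.IsPositiveBasis) then !h.2 else h.2)

/-- The marking arrows on both arcs of a splicing run counterclockwise around the crossing, that is,
consistently with an orientation of the disc between the two arcs: from under to over for an
A-splicing, from over to under for a B-splicing. -/
def isSpliceHead (h : D.HalfEdge) : Bool :=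
  match σ h.1.crossing with
  | .A => h.1.isOver
  | .B => !h.1.isOver

/-- The other end of the edge of the diagram that starts with a given half-edge. -/
def edgeEnd (h : D.HalfEdge) : D.HalfEdge :=
  if h.2 then (Passage.nextPassage h.1, false) else (Passage.nextPassage.symm h.1, true)

theorem heads_ncard (z : D.Crossing) :
    {h : D.HalfEdge | h.1.crossing = z ∧ isSpliceHead σ h = true}.ncard = 2 := by
  obtain ⟨z, p, q, hpq, rfl⟩ := z
  -- the passage through this crossing carrying the arrow heads
  obtain ⟨p₀, hp₀, hh⟩ : ∃ p₀ : D.Passage, p₀.crossing = ⟨D.point p, p, q, hpq, rfl⟩ ∧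
      isSpliceHead σ (p₀, true) = true := by
    let p₁ : D.Passage := ⟨p, q, hpq⟩
    by_cases h : isSpliceHead σ (p₁, true) = true
    · exact ⟨p₁, rfl, h⟩
    · refine ⟨p₁.partner, p₁.crossing_partner, ?_⟩
      unfold isSpliceHead at h ⊢
      rw [p₁.crossing_partner, p₁.isOver_partner]
      revert h
      cases σ p₁.crossing <;> cases p₁.isOver <;> simp
  have : {h : D.HalfEdge | h.1.crossing = ⟨D.point p, p, q, hpq, rfl⟩ ∧
      isSpliceHead σ h = true} = {(p₀, true), (p₀, false)} := by
    ext ⟨r, b⟩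
    simp only [Set.mem_ofPred_eq, Set.mem_insert_iff, Set.mem_singleton_iff, Prod.mk.injEq]
    constructor
    · rintro ⟨h1, h2⟩
      have hr : r = p₀ := by
        rcases Passage.eq_or_eq_partner (h1.trans hp₀.symm) with h | h
        · exact h
        · exfalso
          subst h
          unfold isSpliceHead at h2 hh
          simp only [p₀.crossing_partner, p₀.isOver_partner] at h2 hh
          revert h2 hh
          cases σ p₀.crossing <;> cases p₀.isOver <;> simp
      subst hr
      cases b <;> simp
    · rintro (⟨rfl, rfl⟩ | ⟨rfl, rfl⟩)
      · exact ⟨hp₀, hh⟩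
      · exact ⟨hp₀, hh⟩
  rw [this, Set.ncard_pair (by simp)]

variable (D) in
/-- The number of components without crossings. -/
def crossingless : ℕ := Nat.card {c : D.Component // ∀ p : D.Passage, D.componentOf p.1.1 ≠ c}

/-- The marked state of the diagram given by a choice of splicing at each crossing. -/
def state : SignedArrowPresentation where
  Label := D.Crossing
  End := D.HalfEdge
  finiteEnd := inferInstance
  label h := h.1.crossing
  isHead := isSpliceHead σ
  opp := spliced σ
  along := edgeEnd
  sign z := (σ z).sign
  bare := D.crossingless
  opp_opp := by
    rintro ⟨p, b⟩
    have e : (σ p.partner.crossing = Splicing.A ↔ p.partner.IsPositiveBasis) ↔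
        (σ p.crossing = Splicing.A ↔ p.IsPositiveBasis) := by
      rw [p.crossing_partner, p.isPositiveBasis_partner]
    by_cases h : (σ p.crossing = Splicing.A ↔ p.IsPositiveBasis) <;>
      simp [spliced, Passage.partner_partner, e, h]
  isHead_opp := by
    rintro ⟨p, b⟩
    simp only [spliced, isSpliceHead, Passage.crossing_partner, Passage.isOver_partner]
    cases σ p.crossing <;> simp
  label_opp h := h.1.crossing_partner
  along_along := by
    rintro ⟨p, b⟩
    cases b <;> simp [edgeEnd]
  along_ne := by
    rintro ⟨p, b⟩
    cases b <;> simp [edgeEnd]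
  two_arrows := heads_ncard σ

variable (D) in
/-- The set of signed ribbon graphs of a diagram. -/
def ribbonGraphs : Set SignedRibbonGraph :=
  {G | ∃ σ : D.Crossing → Splicing, G = Quotient.mk _ (state σ)}

end LinkDiagram

end

/-! To each component attach two numbers modulo 2: the number of its arcs that are not closed, which
counts how often the curve passes through the boundary circle, and the number of passages that it
makes through crossings. The proof rests on three facts.

Homology is counted by open arcs. The projective plane is double covered by the sphere. Recording
whether a lift of a path changes sheet, relative to an arbitrary choice of one point in each fibre,
gives a mod 2 cocycle. Its value on a component is the number of open arcs, so that number is even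
when the component bounds. Conversely, coning an arc from the centre of the disc shows that modulo
boundaries it is a difference of two radii. Around a component the radii cancel, except for one
diameter for each open arc. All diameters are homologous and twice a diameter bounds, so an even
number of open arcs gives a boundary (`isNullHomologous_iff_sum_open`).

A checkerboard colouring makes the two numbers agree. Follow a component and watch the colour on its
left. It is constant away from crossings, and it flips at each crossing, because the left quadrants
before and after the crossing are separated by the other strand (`exists_leftColour_flip`). It also
flips on passing through the boundary circle: the antipodal map preserves the counterclockwise
direction, but the counterclockwise side of an end point is on the left of an arc that leaves the
disc and on the right of an arc that enters it (`exists_startColour`). After one turn the colour is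
back, so the number of flips is even (`IsCheckerboardColourable.ncard_passage`).

The ribbon graphs know the passages. In every state the heads of the two arrows with a given label
lie on one strand of the crossing and the tails on the other. Labels and heads therefore tell which
half-edges belong to the same passage, and `along` joins consecutive passages. An equivalence of
states thus matches the cycles of passages of the two diagrams (`exists_passage_equiv`), and hence
their lengths.

Together: a checkerboard colourable diagram is null-homologous exactly when all its cycles of
passages have even length, and this property is read off from one state. -/

noncomputable section

open CategoryTheory Limits

/-! ### Mod 2 cochains on singular 1-chains -/

namespace LinkDiagram

/-- A face of a singular simplex of the projective plane. -/
def simplexFace {n : ℕ} (i : Fin (n + 2)) (τ : C(stdSimplex ℝ (Fin (n + 2)), ProjPlane)) :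
    C(stdSimplex ℝ (Fin (n + 1)), ProjPlane) :=
  τ.comp ⟨stdSimplex.map i.succAbove, by continuity⟩

/-- A singular 2-simplex as a singular 2-chain. -/
def simplexChainTwo (τ : C(stdSimplex ℝ (Fin 3), ProjPlane)) : chains.X 2 :=
  (singularProjPlane.ιChainComplex (R := ModuleCat.of ℤ ℤ)
    (((TopCat.of ProjPlane).toSSetObjEquiv (.op (SimplexCategory.mk 2))).symm τ)).hom (1 : ℤ)

theorem boundary_simplexChainTwo (τ : C(stdSimplex ℝ (Fin 3), ProjPlane)) :
    (chains.d 2 1).hom (simplexChainTwo τ) =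
      simplexChain (simplexFace 0 τ) - simplexChain (simplexFace 1 τ)
        + simplexChain (simplexFace 2 τ) := by
  have h := SSet.ιChainComplex_d (R := ModuleCat.of ℤ ℤ) singularProjPlane
    (((TopCat.of ProjPlane).toSSetObjEquiv (.op (SimplexCategory.mk 2))).symm τ)
  have h2 := congrArg (fun f => f.hom (1 : ℤ)) h
  simp only [ModuleCat.hom_comp, LinearMap.comp_apply] at h2
  refine Eq.trans h2 ?_
  rw [Fin.sum_univ_three]
  simp only [ModuleCat.hom_add, LinearMap.add_apply]
  simp
  rw [← sub_eq_add_neg]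
  rfl

/-- The chain group is a coproduct of copies of `ℤ` indexed by the singular simplices, so values
prescribed on simplices extend linearly. -/
theorem exists_cochain (φ : C(stdSimplex ℝ (Fin 2), ProjPlane) → ZMod 2) :
    ∃ Φ : chains.X 1 →ₗ[ℤ] ZMod 2, ∀ σ, Φ (simplexChain σ) = φ σ := by
  let g : chains.X 1 ⟶ ModuleCat.of ℤ (ZMod 2) :=
    Cofan.IsColimit.desc (singularProjPlane.isColimitChainComplexXCofan (ModuleCat.of ℤ ℤ) 1)
      (fun x => ModuleCat.ofHom (LinearMap.toSpanSingleton ℤ (ZMod 2)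
        (φ ((TopCat.of ProjPlane).toSSetObjEquiv (.op (SimplexCategory.mk 1)) x))))
  refine ⟨g.hom, fun σ => ?_⟩
  have h := Cofan.IsColimit.fac
    (singularProjPlane.isColimitChainComplexXCofan (ModuleCat.of ℤ ℤ) 1)
      (fun x => ModuleCat.ofHom (LinearMap.toSpanSingleton ℤ (ZMod 2)
        (φ ((TopCat.of ProjPlane).toSSetObjEquiv (.op (SimplexCategory.mk 1)) x))))
      (((TopCat.of ProjPlane).toSSetObjEquiv (.op (SimplexCategory.mk 1))).symm σ)
  have h2 := congrArg (fun f => f.hom (1 : ℤ)) h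
  refine Eq.trans h2 ?_
  simp

/-- Maps out of the group of 2-chains are determined on single simplices, where the cocycle
condition is the hypothesis. -/
theorem cochain_boundary_eq_zero (Φ : chains.X 1 →ₗ[ℤ] ZMod 2)
    (h : ∀ τ, Φ (simplexChain (simplexFace 0 τ)) - Φ (simplexChain (simplexFace 1 τ))
      + Φ (simplexChain (simplexFace 2 τ)) = 0) (b : chains.X 2) :
    Φ ((chains.d 2 1).hom b) = 0 := by
  have : chains.d 2 1 ≫ ModuleCat.ofHom Φ = (0 : chains.X 2 ⟶ ModuleCat.of ℤ (ZMod 2)) := by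
    refine SSet.chainComplex_hom_ext fun x => ?_
    ext
    obtain ⟨τ, rfl⟩ :=
      ((TopCat.of ProjPlane).toSSetObjEquiv (.op (SimplexCategory.mk 2))).symm.surjective x
    have h1 := congrArg Φ (boundary_simplexChainTwo τ)
    rw [map_add, map_sub, h] at h1
    exact h1
  exact congrArg (fun f => f.hom b) this

end LinkDiagram
end

noncomputable section

/-! ### The double cover of the projective plane -/

/-- The unit sphere of `ℂ × ℝ`. -/
abbrev UnitSphere : Type := {p : ℂ × ℝ // ‖p.1‖ ^ 2 + p.2 ^ 2 = 1}

namespace UnitSphere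

theorem isClosed : IsClosed {p : ℂ × ℝ | ‖p.1‖ ^ 2 + p.2 ^ 2 = 1} :=
  isClosed_eq (by fun_prop) continuous_const

instance : LocallyCompactSpace UnitSphere := isClosed.isClosedEmbedding_subtypeVal.locallyCompactSpace

/-- The antipodal action of `ℤˣ` on the sphere. -/
instance : MulAction ℤˣ UnitSphere where
  smul u p := ⟨(u : ℤ) • p.1, by
    rcases Int.units_eq_one_or u with rfl | rfl <;> simpa using p.2⟩
  one_smul p := Subtype.ext (by change ((1 : ℤˣ) : ℤ) • p.1 = p.1; simp)
  mul_smul u v p := Subtype.ext (by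
    change ((u * v : ℤˣ) : ℤ) • p.1 = (u : ℤ) • (v : ℤ) • p.1; rw [Units.val_mul, mul_smul])

theorem coe_smul (u : ℤˣ) (p : UnitSphere) : ((u • p : UnitSphere) : ℂ × ℝ) = (u : ℤ) • p.1 := rfl

theorem neg_one_smul_ne (p : UnitSphere) : (-1 : ℤˣ) • p ≠ p := by
  intro h
  have h1 := congrArg Subtype.val h
  rw [coe_smul] at h1
  simp only [Units.val_neg, Units.val_one, neg_smul, one_smul] at h1
  have h2 : p.1 = 0 := self_eq_neg.1 h1.symm
  have := p.2
  simp [h2] at this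

instance : ContinuousConstSMul ℤˣ UnitSphere where
  continuous_const_smul u := by
    refine Continuous.subtype_mk ?_ _
    exact (continuous_subtype_val).const_smul (u : ℤ)

instance : IsCancelSMul ℤˣ UnitSphere := by
  refine isCancelSMul_iff_eq_one_of_smul_eq.2 fun u p h => ?_
  rcases Int.units_eq_one_or u with rfl | rfl
  · rfl
  · exact absurd h (neg_one_smul_ne p)

theorem norm_le (p : UnitSphere) : ‖p.1.1‖ ≤ 1 := by
  have := p.2
  nlinarith [sq_nonneg p.1.2, norm_nonneg p.1.1]

open Classical in
/-- The covering map from the sphere to the projective plane. -/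
def toProjPlane (p : UnitSphere) : ProjPlane :=
  if 0 ≤ p.1.2 then ProjPlane.mk ⟨p.1.1, mem_closedBall_zero_iff.2 p.norm_le⟩
  else ProjPlane.mk ⟨-p.1.1, mem_closedBall_zero_iff.2 (by rw [norm_neg]; exact p.norm_le)⟩

theorem norm_fst_of_snd_eq_zero {p : UnitSphere} (h : p.1.2 = 0) : ‖p.1.1‖ = 1 := by
  have := p.2
  rw [h] at this
  nlinarith [norm_nonneg p.1.1]

theorem mk_eq_mk {z w : Disc} :
    ProjPlane.mk z = ProjPlane.mk w ↔ z = w ∨ (‖(z : ℂ)‖ = 1 ∧ (w : ℂ) = -(z : ℂ)) :=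
  Quotient.eq

theorem _root_.ProjPlane.continuous_mk : Continuous ProjPlane.mk := continuous_quotient_mk'

theorem continuous_toProjPlane : Continuous toProjPlane := by
  refine continuous_if_le continuous_const (by fun_prop) ?_ ?_ ?_
  · exact (ProjPlane.continuous_mk.comp (Continuous.subtype_mk (by fun_prop) _)).continuousOn
  · exact (ProjPlane.continuous_mk.comp (Continuous.subtype_mk (by fun_prop) _)).continuousOn
  · intro p hp
    exact mk_eq_mk.2 (Or.inr ⟨norm_fst_of_snd_eq_zero hp.symm, rfl⟩)

/-- The upper hemisphere, as a section over the disc. -/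
def ofDisc (z : Disc) : UnitSphere :=
  ⟨(z, Real.sqrt (1 - ‖(z : ℂ)‖ ^ 2)), by
    have := mem_closedBall_zero_iff.1 z.2
    simp only
    rw [Real.sq_sqrt (by nlinarith [norm_nonneg (z : ℂ)])]
    ring⟩

theorem continuous_ofDisc : Continuous ofDisc := by
  refine Continuous.subtype_mk ?_ _
  fun_prop

theorem toProjPlane_ofDisc (z : Disc) : toProjPlane (ofDisc z) = ProjPlane.mk z := by
  unfold toProjPlane
  rw [if_pos (show 0 ≤ (ofDisc z).1.2 from Real.sqrt_nonneg _)]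
  rfl

theorem toProjPlane_smul (p : UnitSphere) : toProjPlane ((-1 : ℤˣ) • p) = toProjPlane p := by
  unfold toProjPlane
  have h : ((-1 : ℤˣ) • p).1 = -p.1 := by rw [coe_smul]; simp
  simp only [h, Prod.snd_neg, Prod.fst_neg, neg_neg]
  rcases lt_trichotomy p.1.2 0 with h0 | h0 | h0
  · rw [if_pos (by linarith), if_neg (by linarith)]
  · rw [if_pos (by linarith), if_pos (by linarith)]
    exact mk_eq_mk.2 (Or.inr ⟨by simpa using norm_fst_of_snd_eq_zero h0, by simp⟩)
  · rw [if_neg (by linarith), if_pos (by linarith)]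

theorem eq_of_fst_eq {p q : UnitSphere} (hp : 0 ≤ p.1.2) (hq : 0 ≤ q.1.2)
    (h : p.1.1 = q.1.1) : p = q := by
  refine Subtype.ext (Prod.ext h ?_)
  have h1 := p.2
  have h2 := q.2
  rw [h] at h1
  have h3 : p.1.2 ^ 2 = q.1.2 ^ 2 := by linarith
  exact (sq_eq_sq₀ hp hq).1 h3

theorem eq_or_of_toProjPlane_eq {p q : UnitSphere} (h : toProjPlane p = toProjPlane q) :
    p = q ∨ p = (-1 : ℤˣ) • q := by
  -- Signs move both points into the closed upper hemisphere, where `toProjPlane` is the quotient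
  -- map of the disc.
  have hs : ∀ p : UnitSphere, ∃ u : ℤˣ, 0 ≤ (u • p).1.2 := by
    intro p
    rcases le_total 0 p.1.2 with h | h
    · exact ⟨1, by simpa using h⟩
    · exact ⟨-1, by rw [coe_smul]; simpa using h⟩
  have key : ∀ p q : UnitSphere, 0 ≤ p.1.2 → 0 ≤ q.1.2 → toProjPlane p = toProjPlane q →
      p = q ∨ p = (-1 : ℤˣ) • q := by
    intro p q hp hq h
    unfold toProjPlane at h
    rw [if_pos hp, if_pos hq, mk_eq_mk] at h
    rcases h with h | ⟨h1, h2⟩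
    · exact Or.inl (eq_of_fst_eq hp hq (congrArg Subtype.val h))
    · right
      have hp0 : p.1.2 = 0 := by have := p.2; simp only at h1; rw [h1] at this; simpa using this
      have hq0 : q.1.2 = 0 := by
        have := q.2; simp only at h1 h2; rw [h2, norm_neg, h1] at this; simpa using this
      refine Subtype.ext (Prod.ext ?_ ?_)
      · rw [coe_smul]; simp only at h2; simp [h2]
      · rw [coe_smul]; simp [hp0, hq0]
  have huv : ∀ (u : ℤˣ) (p : UnitSphere), toProjPlane (u • p) = toProjPlane p := by
    intro u p
    rcases Int.units_eq_one_or u with rfl | rfl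
    · rw [one_smul]
    · exact toProjPlane_smul p
  obtain ⟨u, hu⟩ := hs p
  obtain ⟨v, hv⟩ := hs q
  have h' : ∃ w : ℤˣ, u • p = w • v • q := by
    rcases key (u • p) (v • q) hu hv (by rw [huv, huv, h]) with h | h
    · exact ⟨1, by rw [h, one_smul]⟩
    · exact ⟨-1, h⟩
  obtain ⟨w, hw⟩ := h'
  have h2 : p = (u⁻¹ * w * v) • q := by
    rw [mul_smul, mul_smul, ← hw, inv_smul_smul]
  rcases Int.units_eq_one_or (u⁻¹ * w * v) with h3 | h3 <;> rw [h3] at h2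
  · left; simpa using h2
  · exact Or.inr h2

/-- The composite with the section `ofDisc` over the disc is the defining quotient map. -/
theorem isQuotientMap_toProjPlane : Topology.IsQuotientMap toProjPlane := by
  refine Topology.IsQuotientMap.of_comp continuous_ofDisc continuous_toProjPlane ?_
  have : toProjPlane ∘ ofDisc = ProjPlane.mk := funext toProjPlane_ofDisc
  rw [this]
  exact isQuotientMap_quot_mk

/-- The antipodal action of the finite group `ℤˣ` on the sphere is free, and its orbits are the
fibres. -/
theorem isCoveringMap_toProjPlane : IsCoveringMap toProjPlane := by
  have h := isQuotientMap_toProjPlane.isQuotientCoveringMap_of_properlyDiscontinuousSMul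
    (G := ℤˣ) (fun {e₁ e₂} => ?_)
  · exact h.isCoveringMap
  · constructor
    · intro h
      rcases eq_or_of_toProjPlane_eq h with h | h
      · exact ⟨1, by simp [h]⟩
      · exact ⟨-1, h.symm⟩
    · rintro ⟨u, rfl⟩
      rcases Int.units_eq_one_or u with rfl | rfl
      · simp
      · exact toProjPlane_smul _

theorem exists_lift {n : ℕ} (σ : C(stdSimplex ℝ (Fin (n + 1)), ProjPlane)) :
    ∃ F : C(stdSimplex ℝ (Fin (n + 1)), UnitSphere), toProjPlane ∘ F = σ := by
  have : LocallyPathConnectedSpace (stdSimplex ℝ (Fin (n + 1))) :=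
    (convex_stdSimplex ℝ (Fin (n + 1))).locallyPathConnectedSpace
  have : ContractibleSpace (stdSimplex ℝ (Fin (n + 1))) :=
    (convex_stdSimplex ℝ (Fin (n + 1))).contractibleSpace ⟨_, (Classical.arbitrary (stdSimplex ℝ (Fin (n + 1)))).2⟩
  obtain ⟨e, he⟩ := isQuotientMap_toProjPlane.surjective (σ (stdSimplex.vertex 0))
  obtain ⟨F, ⟨-, hF⟩, -⟩ :=
    isCoveringMap_toProjPlane.existsUnique_continuousMap_lifts σ (stdSimplex.vertex 0) e he
  exact ⟨F, hF⟩

/-- Lifts that agree somewhere agree everywhere; lifts that agree nowhere are antipodal at every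
point, since fibres have two points. -/
theorem lift_eq_or {X : Type*} [TopologicalSpace X] [PreconnectedSpace X] (F G : C(X, UnitSphere))
    (h : toProjPlane ∘ F = toProjPlane ∘ G) : F = G ∨ ∀ x, F x = (-1 : ℤˣ) • G x := by
  by_cases hx : ∃ x, F x = G x
  · obtain ⟨x, hx⟩ := hx
    left
    exact ContinuousMap.coe_injective
      (isCoveringMap_toProjPlane.eq_of_comp_eq F.continuous G.continuous h x hx)
  · right
    intro x
    rcases eq_or_of_toProjPlane_eq (congrFun h x) with h | h
    · exact absurd ⟨x, h⟩ hx
    · exact h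

open Classical in
/-- A choice of sign for the points of the sphere. -/
def parity (p : UnitSphere) : ZMod 2 :=
  if Function.surjInv isQuotientMap_toProjPlane.surjective (toProjPlane p) = p then 0 else 1

/-- The chosen representative of a fibre is exactly one of its two antipodal points. The choice need
not be continuous, as parities are only compared at the ends of paths. -/
theorem parity_neg (p : UnitSphere) : parity ((-1 : ℤˣ) • p) = parity p + 1 := by
  unfold parity
  rw [toProjPlane_smul]
  set q := Function.surjInv isQuotientMap_toProjPlane.surjective (toProjPlane p) with hq
  have h : q = p ∨ q = (-1 : ℤˣ) • p :=
    eq_or_of_toProjPlane_eq (Function.surjInv_eq isQuotientMap_toProjPlane.surjective _)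
  rcases h with h | h
  · rw [if_pos h, if_neg, zero_add]
    rw [h]
    exact (neg_one_smul_ne p).symm
  · rw [if_pos h, if_neg]
    · decide
    · rw [h]; exact neg_one_smul_ne p

/-- Whether a lift of the path to the sphere changes its parity. -/
def pathParity (σ : C(stdSimplex ℝ (Fin 2), ProjPlane)) : ZMod 2 :=
  parity ((exists_lift σ).choose (stdSimplex.vertex 1))
    + parity ((exists_lift σ).choose (stdSimplex.vertex 0))

/-- Passing to the antipodal lift changes the parity at both ends, so the sum does not depend on the
lift. -/
theorem pathParity_eq (σ : C(stdSimplex ℝ (Fin 2), ProjPlane))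
    (F : C(stdSimplex ℝ (Fin 2), UnitSphere)) (hF : toProjPlane ∘ F = σ) :
    pathParity σ = parity (F (stdSimplex.vertex 1)) + parity (F (stdSimplex.vertex 0)) := by
  rcases lift_eq_or (exists_lift σ).choose F ((exists_lift σ).choose_spec.trans hF.symm) with h | h
  · rw [pathParity, h]
  · rw [pathParity, h, h, parity_neg, parity_neg, add_add_add_comm]
    have : (1 + 1 : ZMod 2) = 0 := by decide
    rw [this, add_zero]

/-- The cocycle condition: a lift of the whole triangle restricts to lifts of its faces, and each
vertex is then counted twice. -/
theorem pathParity_face (τ : C(stdSimplex ℝ (Fin 3), ProjPlane)) :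
    pathParity (LinkDiagram.simplexFace 0 τ) - pathParity (LinkDiagram.simplexFace 1 τ)
      + pathParity (LinkDiagram.simplexFace 2 τ) = 0 := by
  obtain ⟨F, hF⟩ := exists_lift τ
  have h : ∀ i : Fin 3, pathParity (LinkDiagram.simplexFace i τ) =
      parity (F (stdSimplex.vertex (i.succAbove 1))) +
      parity (F (stdSimplex.vertex (i.succAbove 0))) := by
    intro i
    rw [pathParity_eq _ (F.comp ⟨stdSimplex.map i.succAbove, by continuity⟩)]
    · simp [stdSimplex.map_vertex]
    · rw [LinkDiagram.simplexFace, ContinuousMap.coe_comp, ← Function.comp_assoc, hF]; rfl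
  rw [h, h, h]
  have h0 : (0 : Fin 3).succAbove 1 = 2 ∧ (0 : Fin 3).succAbove 0 = 1 ∧
    (1 : Fin 3).succAbove 1 = 2 ∧ (1 : Fin 3).succAbove 0 = 0 ∧ (2 : Fin 3).succAbove 1 = 1 ∧
    (2 : Fin 3).succAbove 0 = 0 := by decide
  obtain ⟨h1, h2, h3, h4, h5, h6⟩ := h0
  rw [h1, h2, h3, h4, h5, h6]
  generalize parity _ = x
  generalize parity _ = y
  generalize parity _ = z
  revert x y z
  decide

end UnitSphere

/-! ### Bounding components have an even number of open arcs -/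

namespace LinkDiagram

variable (D : LinkDiagram)

theorem componentOf_next (a : D.Arc) : D.componentOf (D.next a) = D.componentOf a :=
  Quotient.sound ⟨-1, by simp⟩

-- `next` permutes the arcs of a component. This is what makes sums along a closed curve telescope.
open Classical in
theorem sum_component_next {M : Type*} [AddCommMonoid M] (c : D.Component) (f : D.Arc → M) :
    ∑ a : D.Arc with D.componentOf a = c, f (D.next a) =
      ∑ a : D.Arc with D.componentOf a = c, f a := by
  refine Finset.sum_bij' (fun a _ => D.next a) (fun a _ => D.next.symm a) ?_ ?_ ?_ ?_ ?_
  · intro a ha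
    simpa [componentOf_next] using ha
  · intro a ha
    have := D.componentOf_next (D.next.symm a)
    simp at this
    simpa [← this] using ha
  · simp
  · simp
  · simp

/-- The point of the disc where an arc starts. -/
def arcStart (a : D.Arc) : Disc :=
  ⟨D.γ a 0, mem_closedBall_zero_iff.2 (D.norm_le_one (a, 0) le_rfl zero_le_one)⟩

/-- The point of the disc where an arc ends. -/
def arcEnd (a : D.Arc) : Disc :=
  ⟨D.γ a 1, mem_closedBall_zero_iff.2 (D.norm_le_one (a, 1) zero_le_one le_rfl)⟩

theorem pathParity_arcSimplex (a : D.Arc) :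
    UnitSphere.pathParity (D.arcSimplex a) =
      UnitSphere.parity (UnitSphere.ofDisc (D.arcEnd a)) +
        UnitSphere.parity (UnitSphere.ofDisc (D.arcStart a)) := by
  rw [UnitSphere.pathParity_eq _ ⟨fun x => UnitSphere.ofDisc ⟨D.γ a (x 1), mem_closedBall_zero_iff.2
    (D.norm_le_one (a, x 1) (stdSimplex.zero_le x 1) (stdSimplex.le_one x 1))⟩, ?_⟩]
  · congr 1
  · funext x
    exact UnitSphere.toProjPlane_ofDisc _
  · refine UnitSphere.continuous_ofDisc.comp (Continuous.subtype_mk ?_ _)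
    exact (D.contDiff a).continuous.comp ((continuous_apply 1).comp continuous_subtype_val)

-- A closed arc ends where it starts. An open arc ends at the antipode of the start of the next one;
-- on the boundary circle `ofDisc` has height zero, so the two lifts are antipodal on the sphere and
-- their parities differ by one.
open Classical in
theorem parity_arcEnd (a : D.Arc) :
    UnitSphere.parity (UnitSphere.ofDisc (D.arcEnd a)) =
      UnitSphere.parity (UnitSphere.ofDisc (D.arcStart (D.next a))) +
        if D.IsClosedArc a then 0 else 1 := by
  split_ifs with h
  · rw [add_zero]
    congr 2
    apply Subtype.ext
    have := D.closed_periodic a h 0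
    simpa [arcEnd, arcStart, D.closed_next a h] using this
  · have : UnitSphere.ofDisc (D.arcStart (D.next a)) =
        (-1 : ℤˣ) • UnitSphere.ofDisc (D.arcEnd a) := by
      apply Subtype.ext
      rw [UnitSphere.coe_smul]
      have h1 := D.open_end a h
      have h2 := D.open_next a h
      simp [UnitSphere.ofDisc, arcStart, arcEnd, h1, h2]
    rw [this, UnitSphere.parity_neg, add_assoc]
    have : (1 + 1 : ZMod 2) = 0 := by decide
    rw [this, add_zero]

-- The parities of the starting points telescope, so the cocycle takes on the component the number
-- of open arcs modulo 2; on a boundary it vanishes.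
open Classical in
theorem sum_open_eq_zero_of_boundary (c : D.Component) (b : chains.X 2)
    (hb : (chains.d 2 1).hom b = D.componentCycle c) :
    ∑ a : D.Arc with D.componentOf a = c, (if D.IsClosedArc a then 0 else 1 : ZMod 2) = 0 := by
  obtain ⟨Φ, hΦ⟩ := exists_cochain UnitSphere.pathParity
  have h := cochain_boundary_eq_zero Φ (fun τ => by
    rw [hΦ, hΦ, hΦ]; exact UnitSphere.pathParity_face τ) b
  rw [hb, componentCycle, map_sum] at h
  simp only [hΦ, pathParity_arcSimplex, parity_arcEnd] at h
  rw [Finset.sum_add_distrib, Finset.sum_add_distrib,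
    D.sum_component_next c (fun a => UnitSphere.parity (UnitSphere.ofDisc (D.arcStart a)))] at h
  have h2 : ∀ x y : ZMod 2, x + y + x = 0 → y = 0 := by decide
  exact h2 _ _ h

end LinkDiagram
end

/-! ### Components with an even number of open arcs bound -/

noncomputable section

namespace LinkDiagram

/-- A path in the disc, as a singular 1-simplex of the projective plane. -/
def pathSimplex (g : ℝ → ℂ) (hg : Continuous g) (hb : ∀ t, 0 ≤ t → t ≤ 1 → ‖g t‖ ≤ 1) :
    C(stdSimplex ℝ (Fin 2), ProjPlane) where
  toFun x := ProjPlane.mk ⟨g (x 1), mem_closedBall_zero_iff.2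
    (hb _ (stdSimplex.zero_le x 1) (stdSimplex.le_one x 1))⟩
  continuous_toFun := by
    refine continuous_quotient_mk'.comp (Continuous.subtype_mk ?_ _)
    exact hg.comp ((continuous_apply 1).comp continuous_subtype_val)

theorem add_two (x : stdSimplex ℝ (Fin 2)) : x 0 + x 1 = 1 := by
  have := stdSimplex.sum_eq_one x
  rwa [Fin.sum_univ_two] at this

theorem add_three (x : stdSimplex ℝ (Fin 3)) : x 0 + x 1 + x 2 = 1 := by
  have := stdSimplex.sum_eq_one x
  rwa [Fin.sum_univ_three] at this

theorem face_zero (x : stdSimplex ℝ (Fin 2)) :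
    (stdSimplex.map (Fin.succAbove (0 : Fin 3)) x) 1 = x 0 ∧
    (stdSimplex.map (Fin.succAbove (0 : Fin 3)) x) 2 = x 1 := by
  constructor <;> simp [stdSimplex.map_coe, FunOnFinite.linearMap_apply_apply, Finset.sum_filter,
    Fin.sum_univ_two]

theorem face_one (x : stdSimplex ℝ (Fin 2)) :
    (stdSimplex.map (Fin.succAbove (1 : Fin 3)) x) 1 = 0 ∧
    (stdSimplex.map (Fin.succAbove (1 : Fin 3)) x) 2 = x 1 := by
  constructor <;> simp [stdSimplex.map_coe, FunOnFinite.linearMap_apply_apply, Finset.sum_filter,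
    Fin.sum_univ_two]

theorem face_two (x : stdSimplex ℝ (Fin 2)) :
    (stdSimplex.map (Fin.succAbove (2 : Fin 3)) x) 1 = x 1 ∧
    (stdSimplex.map (Fin.succAbove (2 : Fin 3)) x) 2 = 0 := by
  constructor <;> simp [stdSimplex.map_coe, FunOnFinite.linearMap_apply_apply, Finset.sum_filter,
    Fin.sum_univ_two]
  exact fun h => absurd (by decide) h

/-- The cone with apex `0` over a path in the disc. -/
def coneFun (g : ℝ → ℂ) (x : ℝ × ℝ) : ℂ := ((x.1 + x.2 : ℝ) : ℂ) * g (x.2 / (x.1 + x.2))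

theorem norm_coneFun_le (g : ℝ → ℂ) (hb : ∀ t, 0 ≤ t → t ≤ 1 → ‖g t‖ ≤ 1) {x : ℝ × ℝ}
    (h1 : 0 ≤ x.1) (h2 : 0 ≤ x.2) : ‖coneFun g x‖ ≤ x.1 + x.2 := by
  rw [coneFun, norm_mul, Complex.norm_real, Real.norm_of_nonneg (by positivity)]
  refine mul_le_of_le_one_right (by positivity) (hb _ (by positivity) ?_)
  exact div_le_one_of_le₀ (by linarith) (by positivity)

theorem continuousOn_coneFun (g : ℝ → ℂ) (hg : Continuous g)
    (hb : ∀ t, 0 ≤ t → t ≤ 1 → ‖g t‖ ≤ 1) :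
    ContinuousOn (coneFun g) {x | 0 ≤ x.1 ∧ 0 ≤ x.2} := by
  rintro x ⟨h1, h2⟩
  by_cases h : x.1 + x.2 = 0
  -- At the apex the quotient is the default 0; continuity comes from the norm bound by `x.1 + x.2`,
  -- whatever the value of `g`.
  · have h0 : coneFun g x = 0 := by simp [coneFun, h]
    rw [ContinuousWithinAt, h0]
    refine squeeze_zero_norm' (a := fun y : ℝ × ℝ => y.1 + y.2) ?_ ?_
    · filter_upwards [self_mem_nhdsWithin] with y hy
      exact norm_coneFun_le g hb hy.1 hy.2
    · have : Filter.Tendsto (fun y : ℝ × ℝ => y.1 + y.2) (𝓝 x) (𝓝 (x.1 + x.2)) :=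
        (continuous_fst.add continuous_snd).tendsto x
      rw [h] at this
      exact this.mono_left nhdsWithin_le_nhds
  · refine ContinuousAt.continuousWithinAt ?_
    unfold coneFun
    refine ContinuousAt.mul (by fun_prop) (hg.continuousAt.comp ?_)
    exact ContinuousAt.div (by fun_prop) (by fun_prop) h

/-- The cone over a path in the disc, as a singular 2-simplex of the projective plane. -/
def coneSimplex (g : ℝ → ℂ) (hg : Continuous g) (hb : ∀ t, 0 ≤ t → t ≤ 1 → ‖g t‖ ≤ 1) :
    C(stdSimplex ℝ (Fin 3), ProjPlane) where
  toFun x := ProjPlane.mk ⟨coneFun g (x 1, x 2), mem_closedBall_zero_iff.2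
    ((norm_coneFun_le g hb (stdSimplex.zero_le x 1) (stdSimplex.zero_le x 2)).trans
      (by have := add_three x; have := stdSimplex.zero_le x 0; simp only; linarith))⟩
  continuous_toFun := by
    refine continuous_quotient_mk'.comp (Continuous.subtype_mk ?_ _)
    refine (continuousOn_coneFun g hg hb).comp_continuous ?_
      (fun x => ⟨stdSimplex.zero_le x 1, stdSimplex.zero_le x 2⟩)
    exact ((continuous_apply 1).comp continuous_subtype_val).prodMk
      ((continuous_apply 2).comp continuous_subtype_val)

/-- The radial path from the centre to a point of the disc. -/
def radial (z : Disc) : C(stdSimplex ℝ (Fin 2), ProjPlane) :=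
  pathSimplex (fun t => t * (z : ℂ)) (by fun_prop) (fun t h0 h1 => by
    rw [norm_mul, Complex.norm_real, Real.norm_of_nonneg h0]
    exact mul_le_one₀ h1 (norm_nonneg _) (mem_closedBall_zero_iff.1 z.2))

/-- The group of boundaries of singular 2-chains. -/
abbrev boundaries : Submodule ℤ (chains.X 1) := LinearMap.range (chains.d 2 1).hom

/-- The class of a singular 1-simplex modulo boundaries. -/
def simplexClass (σ : C(stdSimplex ℝ (Fin 2), ProjPlane)) : chains.X 1 ⧸ boundaries :=
  boundaries.mkQ (simplexChain σ)

/-- The faces of the cone from the centre are the path and the radii to its two ends, so the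
boundary of the cone is the relation. -/
theorem simplexClass_path (g : ℝ → ℂ) (hg : Continuous g)
    (hb : ∀ t, 0 ≤ t → t ≤ 1 → ‖g t‖ ≤ 1) :
    simplexClass (pathSimplex g hg hb) =
      simplexClass (radial ⟨g 1, mem_closedBall_zero_iff.2 (hb 1 zero_le_one le_rfl)⟩) -
      simplexClass (radial ⟨g 0, mem_closedBall_zero_iff.2 (hb 0 le_rfl zero_le_one)⟩) := by
  have h := boundary_simplexChainTwo (coneSimplex g hg hb)
  have h0 : simplexFace 0 (coneSimplex g hg hb) = pathSimplex g hg hb := by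
    ext x
    change ProjPlane.mk _ = ProjPlane.mk _
    congr 2
    change coneFun g (_, _) = g (x 1)
    obtain ⟨e1, e2⟩ := face_zero x
    erw [e1, e2]
    simp [coneFun, add_two x]
  have h1 : simplexFace 1 (coneSimplex g hg hb) =
      radial ⟨g 1, mem_closedBall_zero_iff.2 (hb 1 zero_le_one le_rfl)⟩ := by
    ext x
    change ProjPlane.mk _ = ProjPlane.mk _
    congr 2
    change coneFun g (_, _) = (x 1 : ℂ) * g 1
    obtain ⟨e1, e2⟩ := face_one x
    erw [e1, e2]
    by_cases hx : x 1 = 0 <;> simp [coneFun, hx]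
  have h2 : simplexFace 2 (coneSimplex g hg hb) =
      radial ⟨g 0, mem_closedBall_zero_iff.2 (hb 0 le_rfl zero_le_one)⟩ := by
    ext x
    change ProjPlane.mk _ = ProjPlane.mk _
    congr 2
    change coneFun g (_, _) = (x 1 : ℂ) * g 0
    obtain ⟨e1, e2⟩ := face_two x
    erw [e1, e2]
    simp [coneFun]
  rw [h0, h1, h2] at h
  have h3 : boundaries.mkQ ((chains.d 2 1).hom (simplexChainTwo (coneSimplex g hg hb))) = 0 :=
    (Submodule.Quotient.mk_eq_zero _).2 ⟨_, rfl⟩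
  rw [h, map_add, map_sub] at h3
  unfold simplexClass
  rw [eq_sub_iff_add_eq, ← sub_eq_zero, ← h3]
  abel

/-- The antipode of a point of the disc. -/
def _root_.Disc.neg (z : Disc) : Disc :=
  ⟨-z, mem_closedBall_zero_iff.2 (by rw [norm_neg]; exact mem_closedBall_zero_iff.1 z.2)⟩

/-- The class of a diameter modulo boundaries. -/
def diameterClass (z : Disc) : chains.X 1 ⧸ boundaries :=
  simplexClass (radial z) - simplexClass (radial z.neg)

/-- A circular path from `z` to `w` and its antipodal image are the same simplex of the projective
plane. Writing it in both ways as a difference of radii compares the two diameters. -/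
theorem diameterClass_rotate (z w : Disc) (hz : ‖(z : ℂ)‖ = 1) (hw : ‖(w : ℂ)‖ = 1) :
    diameterClass z = diameterClass w := by
  obtain ⟨θ, hθ⟩ := Complex.norm_eq_one_iff _ |>.1 (show ‖(w : ℂ) / z‖ = 1 by simp [hz, hw])
  have hz0 : (z : ℂ) ≠ 0 := by intro h; simp [h] at hz
  let g : ℝ → ℂ := fun t => Complex.exp ((t * θ : ℝ) * Complex.I) * z
  have hg : Continuous g := by fun_prop
  have hn : ∀ t, ‖g t‖ = 1 := fun t => by
    simp only [g]
    rw [norm_mul, Complex.norm_exp_ofReal_mul_I, hz, one_mul]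
  have hb : ∀ t, 0 ≤ t → t ≤ 1 → ‖g t‖ ≤ 1 := fun t _ _ => (hn t).le
  have hb' : ∀ t, 0 ≤ t → t ≤ 1 → ‖(fun s => -g s) t‖ ≤ 1 := fun t _ _ => by
    simp only [norm_neg]; exact (hn t).le
  have e : pathSimplex g hg hb = pathSimplex (fun s => -g s) hg.neg hb' := by
    ext x
    exact UnitSphere.mk_eq_mk.2 (Or.inr ⟨hn _, rfl⟩)
  have h1 := simplexClass_path g hg hb
  rw [e, simplexClass_path] at h1
  have g1 : g 1 = w := by
    simp only [g, one_mul]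
    rw [hθ, div_mul_cancel₀ _ hz0]
  have g0 : g 0 = z := by simp [g]
  simp only [g1, g0] at h1
  unfold diameterClass Disc.neg
  rw [sub_eq_sub_iff_add_eq_add] at h1 ⊢
  rw [add_comm, ← h1, add_comm]

/-- Exchanging the ends of a diameter negates its class, but by rotation it does not change it. -/
theorem two_diameterClass (z : Disc) (hz : ‖(z : ℂ)‖ = 1) : (2 : ℕ) • diameterClass z = 0 := by
  have h := diameterClass_rotate z z.neg hz (by simpa [Disc.neg] using hz)
  have h2 : z.neg.neg = z := Subtype.ext (neg_neg _)
  have h3 : diameterClass z.neg = - diameterClass z := by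
    unfold diameterClass
    rw [h2, neg_sub]
  rw [two_nsmul]
  nth_rewrite 1 [h]
  rw [h3, neg_add_cancel]

variable (D : LinkDiagram)

theorem simplexClass_arc (a : D.Arc) : simplexClass (D.arcSimplex a) =
    simplexClass (radial (D.arcEnd a)) - simplexClass (radial (D.arcStart a)) :=
  simplexClass_path (D.γ a) (D.contDiff a).continuous
    (fun t h0 h1 => D.norm_le_one (a, t) h0 h1)

-- Modulo boundaries the radii cancel around the component. Each open arc leaves one diameter,
-- because the next arc starts at the other end of the diameter through its end point; pairs of
-- diameters vanish.
open Classical in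
theorem exists_boundary_of_sum_open (c : D.Component)
    (h : ∑ a : D.Arc with D.componentOf a = c, (if D.IsClosedArc a then 0 else 1 : ZMod 2) = 0) :
    ∃ b : chains.X 2, (chains.d 2 1).hom b = D.componentCycle c := by
  suffices hs : boundaries.mkQ (D.componentCycle c) = 0 from
    (Submodule.Quotient.mk_eq_zero _).1 hs
  let z : Disc := ⟨1, by simp⟩
  have hz : ‖(z : ℂ)‖ = 1 := by simp [z]
  have harc : ∀ a : D.Arc, simplexClass (radial (D.arcEnd a)) =
      simplexClass (radial (D.arcStart (D.next a))) +
        (if D.IsClosedArc a then 0 else 1 : ℕ) • diameterClass z := by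
    intro a
    split_ifs with ha
    · rw [zero_nsmul, add_zero]
      congr 2
      apply Subtype.ext
      have := D.closed_periodic a ha 0
      simpa [arcEnd, arcStart, D.closed_next a ha] using this
    · have e : D.arcStart (D.next a) = (D.arcEnd a).neg := Subtype.ext (D.open_next a ha)
      rw [one_nsmul, diameterClass_rotate z (D.arcEnd a) hz (D.open_end a ha), e, diameterClass]
      abel
  rw [componentCycle, map_sum]
  change ∑ a : D.Arc with D.componentOf a = c, simplexClass (D.arcSimplex a) = 0
  simp only [simplexClass_arc, harc]
  rw [Finset.sum_sub_distrib, Finset.sum_add_distrib,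
    D.sum_component_next c (fun a => simplexClass (radial (D.arcStart a))), add_sub_cancel_left,
    ← Finset.sum_smul]
  have hev : (2 : ℕ) ∣ ∑ a : D.Arc with D.componentOf a = c, (if D.IsClosedArc a then 0 else 1) := by
    rw [← ZMod.natCast_eq_zero_iff]
    push_cast
    exact h
  obtain ⟨k, hk⟩ := hev
  rw [hk, mul_comm, mul_nsmul', two_diameterClass z hz, smul_zero]

open Classical in
theorem isNullHomologous_iff_sum_open : D.IsNullHomologous ↔ ∀ c : D.Component,
    ∑ a : D.Arc with D.componentOf a = c, (if D.IsClosedArc a then 0 else 1 : ZMod 2) = 0 :=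
  forall_congr' fun c => ⟨fun ⟨b, hb⟩ => D.sum_open_eq_zero_of_boundary c b hb,
    D.exists_boundary_of_sum_open c⟩

end LinkDiagram
end

/-! ### Cycles of passages and their recovery from a state -/

noncomputable section

namespace LinkDiagram

variable {D D' : LinkDiagram}

namespace Passage

theorem follows_arc {p q : D.Passage} (h : Follows p q) : D.next.SameCycle p.1.1 q.1.1 := by
  obtain ⟨τ, -, ⟨n, hn, -⟩, -⟩ := h
  exact ⟨n, by rw [zpow_natCast, hn]⟩

theorem sameCycle_next_of_sameCycle {p q : D.Passage} (h : nextPassage.SameCycle p q) :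
    D.next.SameCycle p.1.1 q.1.1 := by
  have hn : ∀ (n : ℕ) (p : D.Passage), D.next.SameCycle p.1.1 ((nextPassage ^ n) p).1.1 := by
    intro n
    induction n with
    | zero => intro p; exact Equiv.Perm.SameCycle.refl _ _
    | succ n ih =>
      intro p
      rw [pow_succ', Equiv.Perm.mul_apply]
      exact (ih p).trans (follows_arc (follows_nextPassage _))
  obtain ⟨n, -, -, rfl⟩ := h.exists_pow_eq'
  exact hn n p

theorem sameCycle_of_madeAt {p q : D.Passage} {τ : ℝ} (hτ : p.1.2 ≤ τ)
    (h : MadeAt p.1.1 q τ) : nextPassage.SameCycle p q := by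
  -- The passages of the cycle of `p` made up to time `τ`. If the last of them were before `q`, the
  -- passage following it would come no later than `q` and be a later member.
  let S : Set (ℕ × D.Passage) := {x | (x.1 : ℝ) ≤ τ ∧ x.2.1.1 = (D.next ^ x.1) p.1.1 ∧
    p.1.2 ≤ x.1 + x.2.1.2 ∧ x.1 + x.2.1.2 ≤ τ ∧ nextPassage.SameCycle p x.2}
  have hfin : S.Finite := by
    refine ((Set.finite_Iic ⌊τ⌋₊).prod (Set.finite_univ (α := D.Passage))).subset ?_
    exact fun x hx => ⟨Nat.le_floor hx.1, trivial⟩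
  have hne : S.Nonempty := ⟨(0, p), by
    refine ⟨?_, rfl, by simp, by simpa using hτ, Equiv.Perm.SameCycle.refl _ _⟩
    simpa using p.time_nonneg.trans hτ⟩
  obtain ⟨⟨n, r⟩, ⟨-, hr, h1, h2, h3⟩, hmax⟩ :=
    hfin.exists_maximalFor (fun x => (x.1 : ℝ) + x.2.1.2) S hne
  simp only at hr h1 h2 h3
  rcases h2.eq_or_lt with h2 | h2
  · have : r = q := madeAt_unique ⟨n, hr, h2.symm⟩ h
    rwa [← this]
  · exfalso
    obtain ⟨τ', hlt, ⟨m, hm, hτ'⟩, hmin⟩ := follows_nextPassage r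
    obtain ⟨k, hk, hkτ⟩ := h
    have hnk : n ≤ k := by
      have a1 := r.time_nonneg
      have a2 := q.time_lt_one
      have : (n : ℝ) < k + 1 := by linarith
      have : n < k + 1 := by exact_mod_cast this
      omega
    obtain ⟨j, rfl⟩ := Nat.exists_eq_add_of_le hnk
    push_cast at hkτ
    have hle : τ' ≤ j + q.1.2 := hmin q _ (by linarith) ⟨j, by
      rw [hk, hr, ← Equiv.Perm.mul_apply, ← pow_add, add_comm], rfl⟩
    have h0 := (nextPassage r).time_nonneg
    have hmem : (n + m, nextPassage r) ∈ S := by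
      refine ⟨?_, ?_, ?_, ?_, h3.trans ⟨1, by simp⟩⟩
      · push_cast; linarith
      · simp only; rw [hm, hr, ← Equiv.Perm.mul_apply, ← pow_add, add_comm]
      · push_cast; linarith
      · push_cast; linarith
    have := hmax hmem (by simp only; push_cast; linarith)
    simp only at this
    push_cast at this
    linarith

theorem sameCycle_iff {p q : D.Passage} :
    nextPassage.SameCycle p q ↔ D.componentOf q.1.1 = D.componentOf p.1.1 := by
  constructor
  · intro h
    exact Quotient.sound (sameCycle_next_of_sameCycle h).symm
  · intro h
    have h' : D.next.SameCycle q.1.1 p.1.1 := Quotient.exact h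
    -- A positive exponent is needed: after at least one full arc the passage `q` is certainly made
    -- later than `p`, even when both are on one arc.
    obtain ⟨n, hn0, -, hn⟩ := h'.symm.exists_pow_eq''
    refine sameCycle_of_madeAt (τ := n + q.1.2) ?_ ⟨n, hn.symm, rfl⟩
    have h1 := p.time_lt_one
    have h2 := q.time_nonneg
    have h3 : (1 : ℝ) ≤ n := by exact_mod_cast hn0
    linarith

end Passage

open Passage

/-- In either splicing the heads at a crossing all lie on one strand and the tails on the other. So
the label and the kind of an arrow end determine its passage. -/
theorem eq_of_crossing_eq_of_isSpliceHead_eq {σ : D.Crossing → Splicing} {h k : D.HalfEdge}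
    (hc : h.1.crossing = k.1.crossing) (hh : isSpliceHead σ h = isSpliceHead σ k) :
    h.1 = k.1 := by
  rcases Passage.eq_or_eq_partner hc with e | e
  · exact e
  · exfalso
    unfold isSpliceHead at hh
    rw [e, crossing_partner, isOver_partner] at hh
    revert hh
    cases σ k.1.crossing <;> cases k.1.isOver <;> simp

/-- An edge of the diagram leads to the following or to the preceding passage. The map may reverse
directions, but in both cases it stays in one cycle. -/
theorem sameCycle_of_edgeEnd (f : D.HalfEdge ≃ D'.HalfEdge)
    (hf : ∀ h k : D.HalfEdge, h.1 = k.1 → (f h).1 = (f k).1)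
    (he : ∀ h, edgeEnd (f h) = f (edgeEnd h)) {p q : D.Passage}
    (hpq : nextPassage.SameCycle p q) :
    nextPassage.SameCycle (f (p, true)).1 (f (q, true)).1 := by
  have hE : ∀ h : D'.HalfEdge, nextPassage.SameCycle h.1 (edgeEnd h).1 := by
    rintro ⟨r, b⟩
    cases b
    · exact ⟨-1, by simp [edgeEnd]⟩
    · exact ⟨1, by simp [edgeEnd]⟩
  have h1 : ∀ p : D.Passage,
      nextPassage.SameCycle (f (p, true)).1 (f (nextPassage p, true)).1 := by
    intro p
    have := hE (f (p, true))
    rwa [he, hf (edgeEnd (p, true)) (nextPassage p, true) (by simp [edgeEnd])] at this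
  have hn : ∀ (n : ℕ) (p : D.Passage),
      nextPassage.SameCycle (f (p, true)).1 (f ((nextPassage ^ n) p, true)).1 := by
    intro n
    induction n with
    | zero => intro p; exact Equiv.Perm.SameCycle.refl _ _
    | succ n ih =>
      intro p
      rw [pow_succ', Equiv.Perm.mul_apply]
      exact (ih p).trans (h1 _)
  obtain ⟨n, -, -, rfl⟩ := hpq.exists_pow_eq'
  exact hn n p

/-- Reversing both arrows of a label exchanges heads and tails on both strands at once, so the
grouping of half-edges into passages survives, and `f` descends to passages. -/
theorem exists_passage_equiv_of_halfEdge_equiv {σ : D.Crossing → Splicing}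
    {σ' : D'.Crossing → Splicing} (f : D.HalfEdge ≃ D'.HalfEdge) (g : D.Crossing ≃ D'.Crossing)
    (flip : D.Crossing → Bool) (h1 : ∀ e, (f e).1.crossing = g e.1.crossing)
    (h2 : ∀ e, isSpliceHead σ' (f e) = xor (isSpliceHead σ e) (flip e.1.crossing))
    (he : ∀ h, edgeEnd (f h) = f (edgeEnd h)) :
    ∃ φ : D.Passage ≃ D'.Passage, ∀ p q,
      nextPassage.SameCycle p q ↔ nextPassage.SameCycle (φ p) (φ q) := by
  have key : ∀ {D D' : LinkDiagram} {σ : D.Crossing → Splicing} {σ' : D'.Crossing → Splicing}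
      (f : D.HalfEdge ≃ D'.HalfEdge) (g : D.Crossing → D'.Crossing) (flip : D.Crossing → Bool),
      (∀ e, (f e).1.crossing = g e.1.crossing) →
      (∀ e, isSpliceHead σ' (f e) = xor (isSpliceHead σ e) (flip e.1.crossing)) →
      ∀ h k : D.HalfEdge, h.1 = k.1 → (f h).1 = (f k).1 := by
    intro D D' σ σ' f g flip h1 h2 h k hk
    refine eq_of_crossing_eq_of_isSpliceHead_eq (σ := σ') (by rw [h1, h1, hk]) ?_
    rw [h2, h2, hk]
    unfold isSpliceHead
    rw [hk]
  have hf : ∀ h k : D.HalfEdge, h.1 = k.1 → (f h).1 = (f k).1 := key f g flip h1 h2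
  have h1' : ∀ e : D'.HalfEdge, (f.symm e).1.crossing = g.symm e.1.crossing := by
    intro e
    rw [Equiv.eq_symm_apply]
    have := h1 (f.symm e)
    rw [Equiv.apply_symm_apply] at this
    exact this.symm
  have hf' : ∀ h k : D'.HalfEdge, h.1 = k.1 → (f.symm h).1 = (f.symm k).1 := by
    refine key (σ := σ') (σ' := σ) f.symm g.symm (fun l => flip (g.symm l)) h1' ?_
    intro e
    have := h2 (f.symm e)
    rw [Equiv.apply_symm_apply] at this
    rw [this, h1']
    simp
  have he' : ∀ h : D'.HalfEdge, edgeEnd (f.symm h) = f.symm (edgeEnd h) := by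
    intro h
    rw [Equiv.eq_symm_apply]
    have := he (f.symm h)
    rw [Equiv.apply_symm_apply] at this
    exact this.symm
  let φ : D.Passage ≃ D'.Passage :=
    { toFun := fun p => (f (p, true)).1
      invFun := fun p => (f.symm (p, true)).1
      left_inv := fun p => by
        have := hf' ((f (p, true)).1, true) (f (p, true)) rfl
        rw [Equiv.symm_apply_apply] at this
        exact this
      right_inv := fun p => by
        have := hf ((f.symm (p, true)).1, true) (f.symm (p, true)) rfl
        rw [Equiv.apply_symm_apply] at this
        exact this }
  refine ⟨φ, fun p q => ⟨sameCycle_of_edgeEnd f hf he, fun hpq => ?_⟩⟩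
  have := sameCycle_of_edgeEnd f.symm hf' he' hpq
  change nextPassage.SameCycle (φ.symm (φ p)) (φ.symm (φ q)) at this
  simpa using this

/-- One state is enough: the all-`A` state of one diagram is equivalent to some state of the other.
-/
theorem exists_passage_equiv (h : D.ribbonGraphs = D'.ribbonGraphs) :
    ∃ φ : D.Passage ≃ D'.Passage, ∀ p q,
      nextPassage.SameCycle p q ↔ nextPassage.SameCycle (φ p) (φ q) := by
  have hm : Quotient.mk _ (state (D := D) fun _ => Splicing.A) ∈ D'.ribbonGraphs := by
    rw [← h]; exact ⟨_, rfl⟩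
  obtain ⟨σ', hσ'⟩ := hm
  obtain ⟨f, g, flip, h1, h2, -, h4, -⟩ := Quotient.exact hσ'
  exact exists_passage_equiv_of_halfEdge_equiv (σ := fun _ => Splicing.A) (σ' := σ')
    f g flip h1 h2 h4

/-- Every closed curve makes an even number of passages through crossings. -/
def HasEvenCycles (D : LinkDiagram) : Prop :=
  ∀ p : D.Passage, Even {q : D.Passage | nextPassage.SameCycle p q}.ncard

theorem hasEvenCycles_of_equiv (φ : D.Passage ≃ D'.Passage)
    (hφ : ∀ p q, nextPassage.SameCycle p q ↔ nextPassage.SameCycle (φ p) (φ q))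
    (h : D'.HasEvenCycles) : D.HasEvenCycles := by
  intro p
  have e : {q : D'.Passage | nextPassage.SameCycle (φ p) q} =
      φ '' {q : D.Passage | nextPassage.SameCycle p q} := by
    ext q
    constructor
    · intro hq
      exact ⟨φ.symm q, by simpa [hφ] using hq, by simp⟩
    · rintro ⟨r, hr, rfl⟩
      exact (hφ _ _).1 hr
  have := h (φ p)
  rwa [e, Set.ncard_image_of_injective _ φ.injective] at this

theorem hasEvenCycles_iff_of_ribbonGraphs_eq (h : D.ribbonGraphs = D'.ribbonGraphs) :
    D.HasEvenCycles ↔ D'.HasEvenCycles := by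
  obtain ⟨φ, hφ⟩ := exists_passage_equiv h
  refine ⟨hasEvenCycles_of_equiv φ.symm fun p q => ?_, hasEvenCycles_of_equiv φ hφ⟩
  rw [hφ]
  simp

-- The hypothesis is the parity identity that a checkerboard colouring provides. Components with
-- passages correspond to cycles of `nextPassage`; the others have zero passages.
open Classical in
theorem isNullHomologous_iff_hasEvenCycles (D : LinkDiagram)
    (h : ∀ c : D.Component,
      (({p : D.Passage | D.componentOf p.1.1 = c}.ncard : ℕ) : ZMod 2) =
        ∑ a : D.Arc with D.componentOf a = c, (if D.IsClosedArc a then 0 else 1)) :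
    D.IsNullHomologous ↔ D.HasEvenCycles := by
  rw [isNullHomologous_iff_sum_open]
  simp only [← h, ZMod.natCast_eq_zero_iff, ← even_iff_two_dvd]
  constructor
  · intro hc p
    have := hc (D.componentOf p.1.1)
    simpa only [sameCycle_iff] using this
  · intro hp c
    by_cases hc : ∃ p : D.Passage, D.componentOf p.1.1 = c
    · obtain ⟨p, rfl⟩ := hc
      have := hp p
      simpa only [sameCycle_iff] using this
    · have : {p : D.Passage | D.componentOf p.1.1 = c} = ∅ :=
        Set.eq_empty_of_forall_notMem fun p hp => hc ⟨p, hp⟩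
      simp [this]

end LinkDiagram
end

/-! ### Regions and colours of points off the curves -/

noncomputable section

namespace LinkDiagram

variable (D : LinkDiagram)

/-- The points of the plane on an arc. -/
def trace : Set ℂ := {z | ∃ b : D.Arc, ∃ s : ℝ, 0 ≤ s ∧ s ≤ 1 ∧ D.γ b s = z}

/-- The points of the disc off the curves of the diagram. -/
def free : Set ℂ :=
  {z | ∃ hz : ‖z‖ ≤ 1, ProjPlane.mk ⟨z, mem_closedBall_zero_iff.2 hz⟩ ∉ D.curves}

/-- The region of a point off the curves. -/
def regionAt (z : ℂ) (h : z ∈ D.free) : D.Region :=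
  ConnectedComponents.mk ⟨ProjPlane.mk ⟨z, mem_closedBall_zero_iff.2 h.1⟩, h.2⟩

variable {D}

theorem point_mem_trace {p : D.Arc × ℝ} (hp : p ∈ D.params) : D.point p ∈ D.trace :=
  ⟨p.1, p.2, hp.1, hp.2.1, rfl⟩

/-- A boundary point is identified with its antipode, which must therefore be off the arcs too. -/
theorem mem_free {z : ℂ} (hz : ‖z‖ ≤ 1) (h : z ∉ D.trace) (h' : ‖z‖ = 1 → -z ∉ D.trace) :
    z ∈ D.free := by
  refine ⟨hz, ?_⟩
  rintro ⟨y, hy, p, hp, hpy⟩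
  rcases UnitSphere.mk_eq_mk.1 hy with e | ⟨e1, e2⟩
  · exact h (by rw [e] at hpy; change D.point p = z at hpy; rw [← hpy]; exact point_mem_trace hp)
  · simp only at e2
    refine h' (by rw [e2, norm_neg, e1]) ?_
    rw [e2, neg_neg, ← hpy]
    exact point_mem_trace hp

theorem mem_free_of_norm_lt {z : ℂ} (hz : ‖z‖ < 1) (h : z ∉ D.trace) : z ∈ D.free :=
  mem_free hz.le h fun h1 => absurd h1 hz.ne

theorem regionAt_eq_of_isPreconnected {S : Set ℂ} (hS : IsPreconnected S) (hfree : S ⊆ D.free)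
    {z w : ℂ} (hz : z ∈ S) (hw : w ∈ S) :
    D.regionAt z (hfree hz) = D.regionAt w (hfree hw) := by
  have := isPreconnected_iff_preconnectedSpace.1 hS
  let j : S → {x : ProjPlane // x ∉ D.curves} := fun z =>
    ⟨ProjPlane.mk ⟨z, mem_closedBall_zero_iff.2 (hfree z.2).1⟩, (hfree z.2).2⟩
  have hj : Continuous j :=
    Continuous.subtype_mk (ProjPlane.continuous_mk.comp
      (Continuous.subtype_mk continuous_subtype_val _)) _
  have h1 : IsPreconnected (Set.range j) := isPreconnected_range hj
  exact ConnectedComponents.coe_eq_coe'.2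
    (h1.subset_connectedComponent ⟨⟨w, hw⟩, rfl⟩ ⟨⟨z, hz⟩, rfl⟩)

open Classical in
/-- The colour of a point off the curves. -/
def colourAt (col : D.Region → ZMod 2) (z : ℂ) : ZMod 2 :=
  if h : z ∈ D.free then col (D.regionAt z h) else 0

variable (col : D.Region → ZMod 2)

theorem colourAt_eq {z : ℂ} (h : z ∈ D.free) : colourAt col z = col (D.regionAt z h) := dif_pos h

theorem colourAt_eq_of_isPreconnected {S : Set ℂ} (hS : IsPreconnected S) (hfree : S ⊆ D.free)
    {z w : ℂ} (hz : z ∈ S) (hw : w ∈ S) : colourAt col z = colourAt col w := by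
  rw [colourAt_eq col (hfree hz), colourAt_eq col (hfree hw),
    regionAt_eq_of_isPreconnected hS hfree hz hw]

theorem colourAt_neg {z : ℂ} (hz : ‖z‖ = 1) (h : z ∈ D.free) :
    colourAt col (-z) = colourAt col z := by
  have e : ProjPlane.mk ⟨-z, mem_closedBall_zero_iff.2 (by rw [norm_neg, hz])⟩ =
      ProjPlane.mk ⟨z, mem_closedBall_zero_iff.2 hz.le⟩ :=
    UnitSphere.mk_eq_mk.2 (Or.inr ⟨by simpa using hz, by simp⟩)
  have h' : -z ∈ D.free := ⟨by rw [norm_neg, hz], by rw [e]; exact h.2⟩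
  rw [colourAt_eq col h, colourAt_eq col h']
  congr 1
  unfold regionAt
  congr 2

/-- A ball meets a convex set in a connected set, so its image lies in a single region. Every local
constancy of colours below comes from this, applied to suitable coordinates `F` near a curve. -/
theorem exists_eventually_region {X : Type*} [NormedAddCommGroup X] [NormedSpace ℝ X] {C : Set X}
    (hC : Convex ℝ C) (x₀ : X) [(𝓝[C] x₀).NeBot] (F : X → ℂ) (hF : ContinuousOn F C)
    (h : ∀ᶠ x in 𝓝[C] x₀, F x ∈ D.free) :
    ∃ r : D.Region, ∀ᶠ x in 𝓝[C] x₀, ∃ hx : F x ∈ D.free, D.regionAt (F x) hx = r := by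
  obtain ⟨δ, hδ, hsub⟩ := Metric.mem_nhdsWithin_iff.1 h
  have hS : IsPreconnected (F '' (Metric.ball x₀ δ ∩ C)) :=
    ((convex_ball x₀ δ).inter hC).isPreconnected.image F (hF.mono Set.inter_subset_right)
  have hfree : F '' (Metric.ball x₀ δ ∩ C) ⊆ D.free := by
    rintro _ ⟨x, hx, rfl⟩
    exact hsub hx
  have hmem : Metric.ball x₀ δ ∩ C ∈ 𝓝[C] x₀ :=
    Metric.mem_nhdsWithin_iff.2 ⟨δ, hδ, subset_rfl⟩
  obtain ⟨y, hy⟩ := Filter.nonempty_of_mem hmem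
  refine ⟨D.regionAt (F y) (hfree ⟨y, hy, rfl⟩), ?_⟩
  filter_upwards [hmem] with x hx
  exact ⟨hfree ⟨x, hx, rfl⟩, regionAt_eq_of_isPreconnected hS hfree ⟨x, hx, rfl⟩ ⟨y, hy, rfl⟩⟩

theorem exists_eventually_colour {X : Type*} [NormedAddCommGroup X] [NormedSpace ℝ X] {C : Set X}
    (hC : Convex ℝ C) (x₀ : X) [(𝓝[C] x₀).NeBot] (F : X → ℂ) (hF : ContinuousOn F C)
    (h : ∀ᶠ x in 𝓝[C] x₀, F x ∈ D.free) :
    ∃ q, ∀ᶠ x in 𝓝[C] x₀, F x ∈ D.free ∧ colourAt col (F x) = q := by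
  obtain ⟨r, hr⟩ := exists_eventually_region hC x₀ F hF h
  refine ⟨col r, ?_⟩
  filter_upwards [hr] with x hx
  obtain ⟨hx, e⟩ := hx
  exact ⟨hx, by rw [colourAt_eq col hx, e]⟩

/-! ### The arcs near a point -/

/-- The remaining parameters of each of the finitely many arcs trace a compact set that misses `z₀`.
-/
theorem eventually_mem_of_trace (z₀ : ℂ) (O : D.Arc → Set ℝ) (hO : ∀ b, IsOpen (O b))
    (h : ∀ b s, 0 ≤ s → s ≤ 1 → D.γ b s = z₀ → s ∈ O b) :
    ∀ᶠ z in 𝓝 z₀, ∀ b s, 0 ≤ s → s ≤ 1 → D.γ b s = z → s ∈ O b := by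
  rw [Filter.eventually_all]
  intro b
  have hK : IsCompact (D.γ b '' (Set.Icc 0 1 \ O b)) :=
    (isCompact_Icc.diff (hO b)).image (D.contDiff b).continuous
  have hz : z₀ ∉ D.γ b '' (Set.Icc 0 1 \ O b) := by
    rintro ⟨s, ⟨hs, hsO⟩, rfl⟩
    exact hsO (h b s hs.1 hs.2 rfl)
  filter_upwards [hK.isClosed.isOpen_compl.mem_nhds hz] with z hz s h0 h1 hs
  by_contra hsO
  exact hz ⟨s, ⟨⟨h0, h1⟩, hsO⟩, hs⟩

/-- Parameters of points in the interior of the disc; closed arcs are parametrised by the line. -/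
def IsInner (a : D.Arc) (t : ℝ) : Prop := D.IsClosedArc a ∨ (0 < t ∧ t < 1)

/-- Whether the arc passes through a crossing at a parameter. -/
def IsCrossing (a : D.Arc) (t : ℝ) : Prop := ∃ q, D.Meet (a, Int.fract t) q

theorem fract_eq {t : ℝ} (h : 0 < t ∧ t < 1) : Int.fract t = t := Int.fract_eq_self.2 ⟨h.1.le, h.2⟩

theorem γ_add_int {a : D.Arc} (h : D.IsClosedArc a) (t : ℝ) (n : ℤ) :
    D.γ a (t + n) = D.γ a t := by
  have := (D.closed_periodic a h).int_mul n t
  simpa using this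

theorem γ_fract {a : D.Arc} {t : ℝ} (h : IsInner a t) : D.γ a (Int.fract t) = D.γ a t := by
  rcases h with h | h
  · have := γ_add_int h (Int.fract t) ⌊t⌋
    rw [← this, Int.fract_add_floor]
  · rw [fract_eq h]

theorem fract_mem_params {a : D.Arc} {t : ℝ} : (a, Int.fract t) ∈ D.params :=
  ⟨Int.fract_nonneg t, (Int.fract_lt_one t).le, fun _ => Int.fract_lt_one t⟩

theorem norm_lt_of_isInner {a : D.Arc} {t : ℝ} (h : IsInner a t) : ‖D.γ a t‖ < 1 := by
  by_cases ha : D.IsClosedArc a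
  · exact D.closed_interior a ha t
  · rcases h with h | h
    · exact absurd h ha
    · exact D.open_interior a ha t h

theorem isInner_of_norm_lt {a : D.Arc} {t : ℝ} (h0 : 0 ≤ t) (h1 : t ≤ 1) (h : ‖D.γ a t‖ < 1) :
    IsInner a t := by
  by_cases ha : D.IsClosedArc a
  · exact Or.inl ha
  · refine Or.inr ⟨lt_of_le_of_ne h0 ?_, lt_of_le_of_ne h1 ?_⟩
    · rintro rfl; exact h.ne (D.open_start a ha)
    · rintro rfl; exact h.ne (D.open_end a ha)

theorem eq_add_int {a : D.Arc} {s t : ℝ} (hs : IsInner a s) (ht : IsInner a t)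
    (h : Int.fract s = Int.fract t) : ∃ n : ℤ, s = t + n ∧ (n = 0 ∨ D.IsClosedArc a) := by
  rcases hs with hs | hs
  · obtain ⟨n, hn⟩ := Int.fract_eq_fract.1 h
    exact ⟨n, by linarith, Or.inr hs⟩
  · rcases ht with ht | ht
    · obtain ⟨n, hn⟩ := Int.fract_eq_fract.1 h
      exact ⟨n, by linarith, Or.inr ht⟩
    · rw [fract_eq hs, fract_eq ht] at h
      exact ⟨0, by simp [h], Or.inl rfl⟩

theorem isInner_sub_int {a : D.Arc} {t : ℝ} {n : ℤ} (hn : n = 0 ∨ D.IsClosedArc a) (s : ℝ)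
    (h : s = t + n) : D.γ a s = D.γ a t := by
  rcases hn with rfl | hn
  · simp [h]
  · rw [h, γ_add_int hn]

/-- The arcs near an inner point, given the parameters at which they pass through it. -/
theorem eventually_trace (z₀ : ℂ) (B : Set (D.Arc × ℝ)) (N : D.Arc × ℝ → Set ℝ)
    (hN : ∀ x ∈ B, N x ∈ 𝓝 x.2)
    (h : ∀ b s, 0 ≤ s → s ≤ 1 → D.γ b s = z₀ →
      ∃ x ∈ B, x.1 = b ∧ ∃ n : ℤ, s = x.2 + n ∧ (n = 0 ∨ D.IsClosedArc b)) :
    ∀ᶠ z in 𝓝 z₀, z ∈ D.trace → ∃ x ∈ B, ∃ t ∈ N x,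
      (D.IsClosedArc x.1 ∨ (0 ≤ t ∧ t ≤ 1)) ∧ D.γ x.1 t = z := by
  have := eventually_mem_of_trace z₀
    (fun b => {s | ∃ x ∈ B, x.1 = b ∧ ∃ n : ℤ, s - n ∈ interior (N x) ∧
      (n = 0 ∨ D.IsClosedArc b)}) ?_ ?_
  · filter_upwards [this] with z hz
    rintro ⟨b, s, h0, h1, hs⟩
    obtain ⟨x, hx, rfl, n, hn, hn'⟩ := hz b s h0 h1 hs
    refine ⟨x, hx, s - n, interior_subset hn, ?_, ?_⟩
    · rcases hn' with rfl | hn'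
      · right; simpa using ⟨h0, h1⟩
      · exact Or.inl hn'
    · rw [← hs]
      exact (isInner_sub_int hn' s (by ring)).symm
  · intro b
    have : {s : ℝ | ∃ x ∈ B, x.1 = b ∧ ∃ n : ℤ, s - n ∈ interior (N x) ∧
        (n = 0 ∨ D.IsClosedArc b)} = ⋃ x ∈ B, ⋃ (_ : x.1 = b), ⋃ n : ℤ,
          ⋃ (_ : n = 0 ∨ D.IsClosedArc b), (fun s : ℝ => s - n) ⁻¹' interior (N x) := by
      ext s
      simp only [Set.mem_ofPred_eq, Set.mem_iUnion, Set.mem_preimage, exists_prop]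
      simp only [and_comm]
    rw [this]
    refine isOpen_biUnion fun x _ => isOpen_iUnion fun _ => isOpen_iUnion fun n =>
      isOpen_iUnion fun _ => isOpen_interior.preimage (by fun_prop)
  · intro b s h0 h1 hs
    obtain ⟨x, hx, e, n, hn, hn'⟩ := h b s h0 h1 hs
    refine ⟨x, hx, e, n, ?_, hn'⟩
    rw [hn, add_sub_cancel_right]
    exact mem_interior_iff_mem_nhds.2 (hN x hx)

theorem eventually_trace_of_not_isCrossing {a : D.Arc} {t : ℝ} (ht : IsInner a t)
    (hX : ¬ IsCrossing a t) {N : Set ℝ} (hN : N ∈ 𝓝 t) :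
    ∀ᶠ z in 𝓝 (D.γ a t), z ∈ D.trace → ∃ t' ∈ N, D.γ a t' = z := by
  have key := eventually_trace (D.γ a t) {(a, t)} (fun _ => N) (by simpa using hN) ?_
  · filter_upwards [key] with z hz hzt
    obtain ⟨x, rfl, t', ht', -, e⟩ := hz hzt
    exact ⟨t', ht', e⟩
  · intro b s h0 h1 hs
    have hsI : IsInner b s := isInner_of_norm_lt h0 h1 (hs ▸ norm_lt_of_isInner ht)
    have hp : (a, Int.fract t) = (b, Int.fract s) := by
      by_contra hne
      refine hX ⟨(b, Int.fract s), fract_mem_params, fract_mem_params, hne, ?_⟩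
      change D.γ a (Int.fract t) = D.γ b (Int.fract s)
      rw [γ_fract ht, γ_fract hsI, hs]
    obtain ⟨rfl, e⟩ := Prod.mk.inj hp
    exact ⟨_, rfl, rfl, eq_add_int hsI ht e.symm⟩

theorem eventually_trace_of_meet {a b : D.Arc} {t s : ℝ} (ht : IsInner a t) (hs : IsInner b s)
    (hX : D.Meet (a, Int.fract t) (b, Int.fract s)) {N M : Set ℝ} (hN : N ∈ 𝓝 t)
    (hM : M ∈ 𝓝 s) :
    ∀ᶠ z in 𝓝 (D.γ a t), z ∈ D.trace → (∃ t' ∈ N, D.γ a t' = z) ∨ ∃ s' ∈ M, D.γ b s' = z := by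
  classical
  have hne : (b, s) ≠ (a, t) := by
    intro h
    obtain ⟨rfl, rfl⟩ := Prod.mk.inj h
    exact hX.2.2.1 rfl
  have key := eventually_trace (D.γ a t) {(a, t), (b, s)}
    (fun x => if x = (a, t) then N else M) (by
      rintro x (rfl | rfl)
      · simpa using hN
      · simpa [hne] using hM) ?_
  · filter_upwards [key] with z hz hzt
    obtain ⟨x, rfl | rfl, t', ht', -, e⟩ := hz hzt
    · exact Or.inl ⟨t', by simpa using ht', e⟩
    · exact Or.inr ⟨t', by simpa [hne] using ht', e⟩
  · intro b' s' h0 h1 hs'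
    have hsI : IsInner b' s' := isInner_of_norm_lt h0 h1 (hs' ▸ norm_lt_of_isInner ht)
    by_cases hp : (a, Int.fract t) = (b', Int.fract s')
    · obtain ⟨rfl, e⟩ := Prod.mk.inj hp
      exact ⟨(a, t), Or.inl rfl, rfl, eq_add_int hsI ht e.symm⟩
    · have hm : D.Meet (a, Int.fract t) (b', Int.fract s') := by
        refine ⟨fract_mem_params, fract_mem_params, hp, ?_⟩
        change D.γ a (Int.fract t) = D.γ b' (Int.fract s')
        rw [γ_fract ht, γ_fract hsI, hs']
      obtain ⟨rfl, e⟩ := Prod.mk.inj (D.meet_double _ _ _ hX hm)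
      exact ⟨(b, s), Or.inr rfl, rfl, eq_add_int hsI hs e.symm⟩

theorem eventually_not_isCrossing (a : D.Arc) (t : ℝ) :
    ∀ᶠ t' in 𝓝[≠] t, ¬ IsCrossing a t' := by
  have hfin : {t' : ℝ | t' ∈ Set.Icc (t - 1) (t + 1) ∧ IsCrossing a t'}.Finite := by
    have h1 : (Set.Icc ⌊t - 1⌋ ⌊t + 1⌋ : Set ℤ).Finite := Set.finite_Icc _ _
    -- A parameter is the sum of its floor, bounded here, and its fractional part, which is one of
    -- finitely many double parameters.
    refine ((h1.prod D.finite_meet).image fun x => (x.1 : ℝ) + x.2.2).subset ?_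
    rintro t' ⟨ht', hX⟩
    exact ⟨(⌊t'⌋, (a, Int.fract t')), ⟨⟨Int.floor_le_floor ht'.1, Int.floor_le_floor ht'.2⟩, hX⟩,
      Int.floor_add_fract t'⟩
  have h2 : ({t' : ℝ | t' ∈ Set.Icc (t - 1) (t + 1) ∧ IsCrossing a t'} \ {t})ᶜ ∈ 𝓝 t :=
    (hfin.subset Set.sdiff_subset).isClosed.isOpen_compl.mem_nhds (by simp)
  filter_upwards [self_mem_nhdsWithin, nhdsWithin_le_nhds h2,
    nhdsWithin_le_nhds (Icc_mem_nhds (by linarith : t - 1 < t) (by linarith : t < t + 1))] with t' h0 h3 h4 hX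
  exact h3 ⟨⟨h4, hX⟩, h0⟩

theorem eventually_isInner {a : D.Arc} {t : ℝ} (h : IsInner a t) :
    ∀ᶠ t' in 𝓝 t, IsInner a t' := by
  rcases h with h | h
  · exact Filter.Eventually.of_forall fun _ => Or.inl h
  · filter_upwards [Ioo_mem_nhds h.1 h.2] with t' ht'
    exact Or.inr ht'

end LinkDiagram
end

/-! ### Chords of curves and transverse directions -/

noncomputable section

/-- The oriented area of the parallelogram spanned by two vectors of the plane. -/
def planeArea (u w : ℂ) : ℝ := u.re * w.im - u.im * w.re

theorem planeArea_swap (u w : ℂ) : planeArea w u = -planeArea u w := by unfold planeArea; ring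

theorem planeArea_real_mul (u w : ℂ) (r : ℝ) : planeArea u (r * w) = r * planeArea u w := by
  simp [planeArea]; ring

theorem planeArea_mul_I_self (u : ℂ) : planeArea u (Complex.I * u) = ‖u‖ ^ 2 := by
  rw [← Complex.normSq_eq_norm_sq, Complex.normSq_apply]
  simp [planeArea]

theorem planeArea_sub (u w z : ℂ) : planeArea u (w - z) = planeArea u w - planeArea u z := by
  simp [planeArea]; ring

theorem planeArea_add (u w z : ℂ) : planeArea u (w + z) = planeArea u w + planeArea u z := by
  simp [planeArea]; ring

theorem planeArea_self (u : ℂ) : planeArea u u = 0 := by unfold planeArea; ring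

theorem abs_planeArea_le (u w : ℂ) : |planeArea u w| ≤ ‖u‖ * ‖w‖ := by
  have : planeArea u w = (conj u * w).im := by simp [planeArea]; ring
  rw [this]
  refine (Complex.abs_im_le_norm _).trans ?_
  rw [norm_mul, Complex.norm_conj]

theorem planeArea_ne_zero_of_linearIndependent {u v : ℂ} (h : LinearIndependent ℝ ![u, v]) :
    planeArea u v ≠ 0 := by
  intro h0
  rw [LinearIndependent.pair_iff] at h
  have hu : u ≠ 0 := by
    rintro rfl
    have := h 1 0 (by simp)
    simp at this
  have h1 := h (-(u.re * v.re + u.im * v.im)) (u.re * u.re + u.im * u.im) ?_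
  · have h2 := h1.2
    apply hu
    apply Complex.ext <;> simp <;> nlinarith [sq_nonneg u.re, sq_nonneg u.im]
  · unfold planeArea at h0
    apply Complex.ext
    · simp
      linear_combination (u.im) * (-1) * h0
    · simp
      linear_combination u.re * h0

theorem _root_.HasStrictDerivAt.eventually_norm_sub_le {c : ℝ → ℂ} {u : ℂ} {t : ℝ}
    (hc : HasStrictDerivAt c u t) {δ : ℝ} (hδ : 0 < δ) :
    ∀ᶠ p : ℝ × ℝ in 𝓝 (t, t), ‖c p.1 - c p.2 - ((p.1 - p.2 : ℝ) : ℂ) * u‖ ≤ δ * |p.1 - p.2| := by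
  have h := (hc.hasStrictFDerivAt.isLittleO).def hδ
  filter_upwards [h] with p hp
  simpa [Complex.real_smul] using hp

/-- Short chords of the curve are nearly parallel to `u`, so none is a nonzero multiple of a
direction near the transverse `w`. Uniformity in both parameters and in the direction is the point
of using a strict derivative. -/
theorem HasStrictDerivAt.eventually_ne_add {c : ℝ → ℂ} {u w : ℂ} {t : ℝ}
    (hc : HasStrictDerivAt c u t) (hw : planeArea u w ≠ 0) :
    ∀ᶠ p : (ℝ × ℝ) × ℂ in 𝓝 ((t, t), w), ∀ ε : ℝ, ε ≠ 0 → c p.1.1 ≠ c p.1.2 + ε * p.2 := by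
  set m := |planeArea u w| with hm
  have hm0 : 0 < m := abs_pos.2 hw
  set W := ‖w‖ + 1 with hW
  have hW0 : 0 < W := by positivity
  -- With this constant the error contributes area at most `|τ| * (m / 4)`, against at least `|τ| *
  -- (m / 2)` from the chord.
  have h1 := hc.eventually_norm_sub_le (δ := m / (4 * W)) (by positivity)
  have h2 : ∀ᶠ w' in 𝓝 w, m / 2 < |planeArea u w'| := by
    have : Continuous fun w' => |planeArea u w'| := by unfold planeArea; fun_prop
    exact this.continuousAt.eventually_const_lt (by change m / 2 < m; linarith)
  have h3 : ∀ᶠ w' in 𝓝 w, ‖w'‖ < W :=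
    continuous_norm.continuousAt.eventually_lt_const (by rw [hW]; linarith)
  have h4 := h1.prod_nhds (h2.and h3)
  filter_upwards [h4] with ⟨⟨t1, t2⟩, w'⟩ ⟨ha, hb, hd⟩ ε hε heq
  simp only at ha hb hd heq
  set τ := t1 - t2 with hτ
  have e : c t1 - c t2 - (τ : ℂ) * u = ε * w' - τ * u := by rw [heq]; ring
  rw [e] at ha
  -- Taking the area with `w'` removes the unknown `ε`.
  have h5 : planeArea w' (ε * w' - τ * u) = τ * planeArea u w' := by
    rw [planeArea_sub, planeArea_real_mul, planeArea_real_mul, planeArea_self, planeArea_swap u w']; ring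
  have h6 := abs_planeArea_le w' (ε * w' - τ * u)
  rw [h5, abs_mul] at h6
  have h7 : |τ| * |planeArea u w'| ≤ W * (m / (4 * W) * |τ|) :=
    h6.trans (mul_le_mul hd.le ha (norm_nonneg _) hW0.le)
  have h8 : W * (m / (4 * W) * |τ|) = |τ| * (m / 4) := by field_simp
  rw [h8] at h7
  have h9 : |τ| = 0 := by
    by_contra hne
    have : 0 < |τ| := lt_of_le_of_ne (abs_nonneg _) (Ne.symm hne)
    have := le_of_mul_le_mul_left h7 this
    linarith
  have h10 : τ = 0 := abs_eq_zero.1 h9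
  have h11 : t1 = t2 := by rw [hτ] at h10; linarith
  rw [h11] at heq
  have h12 : (ε : ℂ) * w' = 0 := by
    have := heq.symm
    rwa [add_eq_left] at this
  rcases mul_eq_zero.1 h12 with h | h
  · exact hε (by exact_mod_cast h)
  · rw [h] at hb
    simp [planeArea] at hb
    linarith

/-- Short chords of two transverse curves have different directions, so they are equal only when
both are zero. -/
theorem HasStrictDerivAt.eventually_eq_of_sub_eq {c₁ c₂ : ℝ → ℂ} {u v : ℂ} {t s : ℝ}
    (h₁ : HasStrictDerivAt c₁ u t) (h₂ : HasStrictDerivAt c₂ v s) (huv : planeArea u v ≠ 0) :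
    ∀ᶠ p : (ℝ × ℝ) × (ℝ × ℝ) in 𝓝 ((t, t), (s, s)),
      c₁ p.1.1 - c₁ p.1.2 = c₂ p.2.1 - c₂ p.2.2 → p.1.1 = p.1.2 ∧ p.2.1 = p.2.2 := by
  set m := |planeArea u v| with hm
  have hm0 : 0 < m := abs_pos.2 huv
  set W := ‖u‖ + ‖v‖ + 1 with hW
  have hW0 : 0 < W := by positivity
  have h3 := (h₁.eventually_norm_sub_le (δ := m / (4 * W)) (by positivity)).prod_nhds
    (h₂.eventually_norm_sub_le (δ := m / (4 * W)) (by positivity))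
  filter_upwards [h3] with ⟨⟨t1, t2⟩, s1, s2⟩ ⟨ha, hb⟩ heq
  simp only at ha hb heq ⊢
  set τ := t1 - t2 with hτ
  set σ := s1 - s2 with hσ
  set r₁ := c₁ t1 - c₁ t2 - (τ : ℂ) * u with hr₁
  set r₂ := c₂ s1 - c₂ s2 - (σ : ℂ) * v with hr₂
  have e : (τ : ℂ) * u - σ * v = r₂ - r₁ := by rw [hr₁, hr₂, heq]; ring
  have hr : ‖r₂ - r₁‖ ≤ m / (4 * W) * (|τ| + |σ|) := by
    refine (norm_sub_le _ _).trans ?_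
    rw [mul_add]; linarith
  -- Areas with `u` and with `v` isolate `σ` and `τ`.
  have e1 : planeArea u (r₂ - r₁) = -(σ * planeArea u v) := by
    rw [← e, planeArea_sub, planeArea_real_mul, planeArea_real_mul, planeArea_self]; ring
  have e2 : planeArea v (r₂ - r₁) = -(τ * planeArea u v) := by
    rw [← e, planeArea_sub, planeArea_real_mul, planeArea_real_mul, planeArea_self, planeArea_swap u v]; ring
  have k1 := abs_planeArea_le u (r₂ - r₁)
  have k2 := abs_planeArea_le v (r₂ - r₁)
  rw [e1, abs_neg, abs_mul, ← hm] at k1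
  rw [e2, abs_neg, abs_mul, ← hm] at k2
  have k3 : (|τ| + |σ|) * m ≤ W * (m / (4 * W) * (|τ| + |σ|)) := by
    calc (|τ| + |σ|) * m = |τ| * m + |σ| * m := by ring
      _ ≤ (‖u‖ + ‖v‖) * ‖r₂ - r₁‖ := by linarith
      _ ≤ W * (m / (4 * W) * (|τ| + |σ|)) :=
        mul_le_mul (by rw [hW]; linarith) hr (norm_nonneg _) hW0.le
  have k4 : W * (m / (4 * W) * (|τ| + |σ|)) = (|τ| + |σ|) * (m / 4) := by field_simp
  rw [k4] at k3
  have k5 : |τ| + |σ| ≤ 0 := by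
    by_contra hne
    push Not at hne
    have := le_of_mul_le_mul_left k3 hne
    linarith
  have k6 : τ = 0 := abs_eq_zero.1 (by linarith [abs_nonneg τ, abs_nonneg σ])
  have k7 : σ = 0 := abs_eq_zero.1 (by linarith [abs_nonneg τ, abs_nonneg σ])
  constructor
  · rw [hτ] at k6; linarith
  · rw [hσ] at k7; linarith

/-- Positions on one side of a curve near a point: a parameter, a distance and a direction. -/
abbrev sideSet : Set (ℝ × ℝ × ℂ) := {p | 0 < p.2.1}

theorem convex_sideSet : Convex ℝ sideSet := by
  have : sideSet = (fun p : ℝ × ℝ × ℂ => p.2.1) ⁻¹' Set.Ioi 0 := rfl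
  rw [this]
  exact (convex_Ioi (0 : ℝ)).linear_preimage
    ((LinearMap.fst ℝ ℝ ℂ).comp (LinearMap.snd ℝ ℝ (ℝ × ℂ)))

theorem tendsto_sideSet {X : Type*} {l : Filter X} {f : X → ℝ} {g : X → ℝ} {h : X → ℂ} {t : ℝ}
    {w : ℂ} (hf : Filter.Tendsto f l (𝓝 t)) (hg : Filter.Tendsto g l (𝓝[>] 0))
    (hh : Filter.Tendsto h l (𝓝 w)) :
    Filter.Tendsto (fun x => (f x, g x, h x)) l (𝓝[sideSet] (t, 0, w)) := by
  refine tendsto_nhdsWithin_iff.2 ⟨hf.prodMk_nhds ((tendsto_nhdsWithin_iff.1 hg).1.prodMk_nhds hh),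
    (tendsto_nhdsWithin_iff.1 hg).2⟩

instance neBot_sideSet (t : ℝ) (w : ℂ) : (𝓝[sideSet] ((t, 0, w) : ℝ × ℝ × ℂ)).NeBot :=
  (tendsto_sideSet (l := 𝓝[>] (0 : ℝ)) (f := fun _ => t) (g := id) (h := fun _ => w)
    tendsto_const_nhds Filter.tendsto_id tendsto_const_nhds).neBot

/-! ### The colours beside a curve -/

namespace LinkDiagram

variable {D : LinkDiagram} (col : D.Region → ZMod 2)

/-- `x` is the colour of the points next to the curve at the parameter `t`, on the left of the curve
for `η` positive and on the right for `η` negative. -/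
def SideColour (c : ℝ → ℂ) (t η : ℝ) (x : ZMod 2) : Prop :=
  ∀ w, 0 < η * planeArea (deriv c t) w → ∀ᶠ p : ℝ × ℝ × ℂ in 𝓝[sideSet] (t, 0, w),
    c p.1 + p.2.1 * p.2.2 ∈ D.free ∧ colourAt col (c p.1 + p.2.1 * p.2.2) = x

variable {col}

/-- Any path leaving the curve with velocity `w` sees the side colour: it is the base point plus `θ`
times its slope, and the slope tends to `w`. Hence `SideColour` lets the direction vary. -/
theorem SideColour.eventually_colour {c g : ℝ → ℂ} {t η : ℝ} {x : ZMod 2} {w : ℂ}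
    (h : SideColour col c t η x) (hg : HasDerivWithinAt g w (Set.Ioi 0) 0) (h0 : g 0 = c t)
    (hw : 0 < η * planeArea (deriv c t) w) :
    ∀ᶠ θ in 𝓝[>] (0 : ℝ), g θ ∈ D.free ∧ colourAt col (g θ) = x := by
  have h1 := hasDerivWithinAt_iff_tendsto_slope.1 hg
  have h2 : (Set.Ioi (0 : ℝ)) \ {0} = Set.Ioi 0 := by
    ext y; simp
  rw [h2] at h1
  have h3 := (tendsto_sideSet (tendsto_const_nhds (x := t)) Filter.tendsto_id h1).eventually (h w hw)
  filter_upwards [h3, self_mem_nhdsWithin] with θ hθ (hpos : 0 < θ)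
  have e : c t + ((id θ : ℝ) : ℂ) * slope g 0 θ = g θ := by
    rw [slope_def_module, h0]
    have : (θ : ℂ) ≠ 0 := by exact_mod_cast hpos.ne'
    simp [Complex.real_smul]
    field_simp
    ring
  simpa only [e] using hθ

/-- Transfers a colour known on a patch `F t' θ` to the side colours along the curve: each path `F
t'` leaves the curve to the side `η`, so some point of it carries both colours. -/
theorem SideColour.eventually_eq {c : ℝ → ℂ} {t η : ℝ} {x : ZMod 2} {A : Set ℝ} (F : ℝ → ℝ → ℂ)
    (w : ℝ → ℂ)
    (h : ∀ᶠ p : ℝ × ℝ in 𝓝[A ×ˢ Set.Ioi 0] (t, 0), colourAt col (F p.1 p.2) = x)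
    (hF : ∀ᶠ t' in 𝓝[A] t, HasDerivWithinAt (F t') (w t') (Set.Ioi 0) 0 ∧ F t' 0 = c t' ∧
      0 < η * planeArea (deriv c t') (w t')) :
    ∀ᶠ t' in 𝓝[A] t, ∀ x', SideColour col c t' η x' → x' = x := by
  rw [nhdsWithin_prod_eq] at h
  filter_upwards [h.curry, hF] with t' h1 ⟨h2, h3, h4⟩ x' hx'
  obtain ⟨θ, hθ, hθ'⟩ := (h1.and (hx'.eventually_colour h2 h3 h4)).exists
  rw [← hθ'.2, hθ]

/-- Near each transverse direction the displaced points are off the curves and share a colour. The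
directions to one side form a convex set, so this locally constant colour is the same for all of
them. -/
theorem exists_sideColour {c : ℝ → ℂ} {t : ℝ} (hc : ContDiff ℝ 1 c) (hn : ‖c t‖ < 1)
    (hloc : ∀ N ∈ 𝓝 t, ∀ᶠ z in 𝓝 (c t), z ∈ D.trace → ∃ t' ∈ N, c t' = z) (η : ℝ) :
    ∃ x, SideColour col c t η x := by
  have hst : HasStrictDerivAt c (deriv c t) t := hc.contDiffAt.hasStrictDerivAt one_ne_zero
  have hcc := hc.continuous
  -- near the curve in a transverse direction all points are off the curves
  have h1 : ∀ w, 0 < η * planeArea (deriv c t) w → ∃ x, ∀ᶠ p : ℝ × ℝ × ℂ in 𝓝[sideSet] (t, 0, w),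
      c p.1 + p.2.1 * p.2.2 ∈ D.free ∧ colourAt col (c p.1 + p.2.1 * p.2.2) = x := by
    intro w hw
    have hcr : planeArea (deriv c t) w ≠ 0 := by rintro h; simp [h] at hw
    have hF : Continuous fun p : ℝ × ℝ × ℂ => c p.1 + p.2.1 * p.2.2 := by fun_prop
    refine exists_eventually_colour col convex_sideSet _ _ hF.continuousOn ?_
    obtain ⟨U, hU, V, hV, hUV⟩ := mem_nhds_prod_iff.1 (hst.eventually_ne_add hcr)
    obtain ⟨N, hN, N', hN', hNN⟩ := mem_nhds_prod_iff.1 hU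
    have hF0 : Filter.Tendsto (fun p : ℝ × ℝ × ℂ => c p.1 + p.2.1 * p.2.2)
        (𝓝[sideSet] (t, 0, w)) (𝓝 (c t)) := by
      have := hF.tendsto (t, 0, w)
      simp only [Complex.ofReal_zero, zero_mul, add_zero] at this
      exact this.mono_left nhdsWithin_le_nhds
    have k1 := hF0.eventually (hloc N hN)
    have k2 := hF0.norm.eventually_lt_const hn
    have k3 : ∀ᶠ p : ℝ × ℝ × ℂ in 𝓝[sideSet] (t, 0, w), p.1 ∈ N' :=
      nhdsWithin_le_nhds (continuous_fst.continuousAt.preimage_mem_nhds hN')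
    have k4 : ∀ᶠ p : ℝ × ℝ × ℂ in 𝓝[sideSet] (t, 0, w), p.2.2 ∈ V :=
      nhdsWithin_le_nhds ((continuous_snd.comp continuous_snd).continuousAt.preimage_mem_nhds hV)
    filter_upwards [k1, k2, k3, k4, self_mem_nhdsWithin] with p p1 p2 p3 p4 (p5 : 0 < p.2.1)
    refine mem_free_of_norm_lt p2 fun htr => ?_
    obtain ⟨t', ht', e⟩ := p1 htr
    exact hUV (Set.mk_mem_prod (hNN (Set.mk_mem_prod ht' p3)) p4) p.2.1 p5.ne' e
  choose x hx using h1
  -- Without a direction on that side, as for `η = 0`, the statement is vacuous and any colour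
  -- serves.
  by_cases hne : ∃ w, 0 < η * planeArea (deriv c t) w
  swap
  · exact ⟨0, fun w hw => absurd ⟨w, hw⟩ hne⟩
  obtain ⟨w₀, hw₀⟩ := hne
  refine ⟨x w₀ hw₀, ?_⟩
  have hconv : Convex ℝ {w | 0 < η * planeArea (deriv c t) w} := by
    intro w hw z hz a b ha hb hab
    simp only [Set.mem_ofPred_eq] at hw hz ⊢
    have e : η * planeArea (deriv c t) (a • w + b • z) =
        a * (η * planeArea (deriv c t) w) + b * (η * planeArea (deriv c t) z) := by
      rw [planeArea_add, Complex.real_smul, Complex.real_smul, planeArea_real_mul, planeArea_real_mul]; ring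
    rw [e]
    rcases ha.eq_or_lt with rfl | ha
    · have : b = 1 := by linarith
      subst this; simpa using hz
    · have := mul_pos ha hw
      have := mul_nonneg hb hz.le
      linarith
  have hind : ∀ {w z : ℂ}, w ∈ {w | 0 < η * planeArea (deriv c t) w} →
      z ∈ {w | 0 < η * planeArea (deriv c t) w} → ∀ (hw : 0 < η * planeArea (deriv c t) w)
      (hz : 0 < η * planeArea (deriv c t) z), x w hw = x z hz :=
    hconv.isPreconnected.induction₂
      (fun w z => ∀ (hw : 0 < η * planeArea (deriv c t) w) (hz : 0 < η * planeArea (deriv c t) z),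
        x w hw = x z hz) ?_ ?_ ?_
  · intro w hw
    have e := hind hw₀ hw hw₀ hw
    rw [e]
    exact hx w hw
  · intro w hw
    obtain ⟨δ, hδ, hsub⟩ := Metric.mem_nhdsWithin_iff.1 (hx w hw)
    filter_upwards [nhdsWithin_le_nhds (Metric.ball_mem_nhds w hδ)] with z hz hw' hz'
    have k1 : ∀ᶠ p : ℝ × ℝ × ℂ in 𝓝[sideSet] (t, 0, z), p ∈ Metric.ball (t, (0 : ℝ), w) δ := by
      refine nhdsWithin_le_nhds (Metric.isOpen_ball.mem_nhds ?_)
      rw [← ball_prod_same, ← ball_prod_same]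
      exact ⟨Metric.mem_ball_self hδ, Metric.mem_ball_self hδ, hz⟩
    obtain ⟨p, p1, p2, p3⟩ := (k1.and ((hx z hz').and self_mem_nhdsWithin)).exists
    rw [← p2.2]
    exact (hsub ⟨p1, p3⟩).2.symm
  · intro a b d ha hb hd h1 h2 h3 h4
    exact (h1 h3 hb).trans (h2 hb h4)
  · intro a b ha hb h1 h2 h3
    exact (h1 h3 h2).symm

end LinkDiagram
end

/-! ### Colours at a transverse crossing -/

noncomputable section

namespace LinkDiagram

variable {D : LinkDiagram} {col : D.Region → ZMod 2}

theorem SideColour.of_mul_pos {c : ℝ → ℂ} {t η η' : ℝ} {x : ZMod 2} (h : SideColour col c t η x)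
    (hη : 0 < η * η') : SideColour col c t η' x := by
  intro w hw
  refine h w ?_
  have h1 : 0 < η * planeArea (deriv c t) w * (η * η') := by
    have h2 : 0 < η * η := by
      rcases (mul_ne_zero_iff.1 hη.ne') with ⟨h3, -⟩
      exact mul_self_pos.2 h3
    nlinarith [mul_pos h2 hw]
  exact (mul_pos_iff_of_pos_right hη).1 h1

/-- A single normal direction at `t` remains transverse at nearby parameters, so it reads off all
their side colours from one patch. -/
theorem SideColour.eventually_eq_self {c : ℝ → ℂ} {t η : ℝ} {x : ZMod 2} (hc : ContDiff ℝ 1 c)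
    (h : SideColour col c t η x) (hη : η ≠ 0) (hu : deriv c t ≠ 0) :
    ∀ᶠ t' in 𝓝 t, ∀ x', SideColour col c t' η x' → x' = x := by
  set w : ℂ := η * (Complex.I * deriv c t) with hw
  have hw0 : 0 < η * planeArea (deriv c t) w := by
    rw [hw, planeArea_real_mul, planeArea_mul_I_self, ← mul_assoc]
    have := norm_pos_iff.2 hu
    have := mul_self_pos.2 hη
    positivity
  have key := SideColour.eventually_eq (col := col) (c := c) (t := t) (η := η) (x := x)
    (A := Set.univ) (fun t' θ => c t' + θ * w) (fun _ => w) ?_ ?_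
  · simpa using key
  · have h1 : Filter.Tendsto (fun p : ℝ × ℝ => (p.1, p.2, w)) (𝓝[Set.univ ×ˢ Set.Ioi 0] (t, 0))
        (𝓝[sideSet] (t, 0, w)) := by
      refine tendsto_sideSet ?_ ?_ tendsto_const_nhds
      · exact (continuous_fst.tendsto (t, (0 : ℝ))).mono_left nhdsWithin_le_nhds
      · rw [nhdsWithin_prod_eq]
        exact Filter.tendsto_snd
    filter_upwards [h1.eventually (h w hw0)] with p hp
    exact hp.2
  · rw [nhdsWithin_univ]
    have hcont : Continuous fun t' => η * planeArea (deriv c t') w := by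
      have := hc.continuous_deriv le_rfl
      unfold planeArea
      fun_prop
    filter_upwards [hcont.continuousAt.eventually_const_lt hw0] with t' ht'
    refine ⟨?_, by simp, ht'⟩
    have h2 : HasDerivAt (fun θ : ℝ => c t' + θ * w) w 0 := by
      have := ((Complex.ofRealCLM.hasDerivAt (x := 0)).mul_const w).const_add (c t')
      simpa using this
    exact h2.hasDerivWithinAt

/-- The parameters on one side of `t`. -/
abbrev raySet (α t : ℝ) : Set ℝ := {t' | 0 < α * (t' - t)}

theorem convex_raySet (α t : ℝ) : Convex ℝ (raySet α t) := by
  intro x hx y hy a b ha hb hab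
  simp only [raySet, Set.mem_ofPred_eq] at hx hy ⊢
  have e : α * (a • x + b • y - t) = a * (α * (x - t)) + b * (α * (y - t)) := by
    simp only [smul_eq_mul]
    linear_combination (α * t) * hab
  rw [e]
  rcases ha.eq_or_lt with rfl | ha
  · have : b = 1 := by linarith
    subst this; simpa using hy
  · have := mul_pos ha hx
    have := mul_nonneg hb hy.le
    linarith

theorem tendsto_raySet {α : ℝ} (hα : α ≠ 0) (t : ℝ) :
    Filter.Tendsto (fun τ => t + α * τ) (𝓝[>] 0) (𝓝[raySet α t] t) := by
  refine tendsto_nhdsWithin_iff.2 ⟨?_, ?_⟩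
  · have : Continuous fun τ => t + α * τ := by fun_prop
    have := this.tendsto 0
    simp only [mul_zero, add_zero] at this
    exact this.mono_left nhdsWithin_le_nhds
  · filter_upwards [self_mem_nhdsWithin] with τ (hτ : 0 < τ)
    have := mul_self_pos.2 hα
    have e : α * (t + α * τ - t) = α * α * τ := by ring
    change 0 < α * (t + α * τ - t)
    rw [e]
    positivity

theorem neBot_raySet {α : ℝ} (hα : α ≠ 0) (t : ℝ) : (𝓝[raySet α t] t).NeBot :=
  (tendsto_raySet hα t).neBot

/-- The colour of a quadrant at a transverse crossing of two curves. -/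
theorem exists_quadrant_colour {c₁ c₂ : ℝ → ℂ} {t s α β : ℝ} (hc₁ : ContDiff ℝ 1 c₁)
    (hc₂ : ContDiff ℝ 1 c₂) (hts : c₁ t = c₂ s) (hn : ‖c₁ t‖ < 1)
    (huv : planeArea (deriv c₁ t) (deriv c₂ s) ≠ 0) (hα : α ≠ 0) (hβ : β ≠ 0)
    (hloc : ∀ N ∈ 𝓝 t, ∀ M ∈ 𝓝 s, ∀ᶠ z in 𝓝 (c₁ t), z ∈ D.trace →
      (∃ t' ∈ N, c₁ t' = z) ∨ ∃ s' ∈ M, c₂ s' = z) :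
    ∃ q, ∀ᶠ p : ℝ × ℝ in 𝓝[raySet α t ×ˢ raySet β s] (t, s),
      colourAt col (c₁ p.1 + (c₂ p.2 - c₁ t)) = q := by
  have hst₁ : HasStrictDerivAt c₁ (deriv c₁ t) t := hc₁.contDiffAt.hasStrictDerivAt one_ne_zero
  have hst₂ : HasStrictDerivAt c₂ (deriv c₂ s) s := hc₂.contDiffAt.hasStrictDerivAt one_ne_zero
  have hcc₁ := hc₁.continuous
  have hcc₂ := hc₂.continuous
  have hF : Continuous fun p : ℝ × ℝ => c₁ p.1 + (c₂ p.2 - c₁ t) := by fun_prop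
  have : (𝓝[raySet α t ×ˢ raySet β s] (t, s)).NeBot := by
    rw [nhdsWithin_prod_eq]
    have := neBot_raySet hα t
    have := neBot_raySet hβ s
    infer_instance
  have hfree : ∀ᶠ p : ℝ × ℝ in 𝓝[raySet α t ×ˢ raySet β s] (t, s),
      c₁ p.1 + (c₂ p.2 - c₁ t) ∈ D.free := by
    obtain ⟨U, hU, V, hV, hUV⟩ := mem_nhds_prod_iff.1 (hst₁.eventually_eq_of_sub_eq hst₂ huv)
    obtain ⟨N, hN, N', hN', hNN⟩ := mem_nhds_prod_iff.1 hU
    obtain ⟨M, hM, M', hM', hMM⟩ := mem_nhds_prod_iff.1 hV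
    have hF0 : Filter.Tendsto (fun p : ℝ × ℝ => c₁ p.1 + (c₂ p.2 - c₁ t))
        (𝓝[raySet α t ×ˢ raySet β s] (t, s)) (𝓝 (c₁ t)) := by
      have := hF.tendsto (t, s)
      simp only [hts, sub_self, add_zero] at this
      rw [← hts] at this
      exact this.mono_left nhdsWithin_le_nhds
    have k1 := hF0.eventually (hloc (N ∩ N') (Filter.inter_mem hN hN') (M ∩ M')
      (Filter.inter_mem hM hM'))
    have k2 := hF0.norm.eventually_lt_const hn
    have k3 : ∀ᶠ p : ℝ × ℝ in 𝓝[raySet α t ×ˢ raySet β s] (t, s), p.1 ∈ N ∩ N' :=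
      nhdsWithin_le_nhds (continuous_fst.continuousAt.preimage_mem_nhds (Filter.inter_mem hN hN'))
    have k4 : ∀ᶠ p : ℝ × ℝ in 𝓝[raySet α t ×ˢ raySet β s] (t, s), p.2 ∈ M ∩ M' :=
      nhdsWithin_le_nhds (continuous_snd.continuousAt.preimage_mem_nhds (Filter.inter_mem hM hM'))
    filter_upwards [k1, k2, k3, k4, self_mem_nhdsWithin] with p p1 p2 p3 p4 p5
    -- The coordinates of the quadrant are sums of chords of the two curves. A point of it on either
    -- curve would make a chord of one equal to a chord of the other, putting a coordinate at the
    -- vertex, which `raySet` excludes.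
    refine mem_free_of_norm_lt p2 fun htr => ?_
    rcases p1 htr with ⟨t', ht', e⟩ | ⟨s', hs', e⟩
    · have h := (hUV (Set.mk_mem_prod (hNN (Set.mk_mem_prod ht'.1 p3.2))
        (hMM (Set.mk_mem_prod p4.1 (mem_of_mem_nhds hM')))) (by rw [e, hts]; ring)).2
      have h' : p.2 = s := h
      have := p5.2
      simp [raySet, h'] at this
    · have h := (hUV (Set.mk_mem_prod (hNN (Set.mk_mem_prod p3.1 (mem_of_mem_nhds hN')))
        (hMM (Set.mk_mem_prod hs'.1 p4.2))) (by rw [e]; ring)).1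
      have h' : p.1 = t := h
      have := p5.1
      simp [raySet, h'] at this
  obtain ⟨q, hq⟩ := exists_eventually_colour (D := D) col
    ((convex_raySet α t).prod (convex_raySet β s)) (t, s) _ hF.continuousOn hfree
  exact ⟨q, hq.mono fun _ h => h.2⟩

/-- With the first coordinate fixed, the quadrant consists of translates of the second curve. They
leave the first curve in the direction `β * deriv c₂ s`, whose side is given by the sign of the
area. -/
theorem sideColour_eq_of_quadrant {c₁ c₂ : ℝ → ℂ} {t s β : ℝ} {A : Set ℝ} {q : ZMod 2}
    (hc₁ : ContDiff ℝ 1 c₁) (hc₂ : ContDiff ℝ 1 c₂) (hts : c₁ t = c₂ s)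
    (huv : planeArea (deriv c₁ t) (deriv c₂ s) ≠ 0) (hβ : β ≠ 0)
    (hq : ∀ᶠ p : ℝ × ℝ in 𝓝[A ×ˢ raySet β s] (t, s),
      colourAt col (c₁ p.1 + (c₂ p.2 - c₁ t)) = q) :
    ∀ᶠ t' in 𝓝[A] t, ∀ x',
      SideColour col c₁ t' (β * planeArea (deriv c₁ t) (deriv c₂ s)) x' → x' = q := by
  refine SideColour.eventually_eq (fun t' θ => c₁ t' + (c₂ (s + β * θ) - c₁ t))
    (fun _ => β * deriv c₂ s) ?_ ?_
  · rw [nhdsWithin_prod_eq] at hq ⊢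
    exact (Filter.tendsto_id.prodMap (tendsto_raySet hβ s)).eventually hq
  · set v := deriv c₂ s with hv
    have hcont : Continuous fun t' =>
        β * planeArea (deriv c₁ t) v * planeArea (deriv c₁ t') (β * v) := by
      have := hc₁.continuous_deriv le_rfl
      unfold planeArea
      fun_prop
    have h0 : 0 < β * planeArea (deriv c₁ t) v * planeArea (deriv c₁ t) (β * v) := by
      rw [planeArea_real_mul]
      exact mul_self_pos.2 (mul_ne_zero hβ huv)
    filter_upwards [nhdsWithin_le_nhds (hcont.continuousAt.eventually_const_lt h0)] with t' ht'
    refine ⟨?_, by simp [hts], ht'⟩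
    have h1 : HasDerivAt c₂ v (s + β * 0) := by
      rw [mul_zero, add_zero]
      exact ((hc₂.differentiable one_ne_zero) s).hasDerivAt
    have h2 : HasDerivAt (fun θ : ℝ => s + β * θ) β 0 := by
      simpa using ((hasDerivAt_id (0 : ℝ)).const_mul β).const_add s
    have h3 := ((h1.scomp 0 h2).sub_const (c₁ t)).const_add (c₁ t')
    rw [Complex.real_smul] at h3
    exact h3.hasDerivWithinAt

/-! ### Sides of the arcs -/

theorem deriv_γ_fract {a : D.Arc} {t : ℝ} (h : IsInner a t) :
    deriv (D.γ a) (Int.fract t) = deriv (D.γ a) t := by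
  rcases h with h | h
  · have e : (fun s => D.γ a (s + (⌊t⌋ : ℝ))) = D.γ a := funext fun s => γ_add_int h s ⌊t⌋
    have := deriv_comp_add_const (D.γ a) (⌊t⌋ : ℝ) (Int.fract t)
    rw [e, Int.fract_add_floor] at this
    exact this
  · rw [fract_eq h]

theorem deriv_γ_ne_zero {a : D.Arc} {t : ℝ} (h : IsInner a t) : deriv (D.γ a) t ≠ 0 := by
  rw [← deriv_γ_fract h]
  exact D.immersed a _ ⟨Int.fract_nonneg t, (Int.fract_lt_one t).le⟩

theorem exists_sideColour_arc {a : D.Arc} {t : ℝ} (h : IsInner a t) (hX : ¬ IsCrossing a t)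
    (η : ℝ) : ∃ x, SideColour col (D.γ a) t η x :=
  exists_sideColour (D.contDiff a) (norm_lt_of_isInner h)
    (fun _ hN => eventually_trace_of_not_isCrossing h hX hN) η

/-- The two normals enter regions that have the side colours, and these regions are adjacent. -/
theorem SideColour.opposite (hcol : ∀ r s, D.Adjacent r s → col r = col s + 1) {a : D.Arc} {t : ℝ}
    (ht : 0 < t ∧ t < 1) (hX : ¬ IsCrossing a t) {x y : ZMod 2}
    (hx : SideColour col (D.γ a) t 1 x) (hy : SideColour col (D.γ a) t (-1) y) : x = y + 1 := by
  have hu : deriv (D.γ a) t ≠ 0 := deriv_γ_ne_zero (Or.inr ht)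
  have hpos : 0 < ‖deriv (D.γ a) t‖ ^ 2 := by have := norm_pos_iff.2 hu; positivity
  have key : ∀ (η : ℝ) (x : ZMod 2) (w : ℂ), 0 < η * planeArea (deriv (D.γ a) t) w →
      SideColour col (D.γ a) t η x → ∃ r, D.Enters (a, t) w r ∧ col r = x := by
    intro η x w hw h
    have hd : HasDerivAt (fun ε : ℝ => D.γ a t + ε * w) w 0 := by
      have := ((Complex.ofRealCLM.hasDerivAt (x := 0)).mul_const w).const_add (D.γ a t)
      simpa using this
    have h1 := h.eventually_colour hd.hasDerivWithinAt (by simp) hw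
    obtain ⟨r, hr⟩ := exists_eventually_region (D := D) (convex_Ioi (0 : ℝ)) 0
      (fun ε : ℝ => D.γ a t + ε * w) (by fun_prop) (h1.mono fun _ h => h.1)
    refine ⟨r, ?_, ?_⟩
    · filter_upwards [hr] with ε ⟨hε, e⟩
      exact ⟨⟨_, mem_closedBall_zero_iff.2 hε.1⟩, hε.2, rfl, e⟩
    · obtain ⟨ε, ⟨h2, e⟩, h3⟩ := (hr.and h1).exists
      rw [← h3.2, colourAt_eq col h2, e]
  obtain ⟨r, hr, rfl⟩ := key 1 x (Complex.I * deriv (D.γ a) t)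
    (by rw [planeArea_mul_I_self]; linarith) hx
  obtain ⟨s, hs, rfl⟩ := key (-1) y (-(Complex.I * deriv (D.γ a) t)) (by
    have e : -(Complex.I * deriv (D.γ a) t) = ((-1 : ℝ) : ℂ) * (Complex.I * deriv (D.γ a) t) := by
      simp
    rw [e, planeArea_real_mul, planeArea_mul_I_self]; linarith) hy
  refine hcol r s ⟨(a, t), ht.1, ht.2, fun q hq => hX ⟨q, ?_⟩, hr, hs⟩
  rwa [fract_eq ht]

variable (col) in
open Classical in
/-- The colour on the left of an arc. -/
def leftColour (a : D.Arc) (t : ℝ) : ZMod 2 :=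
  if h : ∃ x, SideColour col (D.γ a) t 1 x then h.choose else 0

theorem sideColour_leftColour {a : D.Arc} {t : ℝ} (h : IsInner a t) (hX : ¬ IsCrossing a t) :
    SideColour col (D.γ a) t 1 (leftColour col a t) := by
  have h1 := exists_sideColour_arc (col := col) h hX 1
  unfold leftColour
  rw [dif_pos h1]
  exact h1.choose_spec

theorem sideColour_add_int {a : D.Arc} (h : D.IsClosedArc a) (t : ℝ) (n : ℤ) (η : ℝ) (x : ZMod 2) :
    SideColour col (D.γ a) (t + n) η x ↔ SideColour col (D.γ a) t η x := by
  have e : (fun s => D.γ a (s + (n : ℝ))) = D.γ a := funext fun s => γ_add_int h s n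
  unfold SideColour
  have hd := deriv_comp_add_const (D.γ a) (n : ℝ) t
  rw [e] at hd
  rw [← hd]
  refine forall_congr' fun w => imp_congr_right fun _ => ?_
  let f : ℝ × ℝ × ℂ ≃ₜ ℝ × ℝ × ℂ :=
    (Homeomorph.addRight (n : ℝ)).prodCongr (Homeomorph.refl (ℝ × ℂ))
  have hm : Filter.map f (𝓝[sideSet] (t, 0, w)) = 𝓝[sideSet] (t + n, 0, w) := by
    have hf := f.isEmbedding.map_nhdsWithin_eq sideSet (t, 0, w)
    have e2 : f '' sideSet = sideSet := by
      ext ⟨p, q⟩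
      constructor
      · rintro ⟨⟨p', q'⟩, h, h'⟩
        obtain ⟨-, rfl⟩ := Prod.mk.inj h'
        exact h
      · intro h
        exact ⟨(p - n, q), h, by simp [f]⟩
    rw [e2] at hf
    exact hf
  rw [← hm, Filter.eventually_map]
  refine Filter.eventually_congr (Filter.Eventually.of_forall fun p => ?_)
  change (D.γ a (p.1 + n) + _ ∈ D.free ∧ colourAt col (D.γ a (p.1 + n) + _) = x) ↔ _
  rw [γ_add_int h]
  rfl

theorem leftColour_add_int {a : D.Arc} (h : D.IsClosedArc a) (t : ℝ) (n : ℤ) :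
    leftColour col a (t + n) = leftColour col a t := by
  have e : SideColour col (D.γ a) (t + n) 1 = SideColour col (D.γ a) t 1 :=
    funext fun x => propext (sideColour_add_int h t n 1 x)
  unfold leftColour
  rw [e]

/-- `Adjacent` only sees parameters strictly between 0 and 1, hence the condition on the fractional
part on closed arcs. -/
theorem SideColour.opposite_of_fract (hcol : ∀ r s, D.Adjacent r s → col r = col s + 1)
    {a : D.Arc} {t : ℝ} (h : IsInner a t) (ht : 0 < Int.fract t) (hX : ¬ IsCrossing a t)
    {x y : ZMod 2} (hx : SideColour col (D.γ a) t 1 x) (hy : SideColour col (D.γ a) t (-1) y) :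
    x = y + 1 := by
  rcases h with h | h
  · rw [← Int.fract_add_floor t, sideColour_add_int h] at hx hy
    refine SideColour.opposite hcol ⟨ht, Int.fract_lt_one t⟩ (fun h => hX ?_) hx hy
    unfold IsCrossing at h ⊢
    rwa [Int.fract_fract] at h
  · exact SideColour.opposite hcol h hX hx hy

theorem eventually_leftColour_eq {a : D.Arc} {t : ℝ} (h : IsInner a t) {l : Filter ℝ}
    (hl : l ≤ 𝓝[≠] t) {q : ZMod 2}
    (hq : ∀ᶠ t' in l, ∀ x', SideColour col (D.γ a) t' 1 x' → x' = q) :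
    ∀ᶠ t' in l, leftColour col a t' = q := by
  filter_upwards [hq, hl (eventually_not_isCrossing a t),
    (hl.trans nhdsWithin_le_nhds) (eventually_isInner h)] with t' h1 h2 h3
  exact h1 _ (sideColour_leftColour h3 h2)

/-- With `m` the area of the two velocities, the branch `raySet m s` of the other strand leaves to
the left of `a`. It separates the left quadrant before the crossing, `α = -1`, from the one after
it, `α = 1`, so they have opposite colours. -/
theorem exists_leftColour_flip (hcol : ∀ r s, D.Adjacent r s → col r = col s + 1) {a : D.Arc}
    {t : ℝ} (h : IsInner a t) (hX : IsCrossing a t) :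
    ∃ q, (∀ᶠ t' in 𝓝[<] t, leftColour col a t' = q) ∧
      ∀ᶠ t' in 𝓝[>] t, leftColour col a t' = q + 1 := by
  obtain ⟨⟨b, s⟩, hM⟩ := hX
  have hpt : D.γ a (Int.fract t) = D.γ b s := hM.2.2.2
  have hs : IsInner b s := isInner_of_norm_lt hM.2.1.1 hM.2.1.2.1 (by
    rw [← hpt, γ_fract h]; exact norm_lt_of_isInner h)
  have hs1 : s < 1 := by
    rcases hs with hs | hs
    · exact hM.2.1.2.2 hs
    · exact hs.2
  have hfs : Int.fract s = s := Int.fract_eq_self.2 ⟨hM.2.1.1, hs1⟩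
  have hM' : D.Meet (a, Int.fract t) (b, Int.fract s) := by rwa [hfs]
  have hts : D.γ a t = D.γ b s := by rw [← hpt, γ_fract h]
  have huv : planeArea (deriv (D.γ a) t) (deriv (D.γ b) s) ≠ 0 := by
    have := planeArea_ne_zero_of_linearIndependent (D.meet_transverse _ _ hM)
    rwa [show D.velocity (a, Int.fract t) = deriv (D.γ a) (Int.fract t) from rfl,
      deriv_γ_fract h] at this
  set m := planeArea (deriv (D.γ a) t) (deriv (D.γ b) s) with hm
  have hvu : planeArea (deriv (D.γ b) s) (deriv (D.γ a) t) = -m := planeArea_swap _ _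
  have key : ∀ α : ℝ, α ≠ 0 → ∃ q, (∀ᶠ t' in 𝓝[raySet α t] t, leftColour col a t' = q) ∧
      ∀ᶠ s' in 𝓝[raySet m s] s, ∀ x', SideColour col (D.γ b) s' (α * -m) x' → x' = q := by
    intro α hα
    obtain ⟨q, hq⟩ := exists_quadrant_colour (col := col) (D.contDiff a) (D.contDiff b) hts
      (norm_lt_of_isInner h) huv hα huv
      (fun N hN M hM => eventually_trace_of_meet h hs hM' hN hM)
    refine ⟨q, eventually_leftColour_eq h (nhdsWithin_mono t ?_) ?_, ?_⟩
    · rintro t' ht' rfl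
      simp [raySet] at ht'
    · filter_upwards [sideColour_eq_of_quadrant (D.contDiff a) (D.contDiff b) hts huv huv hq]
        with t' ht' x' hx'
      refine ht' x' (hx'.of_mul_pos ?_)
      rw [one_mul]
      exact mul_self_pos.2 huv
    · rw [← hvu]
      refine sideColour_eq_of_quadrant (D.contDiff b) (D.contDiff a) hts.symm
        (by rw [hvu]; exact neg_ne_zero.2 huv) hα ?_
      rw [nhdsWithin_prod_eq] at hq ⊢
      have hsw : Filter.Tendsto Prod.swap (𝓝[raySet m s] s ×ˢ 𝓝[raySet α t] t)
          (𝓝[raySet α t] t ×ˢ 𝓝[raySet m s] s) := Filter.tendsto_snd.prodMk Filter.tendsto_fst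
      filter_upwards [hsw.eventually hq] with p hp
      rw [← hp]
      congr 1
      simp only [Prod.fst_swap, Prod.snd_swap, hts]
      ring
  obtain ⟨q₁, h₁, k₁⟩ := key 1 one_ne_zero
  obtain ⟨q₂, h₂, k₂⟩ := key (-1) (by norm_num)
  -- Compare both quadrants at one parameter of the separating branch that is neither a crossing nor
  -- an integer; the sign of `m` tells which quadrant is on its left.
  have hq : q₁ = q₂ + 1 := by
    have := neBot_raySet huv s
    have hle : 𝓝[raySet m s] s ≤ 𝓝[≠] s := nhdsWithin_mono s (by
      rintro t' ht' rfl
      simp [raySet] at ht')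
    have hint : ∀ᶠ s' in 𝓝[≠] s, 0 < Int.fract s' := by
      have hcl : {s' : ℝ | ∃ n : ℤ, (n : ℝ) = s' ∧ s' ∈ Set.Icc (s - 1) (s + 1)}.Finite := by
        refine ((Set.finite_Icc ⌊s - 1⌋ ⌊s + 1⌋).image (fun n : ℤ => (n : ℝ))).subset ?_
        rintro _ ⟨n, rfl, hn⟩
        refine ⟨n, ⟨?_, ?_⟩, rfl⟩
        · simpa using Int.floor_le_floor hn.1
        · simpa using Int.floor_le_floor hn.2
      have h2 := (hcl.subset (Set.sdiff_subset (t := {s}))).isClosed.isOpen_compl.mem_nhds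
        (show s ∈ _ by simp)
      filter_upwards [self_mem_nhdsWithin, nhdsWithin_le_nhds h2, nhdsWithin_le_nhds
        (Icc_mem_nhds (by linarith : s - 1 < s) (by linarith : s < s + 1))] with s' e0 e1 e2
      refine lt_of_le_of_ne (Int.fract_nonneg s') fun e => e1 ⟨⟨⌊s'⌋, ?_, e2⟩, e0⟩
      have := Int.floor_add_fract s'
      rw [← e] at this
      simpa using this
    have hX' : ∀ᶠ s' in 𝓝[raySet m s] s, ¬ IsCrossing b s' := hle (eventually_not_isCrossing b s)
    have hI' : ∀ᶠ s' in 𝓝[raySet m s] s, IsInner b s' :=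
      (hle.trans nhdsWithin_le_nhds) (eventually_isInner hs)
    obtain ⟨s', e1, e2, e3, e4, e5⟩ := (k₁.and (k₂.and (hX'.and
      ((show ∀ᶠ s' in 𝓝[raySet m s] s, 0 < Int.fract s' from hle hint).and hI')))).exists
    obtain ⟨x, hx⟩ := exists_sideColour_arc (col := col) e5 e3 m
    obtain ⟨y, hy⟩ := exists_sideColour_arc (col := col) e5 e3 (-m)
    have hmm : 0 < m * m := mul_self_pos.2 huv
    rw [← e1 y (hy.of_mul_pos (by linarith)), ← e2 x (hx.of_mul_pos (by linarith))]
    rcases lt_or_gt_of_ne huv with hneg | hpos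
    · exact SideColour.opposite_of_fract hcol e5 e4 e3 (hy.of_mul_pos (by linarith))
        (hx.of_mul_pos (by linarith))
    · have := SideColour.opposite_of_fract hcol e5 e4 e3 (hx.of_mul_pos (η' := 1) (by linarith))
        (hy.of_mul_pos (η' := -1) (by linarith))
      have h2 : ∀ x y : ZMod 2, x = y + 1 → y = x + 1 := by decide
      exact h2 _ _ this
  refine ⟨q₂, ?_, ?_⟩
  · have : raySet (-1) t = Set.Iio t := by ext; simp [raySet]
    rwa [this] at h₂
  · have : raySet 1 t = Set.Ioi t := by ext; simp [raySet]
    rw [this, hq] at h₁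
    exact h₁

theorem exists_leftColour_step (hcol : ∀ r s, D.Adjacent r s → col r = col s + 1) {a : D.Arc}
    {t : ℝ} (h : IsInner a t) :
    ∃ q, (∀ᶠ t' in 𝓝[<] t, leftColour col a t' = q) ∧
      ((IsCrossing a t → ∀ᶠ t' in 𝓝[>] t, leftColour col a t' = q + 1) ∧
        (¬ IsCrossing a t → ∀ᶠ t' in 𝓝[>] t, leftColour col a t' = q)) := by
  by_cases hX : IsCrossing a t
  · obtain ⟨q, h1, h2⟩ := exists_leftColour_flip hcol h hX
    exact ⟨q, h1, fun _ => h2, fun h => absurd hX h⟩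
  · have h1 := (sideColour_leftColour (col := col) h hX).eventually_eq_self (D.contDiff a)
      one_ne_zero (deriv_γ_ne_zero h)
    have h2 : ∀ᶠ t' in 𝓝[≠] t, leftColour col a t' = leftColour col a t :=
      eventually_leftColour_eq h le_rfl (nhdsWithin_le_nhds h1)
    exact ⟨leftColour col a t, nhdsWithin_mono t (fun _ h => ne_of_lt h) h2, fun h => absurd h hX,
      fun _ => nhdsWithin_mono t (fun _ h => ne_of_gt h) h2⟩

end LinkDiagram
end

/-! ### Ends on the boundary circle: the sector case -/

noncomputable section

/-- The real inner product of two vectors of the plane. -/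
def planeDot (u w : ℂ) : ℝ := u.re * w.re + u.im * w.im

theorem planeArea_mul_mul (z x y : ℂ) : planeArea (z * x) (z * y) = ‖z‖ ^ 2 * planeArea x y := by
  rw [← Complex.normSq_eq_norm_sq, Complex.normSq_apply]
  simp [planeArea]; ring

theorem planeArea_mul_self (z x : ℂ) : planeArea z (z * x) = ‖z‖ ^ 2 * x.im := by
  rw [← Complex.normSq_eq_norm_sq, Complex.normSq_apply]
  simp [planeArea]; ring

theorem planeDot_mul_self (z x : ℂ) : planeDot z (z * x) = ‖z‖ ^ 2 * x.re := by
  rw [← Complex.normSq_eq_norm_sq, Complex.normSq_apply]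
  simp [planeDot]; ring

theorem planeDot_add (u w z : ℂ) : planeDot u (w + z) = planeDot u w + planeDot u z := by
  simp [planeDot]; ring

theorem abs_planeDot_le (u w : ℂ) : |planeDot u w| ≤ ‖u‖ * ‖w‖ := by
  have : planeDot u w = (conj u * w).re := by simp [planeDot]
  rw [this]
  refine (Complex.abs_re_le_norm _).trans ?_
  rw [norm_mul, Complex.norm_conj]

theorem HasStrictDerivAt.eventually_norm_sub_le_zero {c : ℝ → ℂ} {u : ℂ}
    (hc : HasStrictDerivAt c u 0) {δ : ℝ} (hδ : 0 < δ) :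
    ∀ᶠ τ : ℝ in 𝓝 0, ‖c τ - c 0 - (τ : ℂ) * u‖ ≤ δ * |τ| := by
  have h1 : Filter.Tendsto (fun τ : ℝ => (τ, (0 : ℝ))) (𝓝 0) (𝓝 (0, 0)) :=
    (Continuous.prodMk_left (0 : ℝ)).tendsto 0
  filter_upwards [h1.eventually (hc.eventually_norm_sub_le hδ)] with τ hτ
  simpa using hτ

/-- A curve that reaches the unit circle from the inside does not point inwards. -/
theorem planeDot_deriv_nonneg {c : ℝ → ℂ} {u : ℂ} (hc : HasStrictDerivAt c u 0) (h0 : ‖c 0‖ = 1)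
    (hin : ∀ᶠ τ in 𝓝[<] (0 : ℝ), ‖c τ‖ < 1) : 0 ≤ planeDot (c 0) u := by
  by_contra hneg
  push Not at hneg
  set m := -planeDot (c 0) u with hm
  have hm0 : 0 < m := by linarith
  have h1 := nhdsWithin_le_nhds (s := Set.Iio 0)
    (hc.eventually_norm_sub_le_zero (δ := m / 2) (by positivity))
  obtain ⟨τ, h2, h3, h4 : τ < 0⟩ := (hin.and (Filter.Eventually.and h1 self_mem_nhdsWithin)).exists
  have e : c τ = c 0 + (τ * u + (c τ - c 0 - τ * u)) := by ring
  have k1 : planeDot (c 0) (c τ) = 1 + (τ * -m + planeDot (c 0) (c τ - c 0 - τ * u)) := by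
    conv_lhs => rw [e]
    rw [planeDot_add, planeDot_add]
    have e1 : planeDot (c 0) (c 0) = 1 := by
      have := planeDot_mul_self (c 0) 1
      simpa [h0] using this
    have e2 : planeDot (c 0) (τ * u) = τ * -m := by
      rw [hm]; simp [planeDot]; ring
    rw [e1, e2]
  have k2 := abs_planeDot_le (c 0) (c τ - c 0 - τ * u)
  have k3 := abs_planeDot_le (c 0) (c τ)
  rw [h0, one_mul] at k2 k3
  rw [abs_of_neg h4] at h3
  have k4 := (abs_le.1 (k2.trans h3)).1
  have k5 := (abs_le.1 k3).2
  nlinarith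

theorem norm_exp_sub_le {x : ℝ} (hx : |x| ≤ 1) :
    ‖Complex.exp (x * Complex.I) - 1 - x * Complex.I‖ ≤ x ^ 2 := by
  have := Complex.norm_exp_sub_one_sub_id_le (x := x * Complex.I) (by simpa using hx)
  simpa using this

/-- A spiral that turns to the side `η` while shrinking. Multiplying a curve in the disc by it gives
points beside the curve that stay inside the disc. -/
theorem hasDerivAt_exp_mul (η k : ℝ) :
    HasDerivAt (fun θ : ℝ => Complex.exp ((η * θ : ℝ) * Complex.I) * (1 - (k * θ : ℝ)))
      (η * Complex.I - k) 0 := by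
  have h1 : HasDerivAt (fun θ : ℝ => Complex.exp ((η * θ : ℝ) * Complex.I)) (η * Complex.I) 0 := by
    have h2 : HasDerivAt (fun θ : ℝ => ((η * θ : ℝ) : ℂ) * Complex.I) (η * Complex.I) 0 := by
      have h3 : HasDerivAt (fun θ : ℝ => η * θ) η 0 := by
        simpa using (hasDerivAt_id (0 : ℝ)).const_mul η
      exact h3.ofReal_comp.mul_const _
    have h4 := h2.cexp
    simpa using h4
  have h5 : HasDerivAt (fun θ : ℝ => (1 : ℂ) - (k * θ : ℝ)) (-k) 0 := by
    have h3 : HasDerivAt (fun θ : ℝ => k * θ) k 0 := by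
      simpa using (hasDerivAt_id (0 : ℝ)).const_mul k
    exact h3.ofReal_comp.const_sub 1
  refine (h1.fun_mul h5).congr_deriv ?_
  simp [sub_eq_add_neg]

namespace LinkDiagram

variable {D : LinkDiagram} {col : D.Region → ZMod 2}

/-- A curve ending on the unit circle, not tangentially to the side `-η`: the colour on the side
`η` near the end is the colour of the points of the circle on that side. -/
theorem exists_end_colour_of_pos {c : ℝ → ℂ} {η B : ℝ} {y : ℂ} (hc : ContDiff ℝ 1 c)
    (h0 : ‖c 0‖ = 1) (hin : ∀ᶠ τ in 𝓝[<] (0 : ℝ), ‖c τ‖ < 1) (hu : deriv c 0 = c 0 * y)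
    (hη : η * η = 1) (hB : 0 < B) (hρ : 0 ≤ y.re) (hpos : 0 < y.re + B * (η * y.im))
    (hloc : ∀ N ∈ 𝓝 (0 : ℝ), ∀ᶠ z in 𝓝 (c 0), z ∈ D.trace → ∃ τ ∈ N, τ ≤ 0 ∧ c τ = z)
    (hbd : ∀ᶠ z in 𝓝 (c 0), z ≠ c 0 → ‖z‖ = 1 → -z ∉ D.trace) :
    ∃ q, (∀ᶠ τ in 𝓝[<] (0 : ℝ), ∀ x', SideColour col c τ η x' → x' = q) ∧
      ∀ᶠ θ in 𝓝[>] (0 : ℝ), c 0 * Complex.exp ((η * θ : ℝ) * Complex.I) ∈ D.free ∧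
        colourAt col (c 0 * Complex.exp ((η * θ : ℝ) * Complex.I)) = q := by
  have hcc := hc.continuous
  have hst : HasStrictDerivAt c (deriv c 0) 0 := hc.contDiffAt.hasStrictDerivAt one_ne_zero
  set z₀ := c 0 with hz₀
  have hz₀0 : z₀ ≠ 0 := by intro h; simp [h] at h0
  -- Halving keeps the expression in `hpos` positive, because `0 ≤ y.re`, and leaves room between
  -- the slope `k` of the sector and the separating slope `B`.
  set k := B / 2 with hk
  have hk0 : 0 < k := by positivity
  have hpos' : 0 < y.re + k * (η * y.im) := by rw [hk]; linarith
  set g : ℝ → ℂ := fun θ => Complex.exp ((η * θ : ℝ) * Complex.I) * (1 - (k * θ : ℝ)) with hg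
  have hgd : HasDerivAt g (η * Complex.I - k) 0 := hasDerivAt_exp_mul η k
  have hgc : Continuous g := by fun_prop
  have hg0 : g 0 = 1 := by simp [hg]
  have harea : planeArea (deriv c 0) (z₀ * (η * Complex.I - k)) = η * (y.re + k * (η * y.im)) := by
    rw [hu, planeArea_mul_mul, h0]
    simp [planeArea]
    linear_combination (-(k * y.im)) * hη
  have hη0 : η ≠ 0 := by rintro rfl; simp at hη
  -- the strip next to the curve
  have hstrip : ∀ᶠ p : ℝ × ℝ in 𝓝[Set.Iic 0 ×ˢ Set.Ioi 0] (0, 0), c p.1 * g p.2 ∈ D.free := by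
    have hw : planeArea (deriv c 0) (z₀ * (η * Complex.I - k)) ≠ 0 := by
      rw [harea]; exact mul_ne_zero hη0 hpos'.ne'
    obtain ⟨U, hU, V, hV, hUV⟩ := mem_nhds_prod_iff.1 (hst.eventually_ne_add hw)
    obtain ⟨N, hN, N', hN', hNN⟩ := mem_nhds_prod_iff.1 hU
    have hF0 : Filter.Tendsto (fun p : ℝ × ℝ => c p.1 * g p.2)
        (𝓝[Set.Iic 0 ×ˢ Set.Ioi 0] (0, 0)) (𝓝 z₀) := by
      have h1 : Continuous fun p : ℝ × ℝ => c p.1 * g p.2 := by fun_prop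
      have := h1.tendsto (0, 0)
      simp only [hg0, mul_one] at this
      exact this.mono_left nhdsWithin_le_nhds
    have t1 : Filter.Tendsto (Prod.fst : ℝ × ℝ → ℝ) (𝓝[Set.Iic 0 ×ˢ Set.Ioi 0] (0, 0))
        (𝓝[Set.Iic 0] 0) := by rw [nhdsWithin_prod_eq]; exact Filter.tendsto_fst
    have t2 : Filter.Tendsto (Prod.snd : ℝ × ℝ → ℝ) (𝓝[Set.Iic 0 ×ˢ Set.Ioi 0] (0, 0))
        (𝓝[>] 0) := by rw [nhdsWithin_prod_eq]; exact Filter.tendsto_snd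
    have t3 : Filter.Tendsto (fun p : ℝ × ℝ => c p.1 * slope g 0 p.2)
        (𝓝[Set.Iic 0 ×ˢ Set.Ioi 0] (0, 0)) (𝓝 (z₀ * (η * Complex.I - k))) := by
      refine Filter.Tendsto.mul ?_ ?_
      · exact (hcc.tendsto 0).comp (t1.mono_right nhdsWithin_le_nhds)
      · have := (hasDerivAt_iff_tendsto_slope.1 hgd).mono_left
          (nhdsWithin_mono (0 : ℝ) (fun x (hx : 0 < x) => hx.ne' : Set.Ioi (0 : ℝ) ⊆ {0}ᶜ))
        exact this.comp t2
    have k0 : ∀ᶠ τ in 𝓝[Set.Iic 0] (0 : ℝ), ‖c τ‖ ≤ 1 := by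
      have h1 : ∀ᶠ τ in 𝓝 (0 : ℝ), τ < 0 → ‖c τ‖ < 1 := eventually_nhdsWithin_iff.1 hin
      rw [eventually_nhdsWithin_iff]
      filter_upwards [h1] with τ h2 (h3 : τ ≤ 0)
      rcases h3.eq_or_lt with rfl | h3
      · exact h0.le
      · exact (h2 h3).le
    have k1 := hF0.eventually (hloc N hN)
    have k2 : ∀ᶠ θ : ℝ in 𝓝[>] 0, k * θ < 1 := by
      have h1 : Continuous fun θ : ℝ => k * θ := by fun_prop
      exact nhdsWithin_le_nhds (h1.continuousAt.eventually_lt_const (by simp))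
    have k3 : ∀ᶠ τ in 𝓝[Set.Iic 0] (0 : ℝ), τ ∈ N' := nhdsWithin_le_nhds hN'
    filter_upwards [k1, t2.eventually k2, t1.eventually k3, t3.eventually hV, t1.eventually k0,
      self_mem_nhdsWithin] with p p1 p2 p3 p4 p5 p6
    have hθ : 0 < p.2 := p6.2
    refine mem_free_of_norm_lt ?_ fun htr => ?_
    · have e1 : ‖g p.2‖ = 1 - k * p.2 := by
        simp only [hg]
        rw [norm_mul, Complex.norm_exp_ofReal_mul_I, one_mul, ← Complex.ofReal_one,
          ← Complex.ofReal_sub, Complex.norm_real, Real.norm_of_nonneg (by linarith)]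
      rw [norm_mul, e1]
      have : 0 < k * p.2 := by positivity
      have := norm_nonneg (c p.1)
      nlinarith
    · obtain ⟨τ', hτ', -, e⟩ := p1 htr
      refine hUV (Set.mk_mem_prod (hNN (Set.mk_mem_prod hτ' p3)) p4) p.2 hθ.ne' ?_
      rw [e]
      have hθ' : (p.2 : ℂ) ≠ 0 := by exact_mod_cast hθ.ne'
      simp only [slope_def_module, hg0, sub_zero, Complex.real_smul, Complex.ofReal_inv]
      field_simp
      ring
  have hnb : (𝓝[Set.Iic 0 ×ˢ Set.Ioi 0] ((0 : ℝ), (0 : ℝ))).NeBot := by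
    rw [nhdsWithin_prod_eq]; infer_instance
  obtain ⟨q, hq⟩ := exists_eventually_colour (D := D) col
    ((convex_Iic (0 : ℝ)).prod (convex_Ioi (0 : ℝ))) (0, 0) (fun p : ℝ × ℝ => c p.1 * g p.2)
    (by fun_prop) hstrip
  refine ⟨q, ?_, ?_⟩
  · refine SideColour.eventually_eq (A := Set.Iio 0) (fun τ θ => c τ * g θ)
      (fun τ => c τ * (η * Complex.I - k)) ?_ ?_
    · have : 𝓝[Set.Iio 0 ×ˢ Set.Ioi 0] ((0 : ℝ), (0 : ℝ)) ≤ 𝓝[Set.Iic 0 ×ˢ Set.Ioi 0] (0, 0) :=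
        nhdsWithin_mono _ (Set.prod_mono Set.Iio_subset_Iic_self subset_rfl)
      exact this (hq.mono fun _ h => h.2)
    · have hcont : Continuous fun τ => η * planeArea (deriv c τ) (c τ * (η * Complex.I - k)) := by
        have := hc.continuous_deriv le_rfl
        unfold planeArea
        fun_prop
      have h1 : 0 < η * planeArea (deriv c 0) (c 0 * (η * Complex.I - k)) := by
        rw [← hz₀, harea, ← mul_assoc, hη, one_mul]; exact hpos'
      filter_upwards [nhdsWithin_le_nhds (hcont.continuousAt.eventually_const_lt h1)] with τ hτ
      exact ⟨(hgd.const_mul (c τ)).hasDerivWithinAt, by rw [hg0, mul_one], hτ⟩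
  -- the sector between the strip and the circle
  set C : Set (ℝ × ℝ) := {p | 0 < p.1 ∧ 0 ≤ p.2 ∧ p.2 ≤ k * p.1} with hC
  have hCconv : Convex ℝ C := by
    rintro ⟨a1, a2⟩ ⟨p1, p2, p3⟩ ⟨b1, b2⟩ ⟨q1, q2, q3⟩ s t hs ht hst
    simp only [Prod.smul_mk, Prod.mk_add_mk, smul_eq_mul] at *
    refine ⟨?_, ?_, ?_⟩
    · simp only
      rcases hs.eq_or_lt with rfl | hs
      · have : t = 1 := by linarith
        subst this; simpa using q1
      · have := mul_pos hs p1
        have := mul_nonneg ht q1.le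
        linarith
    · simp only; positivity
    · simp only; nlinarith
  set G : ℝ × ℝ → ℂ := fun p => z₀ * (Complex.exp ((η * p.1 : ℝ) * Complex.I) * (1 - (p.2 : ℝ)))
    with hG
  have hGc : Continuous G := by fun_prop
  have habs : |η| = 1 := by
    have : |η| * |η| = 1 := by rw [← abs_mul, hη, abs_one]
    nlinarith [abs_nonneg η]
  have tip : ∀ᶠ p in 𝓝[C] ((0 : ℝ), (0 : ℝ)), G p ∈ D.free := by
    set m := y.re + B * (η * y.im) with hm
    have d1 := hst.eventually_norm_sub_le_zero (δ := m / (1 + B)) (by positivity)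
    have hG0 : Filter.Tendsto G (𝓝[C] (0, 0)) (𝓝 z₀) := by
      have := hGc.tendsto (0, 0)
      simp only [hG] at this
      simp only [mul_zero, Complex.ofReal_zero, zero_mul, Complex.exp_zero, sub_zero, mul_one]
        at this
      exact this.mono_left nhdsWithin_le_nhds
    have k1 := hG0.eventually (hloc _ d1)
    have k2 := hG0.eventually hbd
    have k3 : ∀ᶠ p : ℝ × ℝ in 𝓝[C] (0, 0), p.1 < 1 ∧ (1 + B) * ((1 + k) * p.1) < k ∧ p.2 < 1 := by
      have a1 : Continuous fun p : ℝ × ℝ => (1 + B) * ((1 + k) * p.1) := by fun_prop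
      have b1 : ∀ᶠ p : ℝ × ℝ in 𝓝 (0, 0), p.1 < 1 :=
        continuous_fst.continuousAt.eventually_lt_const (by simp)
      have b2 : ∀ᶠ p : ℝ × ℝ in 𝓝 (0, 0), (1 + B) * ((1 + k) * p.1) < k :=
        a1.continuousAt.eventually_lt_const (by simpa using hk0)
      have b3 : ∀ᶠ p : ℝ × ℝ in 𝓝 (0, 0), p.2 < 1 :=
        continuous_snd.continuousAt.eventually_lt_const (by simp)
      exact nhdsWithin_le_nhds (b1.and (b2.and b3))
    filter_upwards [k1, k2, k3, self_mem_nhdsWithin] with p p1 p2 ⟨p3, p4, p5⟩ ⟨p6, p7, p8⟩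
    have hnorm : ‖G p‖ = 1 - p.2 := by
      simp only [hG]
      rw [norm_mul, norm_mul, Complex.norm_exp_ofReal_mul_I, one_mul, h0, one_mul,
        ← Complex.ofReal_one, ← Complex.ofReal_sub, Complex.norm_real,
        Real.norm_of_nonneg (by linarith)]
    -- the deviation from the tangent cone
    set e₂ : ℂ := Complex.exp ((η * p.1 : ℝ) * Complex.I) - 1 - (η * p.1 : ℝ) * Complex.I
      - p.2 * (Complex.exp ((η * p.1 : ℝ) * Complex.I) - 1) with he₂
    have hx : |η * p.1| = p.1 := by rw [abs_mul, habs, one_mul, abs_of_pos p6]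
    have b1 := norm_exp_sub_le (x := η * p.1) (by rw [hx]; exact p3.le)
    have b2 : ‖Complex.exp ((η * p.1 : ℝ) * Complex.I) - 1‖ ≤ p.1 := by
      have := Real.norm_exp_I_mul_ofReal_sub_one_le (x := η * p.1)
      rw [Real.norm_eq_abs, hx, mul_comm] at this
      exact this
    have b3 : ‖e₂‖ ≤ (1 + k) * p.1 * p.1 := by
      refine (norm_sub_le _ _).trans ?_
      rw [norm_mul, Complex.norm_real, Real.norm_of_nonneg p7]
      have : (η * p.1) ^ 2 = p.1 * p.1 := by linear_combination (p.1 * p.1) * hη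
      rw [this] at b1
      have : p.2 * ‖Complex.exp ((η * p.1 : ℝ) * Complex.I) - 1‖ ≤ k * p.1 * p.1 :=
        mul_le_mul p8 b2 (norm_nonneg _) (by positivity)
      linarith
    have hval : G p = z₀ + z₀ * (((η * p.1 : ℝ) * Complex.I - p.2) + e₂) := by
      simp only [hG, he₂]; ring
    have key : G p ∉ D.trace ∧ G p ≠ z₀ := by
      have hne : ∀ τ : ℝ, τ ≤ 0 → ‖c τ - c 0 - (τ : ℂ) * deriv c 0‖ ≤ m / (1 + B) * |τ| →
          c τ ≠ G p := by
        intro τ hτ0 hτ e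
        set e₁ := c τ - c 0 - (τ : ℂ) * deriv c 0 with he₁
        have f1 : z₀ * (((η * p.1 : ℝ) * Complex.I - p.2) + e₂) = z₀ * (τ * y) + e₁ := by
          have : c τ = z₀ + z₀ * (τ * y) + e₁ := by rw [he₁, hu]; ring
          rw [e, hval] at this
          linear_combination this
        -- This functional separates: to first order it is `τ * m ≤ 0` on the curve and `B * p.1 -
        -- p.2`, at least `k * p.1`, on the sector. The quadratic errors stay below that by the
        -- choice of `k3`.
        have f2 := congrArg (fun w => planeDot z₀ w + η * B * planeArea z₀ w) f1
        simp only [planeDot_add, planeArea_add, planeDot_mul_self, planeArea_mul_self, h0] at f2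
        simp at f2
        have g1 := abs_planeDot_le z₀ e₁
        have g2 := abs_planeArea_le z₀ e₁
        rw [h0, one_mul] at g1 g2
        have g3 := Complex.abs_re_le_norm e₂
        have g4 := Complex.abs_im_le_norm e₂
        have g5 : |η * B * planeArea z₀ e₁| ≤ B * (m / (1 + B) * |τ|) := by
          rw [abs_mul, abs_mul, habs, one_mul, abs_of_pos hB]
          exact mul_le_mul_of_nonneg_left (g2.trans hτ) hB.le
        have g6 : |η * B * e₂.im| ≤ B * ((1 + k) * p.1 * p.1) := by
          rw [abs_mul, abs_mul, habs, one_mul, abs_of_pos hB]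
          exact mul_le_mul_of_nonneg_left (g4.trans b3) hB.le
        have g7 := (abs_le.1 g5).2
        have g8 := (abs_le.1 g6).1
        have g9 := (abs_le.1 (g1.trans hτ)).2
        have g10 := (abs_le.1 (g3.trans b3)).1
        rw [abs_of_nonpos hτ0] at g7 g9
        have g11 : m / (1 + B) * -τ + B * (m / (1 + B) * -τ) = -(τ * m) := by
          field_simp
          ring
        have g12 : η * B * (η * p.1) = B * p.1 := by linear_combination (B * p.1) * hη
        have g13 : (1 + B) * ((1 + k) * p.1) * p.1 < k * p.1 := mul_lt_mul_of_pos_right p4 p6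
        have g14 : B * p.1 = 2 * (k * p.1) := by rw [hk]; ring
        have g15 : τ * m = τ * y.re + η * B * (τ * y.im) := by rw [hm]; ring
        rw [mul_add, mul_add, g12] at f2
        linarith
      refine ⟨fun htr => ?_, fun h => ?_⟩
      · obtain ⟨τ, hτ, hτ0, e⟩ := p1 htr
        exact hne τ hτ0 hτ e
      · refine hne 0 le_rfl ?_ h.symm
        simp
    refine mem_free (by rw [hnorm]; linarith) key.1 fun h1 => p2 key.2 h1
  have hCnb : Filter.Tendsto (fun θ : ℝ => (θ, (0 : ℝ))) (𝓝[>] 0) (𝓝[C] (0, 0)) := by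
    refine tendsto_nhdsWithin_iff.2 ⟨?_, ?_⟩
    · exact ((Continuous.prodMk_left (0 : ℝ)).tendsto 0).mono_left nhdsWithin_le_nhds
    · filter_upwards [self_mem_nhdsWithin] with θ (hθ : 0 < θ)
      exact ⟨hθ, le_rfl, by simp only; positivity⟩
  have hCk : Filter.Tendsto (fun θ : ℝ => (θ, k * θ)) (𝓝[>] 0) (𝓝[C] (0, 0)) := by
    refine tendsto_nhdsWithin_iff.2 ⟨?_, ?_⟩
    · have h1 : Continuous fun θ : ℝ => (θ, k * θ) := by fun_prop
      have := h1.tendsto 0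
      rw [mul_zero] at this
      exact this.mono_left nhdsWithin_le_nhds
    · filter_upwards [self_mem_nhdsWithin] with θ (hθ : 0 < θ)
      exact ⟨hθ, by simp only; positivity, le_rfl⟩
  have hnb2 : (𝓝[C] ((0 : ℝ), (0 : ℝ))).NeBot := hCnb.neBot
  obtain ⟨q₂, hq₂⟩ := exists_eventually_colour (D := D) col hCconv (0, 0) G hGc.continuousOn tip
  have hCs : Filter.Tendsto (fun θ : ℝ => ((0 : ℝ), θ)) (𝓝[>] 0)
      (𝓝[Set.Iic 0 ×ˢ Set.Ioi 0] (0, 0)) := by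
    refine tendsto_nhdsWithin_iff.2 ⟨?_, ?_⟩
    · exact ((Continuous.prodMk_right (0 : ℝ)).tendsto 0).mono_left nhdsWithin_le_nhds
    · filter_upwards [self_mem_nhdsWithin] with θ (hθ : 0 < θ)
      exact ⟨le_refl (0 : ℝ), hθ⟩
  -- The strip at parameter 0 and the edge `p.2 = k * p.1` of the sector are the same spiral.
  have hqq : q₂ = q := by
    obtain ⟨θ, e1, e2⟩ := ((hCk.eventually hq₂).and (hCs.eventually hq)).exists
    rw [← e1.2, ← e2.2]
  subst hqq
  filter_upwards [hCnb.eventually hq₂] with θ hθ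
  simpa [hG] using hθ

end LinkDiagram
end

/-! ### Ends on the boundary circle: the tangential case -/

noncomputable section

namespace LinkDiagram

variable {D : LinkDiagram} {col : D.Region → ZMod 2}

/-- A curve ending on the unit circle tangentially to the side `-η`: the colour on the side
`η` near the end is the colour of the points of the circle on that side. -/
theorem exists_end_colour_of_tangent {c : ℝ → ℂ} {η : ℝ} {y : ℂ} (hc : ContDiff ℝ 1 c)
    (h0 : ‖c 0‖ = 1) (hin : ∀ᶠ τ in 𝓝[<] (0 : ℝ), ‖c τ‖ < 1) (hu : deriv c 0 = c 0 * y)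
    (hη : η * η = 1) (hneg : η * y.im < 0)
    (hloc : ∀ N ∈ 𝓝 (0 : ℝ), ∀ᶠ z in 𝓝 (c 0), z ∈ D.trace → ∃ τ ∈ N, τ ≤ 0 ∧ c τ = z)
    (hbd : ∀ᶠ z in 𝓝 (c 0), z ≠ c 0 → ‖z‖ = 1 → -z ∉ D.trace)
    (hcirc : ∀ᶠ θ in 𝓝[>] (0 : ℝ), c 0 * Complex.exp ((η * θ : ℝ) * Complex.I) ∈ D.free) :
    ∃ q, (∀ᶠ τ in 𝓝[<] (0 : ℝ), ∀ x', SideColour col c τ η x' → x' = q) ∧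
      ∀ᶠ θ in 𝓝[>] (0 : ℝ), c 0 * Complex.exp ((η * θ : ℝ) * Complex.I) ∈ D.free ∧
        colourAt col (c 0 * Complex.exp ((η * θ : ℝ) * Complex.I)) = q := by
  have hcc := hc.continuous
  have hst : HasStrictDerivAt c (deriv c 0) 0 := hc.contDiffAt.hasStrictDerivAt one_ne_zero
  set z₀ := c 0 with hz₀
  have hz₀0 : z₀ ≠ 0 := by intro h; simp [h] at h0
  have him : y.im ≠ 0 := by rintro h; simp [h] at hneg
  have harea : planeArea (deriv c 0) z₀ = -y.im := by
    have := planeArea_mul_self z₀ y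
    rw [planeArea_swap, hu, this, h0]; ring
  have hw : planeArea (deriv c 0) z₀ ≠ 0 := by rw [harea]; exact neg_ne_zero.2 him
  obtain ⟨U, hU, V, hV, hUV⟩ := mem_nhds_prod_iff.1 (hst.eventually_ne_add hw)
  obtain ⟨N, hN, N', hN', hNN⟩ := mem_nhds_prod_iff.1 hU
  obtain ⟨r, hr, hball⟩ := Metric.mem_nhds_iff.1 (Filter.inter_mem (hloc N hN) hbd)
  have hP : ∀ᶠ τ in 𝓝[<] (0 : ℝ), ‖c τ‖ < 1 ∧ τ ∈ N' ∧ c τ ∈ V ∧ c τ ≠ 0 ∧ ‖c τ - z₀‖ < r / 2 := by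
    refine hin.and (nhdsWithin_le_nhds ?_)
    refine Filter.Eventually.and hN' (((hcc.tendsto 0).eventually hV).and
      ((hcc.continuousAt.eventually_ne hz₀0).and ?_))
    have : Continuous fun τ => ‖c τ - z₀‖ := by fun_prop
    exact this.continuousAt.eventually_lt_const (by
      change ‖c 0 - z₀‖ < r / 2
      rw [← hz₀, sub_self, norm_zero]; linarith)
  obtain ⟨δ, hδ, hsub⟩ := (mem_nhdsLT_iff_exists_Ioo_subset' (show (-1 : ℝ) < 0 by norm_num)).1 hP
  -- The radial segment from the curve, at `l = 0`, to the circle, at `l = 1`. The outward radial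
  -- direction is transverse to the curve and points to the side `η`, so these segments fill a
  -- region free of arcs.
  set F : ℝ → ℝ → ℂ := fun τ l => c τ * (1 + (l * (1 / ‖c τ‖ - 1) : ℝ)) with hF
  have hprops : ∀ τ ∈ Set.Ioo δ 0, ∀ l ∈ Set.Ioc (0 : ℝ) 1, F τ l ∈ D.free := by
    intro τ hτ l hl
    obtain ⟨p1, p2, p3, p4, p5⟩ := hsub hτ
    have hpos : 0 < ‖c τ‖ := norm_pos_iff.2 p4
    have hinv : 0 < 1 / ‖c τ‖ - 1 := by
      have := (one_lt_div hpos).2 p1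
      linarith
    have hε : 0 < l * (1 / ‖c τ‖ - 1) := mul_pos hl.1 hinv
    have hnorm : ‖F τ l‖ = ‖c τ‖ + l * (1 - ‖c τ‖) := by
      simp only [hF]
      rw [norm_mul, ← Complex.ofReal_one, ← Complex.ofReal_add, Complex.norm_real,
        Real.norm_of_nonneg (by linarith)]
      field_simp
    have hdist : F τ l ∈ Metric.ball z₀ r := by
      rw [mem_ball_iff_norm]
      have e : F τ l - z₀ = (c τ - z₀) + c τ * (l * (1 / ‖c τ‖ - 1) : ℝ) := by
        simp only [hF]; ring
      have e1 : ‖c τ * (l * (1 / ‖c τ‖ - 1) : ℝ)‖ = l * (1 - ‖c τ‖) := by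
        rw [norm_mul, Complex.norm_real, Real.norm_of_nonneg hε.le]
        field_simp
      have e2 : 1 - ‖c τ‖ ≤ ‖c τ - z₀‖ := by
        have := norm_sub_norm_le z₀ (c τ)
        rwa [h0, norm_sub_rev] at this
      rw [e]
      refine (norm_add_le _ _).trans_lt ?_
      rw [e1]
      nlinarith [hl.1, hl.2]
    have hne : ∀ τ' ∈ N, c τ' ≠ F τ l := by
      intro τ' hτ' e
      refine hUV (Set.mk_mem_prod (hNN (Set.mk_mem_prod hτ' p2)) p3) _ hε.ne' ?_
      simp only
      rw [e]
      simp only [hF]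
      ring
    refine mem_free (by rw [hnorm]; nlinarith [hl.1, hl.2]) (fun htr => ?_) fun h1 =>
      (hball hdist).2 (fun e => hne 0 (mem_of_mem_nhds hN) e.symm) h1
    obtain ⟨τ', hτ', -, e⟩ := (hball hdist).1 htr
    exact hne τ' hτ' e
  set S : Set ℂ := (fun p : ℝ × ℝ => F p.1 p.2) '' (Set.Ioo δ 0 ×ˢ Set.Ioc 0 1) with hS
  have hSp : IsPreconnected S := by
    refine (((convex_Ioo δ (0 : ℝ)).prod (convex_Ioc (0 : ℝ) 1)).isPreconnected).image _ ?_
    refine ContinuousOn.mul (by fun_prop) (ContinuousOn.add continuousOn_const ?_)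
    refine Complex.continuous_ofReal.comp_continuousOn (ContinuousOn.mul (by fun_prop) ?_)
    refine ContinuousOn.sub (ContinuousOn.div continuousOn_const (by fun_prop) ?_) continuousOn_const
    rintro p ⟨hp, -⟩
    exact norm_ne_zero_iff.2 (hsub hp).2.2.2.1
  have hSf : S ⊆ D.free := by
    rintro _ ⟨p, ⟨hp1, hp2⟩, rfl⟩
    exact hprops _ hp1 _ hp2
  have hδ0 : δ < 0 := hδ
  have hIoo : Set.Ioo δ 0 ∈ 𝓝[<] (0 : ℝ) := Ioo_mem_nhdsLT hδ0
  have hmem : ∀ τ ∈ Set.Ioo δ 0, ∀ l ∈ Set.Ioc (0 : ℝ) 1, F τ l ∈ S := fun τ hτ l hl =>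
    ⟨(τ, l), ⟨hτ, hl⟩, rfl⟩
  have hτ₀ : δ / 2 ∈ Set.Ioo δ 0 := ⟨by linarith, by linarith⟩
  have h1m : (1 : ℝ) ∈ Set.Ioc (0 : ℝ) 1 := ⟨one_pos, le_rfl⟩
  set q := colourAt col (F (δ / 2) 1) with hq
  have hqS : ∀ τ ∈ Set.Ioo δ 0, ∀ l ∈ Set.Ioc (0 : ℝ) 1, colourAt col (F τ l) = q :=
    fun τ hτ l hl => colourAt_eq_of_isPreconnected col hSp hSf (hmem τ hτ l hl)
      (hmem _ hτ₀ 1 h1m)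
  refine ⟨q, ?_, ?_⟩
  · refine SideColour.eventually_eq (A := Set.Iio 0) F
      (fun τ => ((1 / ‖c τ‖ - 1 : ℝ) : ℂ) * c τ) ?_ ?_
    · rw [nhdsWithin_prod_eq]
      have h1 : Set.Ioc (0 : ℝ) 1 ∈ 𝓝[>] (0 : ℝ) := Ioc_mem_nhdsGT one_pos
      filter_upwards [Filter.prod_mem_prod hIoo h1] with p hp
      exact hqS _ hp.1 _ hp.2
    · have hcont : Continuous fun τ => η * planeArea (deriv c τ) (c τ) := by
        have := hc.continuous_deriv le_rfl
        unfold planeArea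
        fun_prop
      have h1 : 0 < η * planeArea (deriv c 0) (c 0) := by
        rw [← hz₀, harea]; linarith
      filter_upwards [nhdsWithin_le_nhds (hcont.continuousAt.eventually_const_lt h1), hP]
        with τ hτ hτP
      refine ⟨?_, by simp [hF], ?_⟩
      · have h2 : HasDerivAt (fun l : ℝ => l * (1 / ‖c τ‖ - 1)) (1 / ‖c τ‖ - 1) 0 := by
          simpa using (hasDerivAt_id (0 : ℝ)).mul_const (1 / ‖c τ‖ - 1)
        have h3 := (h2.ofReal_comp.const_add 1).const_mul (c τ)
        rw [mul_comm (c τ)] at h3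
        exact h3.hasDerivWithinAt
      · rw [planeArea_real_mul]
        have := (one_lt_div (norm_pos_iff.2 hτP.2.2.2.1)).2 hτP.1
        have := mul_pos (show 0 < 1 / ‖c τ‖ - 1 by linarith) hτ
        linarith
  · obtain ⟨q₃, hq₃⟩ := exists_eventually_colour (D := D) col (convex_Ioi (0 : ℝ)) 0
      (fun θ : ℝ => z₀ * Complex.exp ((η * θ : ℝ) * Complex.I)) (by fun_prop) hcirc
    suffices h : q₃ = q by rw [← h]; exact hq₃
    -- The argument of `w τ` is the angle of `c τ` seen from `z₀`. It tends to 0 from the side `η`,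
    -- so the radial projections of the curve are points of the circle on that side.
    set w : ℝ → ℂ := fun τ => conj z₀ * c τ with hw'
    have hw0 : w 0 = 1 := by
      simp only [hw', ← hz₀]
      rw [mul_comm, Complex.mul_conj, Complex.normSq_eq_norm_sq, h0]; simp
    have hwc : Continuous w := by fun_prop
    have harg : Filter.Tendsto (fun τ => η * (w τ).arg) (𝓝[<] 0) (𝓝[>] 0) := by
      refine tendsto_nhdsWithin_iff.2 ⟨?_, ?_⟩
      · have h1 : ContinuousAt Complex.arg (w 0) := Complex.continuousAt_arg (by
          rw [hw0]; exact Complex.one_mem_slitPlane)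
        have h2 : Filter.Tendsto (fun τ => η * (w τ).arg) (𝓝 0) (𝓝 (η * (w 0).arg)) :=
          (h1.tendsto.comp (hwc.tendsto 0)).const_mul η
        rw [hw0, Complex.arg_one, mul_zero] at h2
        exact h2.mono_left nhdsWithin_le_nhds
      · have d1 := nhdsWithin_le_nhds (s := Set.Iio 0)
          (hst.eventually_norm_sub_le_zero (δ := -(η * y.im) / 2) (by linarith))
        have d2 : ∀ᶠ τ in 𝓝[<] (0 : ℝ), 0 < η * (w τ).im := by
          filter_upwards [d1, self_mem_nhdsWithin] with τ hτ (hτ0 : τ < 0)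
          have e : (w τ).im = planeArea z₀ (c τ) := by
            simp [hw', planeArea]; ring
          have e2 : c τ = z₀ * (1 + τ * y) + (c τ - c 0 - τ * deriv c 0) := by
            rw [hu, ← hz₀]; ring
          rw [e, e2, planeArea_add, planeArea_mul_self, h0]
          have k1 := abs_planeArea_le z₀ (c τ - c 0 - τ * deriv c 0)
          rw [h0, one_mul] at k1
          have habs : |η| = 1 := by
            have : |η| * |η| = 1 := by rw [← abs_mul, hη, abs_one]
            nlinarith [abs_nonneg η]
          have k2 : |η * planeArea z₀ (c τ - c 0 - τ * deriv c 0)| ≤ -(η * y.im) / 2 * |τ| := by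
            rw [abs_mul, habs, one_mul]
            exact k1.trans hτ
          have k3 := (abs_le.1 k2).1
          rw [abs_of_neg hτ0] at k3
          simp
          nlinarith [mul_pos_of_neg_of_neg hneg hτ0]
        filter_upwards [d2] with τ hτ
        have hηc : η = 1 ∨ η = -1 := by
          have : (η - 1) * (η + 1) = 0 := by linear_combination hη
          rcases mul_eq_zero.1 this with h | h
          · left; linarith
          · right; linarith
        change 0 < η * (w τ).arg
        rcases hηc with h | h
        · rw [h, one_mul] at hτ ⊢
          refine lt_of_le_of_ne (Complex.arg_nonneg_iff.2 hτ.le) fun e => ?_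
          have := (Complex.arg_eq_zero_iff.1 e.symm).2
          linarith
        · rw [h] at hτ ⊢
          have : (w τ).arg < 0 := Complex.arg_neg_iff.2 (by linarith)
          linarith
    obtain ⟨τ, h1, hτP, h2⟩ := ((harg.eventually hq₃).and (hP.and hIoo)).exists
    rw [← h1.2, ← hqS τ h2 1 h1m]
    congr 1
    have hpos : (‖c τ‖ : ℂ) ≠ 0 := by exact_mod_cast norm_ne_zero_iff.2 hτP.2.2.2.1
    have e : η * (η * (w τ).arg) = (w τ).arg := by rw [← mul_assoc, hη, one_mul]
    rw [e]
    have hwn : ‖w τ‖ = ‖c τ‖ := by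
      simp only [hw']; rw [norm_mul, Complex.norm_conj, h0, one_mul]
    have e3 := Complex.norm_mul_exp_arg_mul_I (w τ)
    rw [hwn] at e3
    have e4 : z₀ * w τ = c τ := by
      simp only [hw']
      rw [← mul_assoc, Complex.mul_conj, Complex.normSq_eq_norm_sq, h0]; simp
    have e5 : (‖c τ‖ : ℂ) * (z₀ * Complex.exp (((w τ).arg : ℝ) * Complex.I)) = c τ := by
      rw [mul_left_comm, e3, e4]
    have e6 : F τ 1 * ‖c τ‖ = c τ := by
      simp only [hF]
      push_cast
      field_simp
      ring
    refine mul_left_cancel₀ hpos ?_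
    rw [e5, mul_comm, e6]

/-- An arc may be tangent to the boundary circle. Writing the velocity as `c 0 * y` with `0 ≤ y.re`,
a suitable `B` exists unless `y.re = 0` and `η * y.im < 0`, when the curve runs along the circle,
coming from the side `η`. -/
theorem exists_end_colour {c : ℝ → ℂ} {η : ℝ} (hc : ContDiff ℝ 1 c)
    (h0 : ‖c 0‖ = 1) (hin : ∀ᶠ τ in 𝓝[<] (0 : ℝ), ‖c τ‖ < 1) (hu : deriv c 0 ≠ 0)
    (hη : η * η = 1)
    (hloc : ∀ N ∈ 𝓝 (0 : ℝ), ∀ᶠ z in 𝓝 (c 0), z ∈ D.trace → ∃ τ ∈ N, τ ≤ 0 ∧ c τ = z)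
    (hbd : ∀ᶠ z in 𝓝 (c 0), z ≠ c 0 → ‖z‖ = 1 → z ∉ D.trace ∧ -z ∉ D.trace) :
    ∃ q, (∀ᶠ τ in 𝓝[<] (0 : ℝ), ∀ x', SideColour col c τ η x' → x' = q) ∧
      ∀ᶠ θ in 𝓝[>] (0 : ℝ), c 0 * Complex.exp ((η * θ : ℝ) * Complex.I) ∈ D.free ∧
        colourAt col (c 0 * Complex.exp ((η * θ : ℝ) * Complex.I)) = q := by
  have hst : HasStrictDerivAt c (deriv c 0) 0 := hc.contDiffAt.hasStrictDerivAt one_ne_zero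
  set y : ℂ := conj (c 0) * deriv c 0 with hy
  have hu' : deriv c 0 = c 0 * y := by
    rw [hy, ← mul_assoc, Complex.mul_conj, Complex.normSq_eq_norm_sq, h0]; simp
  have hρ : 0 ≤ y.re := by
    have := planeDot_deriv_nonneg hst h0 hin
    rw [hu', planeDot_mul_self, h0] at this
    simpa using this
  have hbd' : ∀ᶠ z in 𝓝 (c 0), z ≠ c 0 → ‖z‖ = 1 → -z ∉ D.trace :=
    hbd.mono fun z h h1 h2 => (h h1 h2).2
  have hη0 : η ≠ 0 := by rintro rfl; simp at hη
  by_cases hB : ∃ B : ℝ, 0 < B ∧ 0 < y.re + B * (η * y.im)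
  · obtain ⟨B, hB, hpos⟩ := hB
    exact exists_end_colour_of_pos hc h0 hin hu' hη hB hρ hpos hloc hbd'
  · push Not at hB
    have hneg : η * y.im < 0 := by
      have h1 := hB 1 one_pos
      refine lt_of_le_of_ne (by linarith) fun h2 => ?_
      have h3 : y.im = 0 := (mul_eq_zero.1 h2).resolve_left hη0
      have h4 : y.re = 0 := by rw [h2] at h1; linarith
      refine hu ?_
      rw [hu', show y = 0 from Complex.ext h4 h3, mul_zero]
    refine exists_end_colour_of_tangent hc h0 hin hu' hη hneg hloc hbd' ?_
    have hcont : Continuous fun θ : ℝ => c 0 * Complex.exp ((η * θ : ℝ) * Complex.I) := by fun_prop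
    have h1 : Filter.Tendsto (fun θ : ℝ => c 0 * Complex.exp ((η * θ : ℝ) * Complex.I)) (𝓝[>] 0)
        (𝓝 (c 0)) := by
      have := hcont.tendsto 0
      simp only [mul_zero, Complex.ofReal_zero, zero_mul, Complex.exp_zero, mul_one] at this
      exact this.mono_left nhdsWithin_le_nhds
    have hc0 : c 0 ≠ 0 := by intro h; simp [h] at h0
    filter_upwards [h1.eventually hbd, Ioo_mem_nhdsGT (show (0 : ℝ) < 1 by norm_num)] with θ h2 h3
    have hn : ‖c 0 * Complex.exp ((η * θ : ℝ) * Complex.I)‖ = 1 := by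
      rw [norm_mul, Complex.norm_exp_ofReal_mul_I, h0, mul_one]
    have h4 := h2 (fun e => ?_) hn
    · exact mem_free hn.le h4.1 fun _ => h4.2
    · have e1 : Complex.exp ((η * θ : ℝ) * Complex.I) = 1 := mul_left_cancel₀ hc0 (by rw [e, mul_one])
      have e2 := congrArg Complex.im e1
      rw [Complex.exp_ofReal_mul_I_im, Complex.one_im] at e2
      have h5 : |η * θ| = θ := by
        have : |η| * |η| = 1 := by rw [← abs_mul, hη, abs_one]
        have : |η| = 1 := by nlinarith [abs_nonneg η]
        rw [abs_mul, this, one_mul, abs_of_pos h3.1]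
      have h6 := abs_le.1 h5.le
      have h7 := (Real.sin_eq_zero_iff_of_lt_of_lt
        (by linarith [Real.pi_gt_three, h3.2, h6.1]) (by linarith [Real.pi_gt_three, h3.2, h6.2])).1 e2
      rw [h7, abs_zero] at h5
      exact h3.1.ne h5

end LinkDiagram
end

noncomputable section

/-! ### Counting the jumps of a function of one real variable -/

theorem Set.Finite.exists_isolating {F : Set ℝ} (hF : F.Finite) (t₀ : ℝ) :
    ∃ ε > 0, ∀ s ∈ F, |s - t₀| < ε → s = t₀ := by
  have h := (hF.subset (Set.sdiff_subset (t := {t₀}))).isClosed.isOpen_compl.mem_nhds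
    (show t₀ ∈ _ by simp)
  obtain ⟨ε, hε, hsub⟩ := Metric.mem_nhds_iff.1 h
  refine ⟨ε, hε, fun s hs hlt => ?_⟩
  by_contra hne
  exact hsub (by rwa [Metric.mem_ball, Real.dist_eq]) ⟨hs, hne⟩

theorem Set.Finite.eventually_inter_Iio_left {F : Set ℝ} (hF : F.Finite) (t₀ : ℝ) :
    ∀ᶠ t in 𝓝[<] t₀, F ∩ Set.Iio t = F ∩ Set.Iio t₀ := by
  obtain ⟨ε, hε, h⟩ := hF.exists_isolating t₀
  filter_upwards [Ioo_mem_nhdsLT (show t₀ - ε < t₀ by linarith)] with t ht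
  ext s
  refine ⟨fun hs => ⟨hs.1, lt_trans hs.2 ht.2⟩, fun hs => ⟨hs.1, ?_⟩⟩
  by_contra hlt
  have h1 : t ≤ s := not_lt.1 hlt
  have h2 : s < t₀ := hs.2
  have := h s hs.1 (by rw [abs_lt]; constructor <;> linarith [ht.1])
  exact h2.ne this

theorem Set.Finite.eventually_inter_Iio_right {F : Set ℝ} (hF : F.Finite) (t₀ : ℝ) :
    ∀ᶠ t in 𝓝[>] t₀, F ∩ Set.Iio t = F ∩ Set.Iic t₀ := by
  obtain ⟨ε, hε, h⟩ := hF.exists_isolating t₀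
  filter_upwards [Ioo_mem_nhdsGT (show t₀ < t₀ + ε by linarith)] with t ht
  ext s
  refine ⟨fun hs => ⟨hs.1, ?_⟩, fun hs => ⟨hs.1, lt_of_le_of_lt hs.2 ht.1⟩⟩
  by_contra hlt
  have h1 : t₀ < s := not_le.1 hlt
  have h2 : s < t := hs.2
  have := h s hs.1 (by rw [abs_lt]; constructor <;> linarith [ht.2])
  exact h1.ne' this

/-- A function that is constant on either side of each point of an interval, the two constants
being different exactly at the points of a finite set `F`. -/
theorem eq_add_ncard_of_jumps {f : ℝ → ZMod 2} {F : Set ℝ} {α β : ℝ} (hαβ : α < β)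
    (hF : F.Finite) (hFI : F ⊆ Set.Ioo α β)
    (hstep : ∀ t ∈ Set.Ioo α β, ∃ q, (∀ᶠ t' in 𝓝[<] t, f t' = q) ∧
      ((t ∈ F → ∀ᶠ t' in 𝓝[>] t, f t' = q + 1) ∧ (t ∉ F → ∀ᶠ t' in 𝓝[>] t, f t' = q)))
    {x y : ZMod 2} (hx : ∀ᶠ t in 𝓝[>] α, f t = x) (hy : ∀ᶠ t in 𝓝[<] β, f t = y) :
    y = x + (F.ncard : ℕ) := by
  -- Adding the number of earlier jumps cancels every jump. The values of `f` at single points are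
  -- uncontrolled, so constancy is proved for the punctured limits `g` of `G`.
  set G : ℝ → ZMod 2 := fun t => f t + ((F ∩ Set.Iio t).ncard : ℕ) with hG
  have h1 : ∀ t, ∃ q, t ∈ Set.Ioo α β → ∀ᶠ t' in 𝓝[≠] t, G t' = q := by
    intro t
    by_cases ht : t ∈ Set.Ioo α β
    swap
    · exact ⟨0, fun h => absurd h ht⟩
    obtain ⟨q, hq, hq1, hq2⟩ := hstep t ht
    refine ⟨q + ((F ∩ Set.Iio t).ncard : ℕ), fun _ => ?_⟩
    rw [← Set.Iio_union_Ioi, nhdsWithin_union, Filter.eventually_sup]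
    constructor
    · filter_upwards [hq, hF.eventually_inter_Iio_left t] with t' e1 e2
      simp only [hG]
      rw [e1, e2]
    · by_cases htF : t ∈ F
      · filter_upwards [hq1 htF, hF.eventually_inter_Iio_right t] with t' e1 e2
        have e3 : F ∩ Set.Iic t = insert t (F ∩ Set.Iio t) := by
          ext s
          constructor
          · rintro ⟨hs, hs'⟩
            rcases eq_or_lt_of_le (show s ≤ t from hs') with h | h
            · exact Or.inl h
            · exact Or.inr ⟨hs, h⟩
          · rintro (rfl | ⟨hs, hs'⟩)
            · exact ⟨htF, le_refl s⟩
            · exact ⟨hs, (show s < t from hs').le⟩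
        simp only [hG]
        rw [e1, e2, e3, Set.ncard_insert_of_notMem (by simp) (hF.subset Set.inter_subset_left)]
        push_cast
        have : ∀ a b : ZMod 2, a + 1 + (b + 1) = a + b := by decide
        exact this _ _
      · filter_upwards [hq2 htF, hF.eventually_inter_Iio_right t] with t' e1 e2
        have e3 : F ∩ Set.Iic t = F ∩ Set.Iio t := by
          ext s
          refine ⟨fun hs => ⟨hs.1, lt_of_le_of_ne (show s ≤ t from hs.2) ?_⟩,
            fun hs => ⟨hs.1, (show s < t from hs.2).le⟩⟩
          rintro rfl
          exact htF hs.1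
        simp only [hG]
        rw [e1, e2, e3]
  choose g hg using h1
  have hg' : ∀ t ∈ Set.Ioo α β, ∀ (q : ZMod 2) (l : Filter ℝ), l.NeBot → l ≤ 𝓝[≠] t →
      (∀ᶠ t' in l, G t' = q) → g t = q := by
    intro t ht q l hl hle h
    have h0 : ∀ᶠ t' in l, G t' = g t := hle (hg t ht)
    obtain ⟨t', e1, e2⟩ := (h0.and h).exists
    rw [← e2]
    exact e1.symm
  have hloc : ∀ t ∈ Set.Ioo α β, ∀ᶠ u in 𝓝[Set.Ioo α β] t, g t = g u := by
    intro t ht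
    obtain ⟨O, hO, hOt, hOs⟩ := eventually_nhds_iff.1 (eventually_nhdsWithin_iff.1 (hg t ht))
    filter_upwards [self_mem_nhdsWithin, nhdsWithin_le_nhds (hOt.mem_nhds hOs)] with u hu huO
    by_cases hut : u = t
    · rw [hut]
    refine (hg' u hu _ _ inferInstance le_rfl ?_).symm
    filter_upwards [nhdsWithin_le_nhds (hOt.mem_nhds huO),
      nhdsWithin_le_nhds (isOpen_compl_singleton.mem_nhds hut)] with v hv hvt
    exact hO v hv hvt
  have hconst : ∀ t ∈ Set.Ioo α β, ∀ u ∈ Set.Ioo α β, g t = g u := fun t ht u hu =>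
    isPreconnected_Ioo.induction₂ (fun t u => g t = g u) hloc (fun _ _ _ _ _ _ => Eq.trans)
      (fun _ _ _ _ => Eq.symm) ht hu
  have hGx : ∀ᶠ t in 𝓝[>] α, G t = x := by
    filter_upwards [hx, hF.eventually_inter_Iio_right α] with t e1 e2
    have e3 : F ∩ Set.Iic α = ∅ := by
      ext s
      simp only [Set.mem_inter_iff, Set.mem_Iic, Set.mem_empty_iff_false, iff_false, not_and, not_le]
      exact fun hs => (hFI hs).1
    simp only [hG]
    rw [e1, e2, e3]
    simp
  have hGy : ∀ᶠ t in 𝓝[<] β, G t = y + (F.ncard : ℕ) := by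
    filter_upwards [hy, hF.eventually_inter_Iio_left β] with t e1 e2
    have e3 : F ∩ Set.Iio β = F := Set.inter_eq_left.2 fun s hs => (hFI hs).2
    simp only [hG]
    rw [e1, e2, e3]
  obtain ⟨ta, hta, hta'⟩ := ((eventually_eventually_nhdsWithin.2 hGx).and
    (Ioo_mem_nhdsGT hαβ)).exists
  obtain ⟨tb, htb, htb'⟩ := ((eventually_eventually_nhdsWithin.2 hGy).and
    (Ioo_mem_nhdsLT hαβ)).exists
  rw [nhdsWithin_eq_nhds.2 (Ioi_mem_nhds hta'.1)] at hta
  rw [nhdsWithin_eq_nhds.2 (Iio_mem_nhds htb'.2)] at htb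
  have ea := hg' ta hta' _ (𝓝[≠] ta) inferInstance le_rfl (nhdsWithin_le_nhds hta)
  have eb := hg' tb htb' _ (𝓝[≠] tb) inferInstance le_rfl (nhdsWithin_le_nhds htb)
  have e := hconst ta hta' tb htb'
  rw [ea, eb] at e
  have : ∀ x y n : ZMod 2, x = y + n → y = x + n := by decide
  exact this _ _ _ e

namespace LinkDiagram

variable {D : LinkDiagram} {col : D.Region → ZMod 2}

/-! ### The ends of the arcs -/

/-- Reversing the parametrisation exchanges left and right, hence the factor `σ` in the side. -/
theorem SideColour.comp_affine {c : ℝ → ℂ} {s₀ σ τ η : ℝ} {x : ZMod 2} (hc : ContDiff ℝ 1 c)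
    (h : SideColour col c (s₀ + σ * τ) (η * σ) x) :
    SideColour col (fun τ => c (s₀ + σ * τ)) τ η x := by
  have hd : deriv (fun τ => c (s₀ + σ * τ)) τ = σ * deriv c (s₀ + σ * τ) := by
    have h1 := ((hc.differentiable one_ne_zero) (s₀ + σ * τ)).hasDerivAt
    have h2 : HasDerivAt (fun τ : ℝ => s₀ + σ * τ) σ τ := by
      simpa using ((hasDerivAt_id τ).const_mul σ).const_add s₀
    have h3 := (h1.scomp τ h2).deriv
    rw [Complex.real_smul] at h3
    exact h3
  intro w hw
  rw [hd, planeArea_swap, planeArea_real_mul, ← mul_neg, ← planeArea_swap, ← mul_assoc] at hw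
  have hT : Filter.Tendsto (fun p : ℝ × ℝ × ℂ => (s₀ + σ * p.1, p.2.1, p.2.2))
      (𝓝[sideSet] (τ, 0, w)) (𝓝[sideSet] (s₀ + σ * τ, 0, w)) := by
    refine tendsto_nhdsWithin_iff.2 ⟨?_, self_mem_nhdsWithin⟩
    have : Continuous fun p : ℝ × ℝ × ℂ => (s₀ + σ * p.1, p.2.1, p.2.2) := by fun_prop
    exact (this.tendsto (τ, 0, w)).mono_left nhdsWithin_le_nhds
  exact hT.eventually (h w hw)

theorem finite_trace_inter_circle : {z | z ∈ D.trace ∧ ‖z‖ = 1}.Finite := by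
  refine ((Set.finite_range fun b => D.γ b 0).union (Set.finite_range fun b => D.γ b 1)).subset ?_
  rintro z ⟨⟨b, s, h0, h1, rfl⟩, hz⟩
  by_cases hs : s = 0 ∨ s = 1
  · rcases hs with rfl | rfl
    · exact Or.inl ⟨b, rfl⟩
    · exact Or.inr ⟨b, rfl⟩
  · push Not at hs
    exact absurd hz (norm_lt_of_isInner (Or.inr ⟨lt_of_le_of_ne h0 hs.1.symm,
      lt_of_le_of_ne h1 hs.2⟩)).ne

theorem eventually_circle_notMem_trace (z₀ : ℂ) :
    ∀ᶠ z in 𝓝 z₀, z ≠ z₀ → ‖z‖ = 1 → z ∉ D.trace ∧ -z ∉ D.trace := by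
  have hfin : ({z | z ∈ D.trace ∧ ‖z‖ = 1} ∪ Neg.neg '' {z | z ∈ D.trace ∧ ‖z‖ = 1}).Finite :=
    finite_trace_inter_circle.union (finite_trace_inter_circle.image _)
  filter_upwards [(hfin.subset (Set.sdiff_subset (t := {z₀}))).isClosed.isOpen_compl.mem_nhds
    (show z₀ ∈ _ by simp)] with z hz hne hn
  refine ⟨fun h => hz ⟨Or.inl ⟨h, hn⟩, hne⟩, fun h => hz ⟨Or.inr ⟨-z, ⟨h, ?_⟩, neg_neg z⟩, hne⟩⟩
  rw [norm_neg, hn]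

/-- The colour beside an arc near one of its ends is the colour of the points of the boundary
circle counterclockwise of the end. -/
theorem exists_end_colour_arc {a : D.Arc} (ha : ¬ D.IsClosedArc a) {s₀ σ : ℝ}
    (hσ : s₀ = 1 ∧ σ = 1 ∨ s₀ = 0 ∧ σ = -1) :
    ∃ q, (∀ᶠ τ in 𝓝[<] (0 : ℝ), ∀ x', SideColour col (D.γ a) (s₀ + σ * τ) σ x' → x' = q) ∧
      ∀ᶠ θ : ℝ in 𝓝[>] (0 : ℝ), D.γ a s₀ * Complex.exp (θ * Complex.I) ∈ D.free ∧
        colourAt col (D.γ a s₀ * Complex.exp (θ * Complex.I)) = q := by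
  classical
  have hσσ : σ * σ = 1 := by rcases hσ with ⟨-, rfl⟩ | ⟨-, rfl⟩ <;> norm_num
  have hs₀ : 0 ≤ s₀ ∧ s₀ ≤ 1 := by rcases hσ with ⟨rfl, -⟩ | ⟨rfl, -⟩ <;> norm_num
  have hn : ‖D.γ a s₀‖ = 1 := by
    rcases hσ with ⟨rfl, -⟩ | ⟨rfl, -⟩
    · exact D.open_end a ha
    · exact D.open_start a ha
  -- Either end becomes a final point reached at `τ = 0`; the left of `c` is the side `σ` of the
  -- arc.
  set c : ℝ → ℂ := fun τ => D.γ a (s₀ + σ * τ) with hc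
  have hc0 : c 0 = D.γ a s₀ := by simp [hc]
  have hcd : ContDiff ℝ 1 c := by
    have h1 : ContDiff ℝ 1 fun τ : ℝ => s₀ + σ * τ := by fun_prop
    exact (D.contDiff a).comp h1
  have hin : ∀ᶠ τ in 𝓝[<] (0 : ℝ), ‖c τ‖ < 1 := by
    filter_upwards [Ioo_mem_nhdsLT (show (-1 : ℝ) < 0 by norm_num)] with τ hτ
    refine D.open_interior a ha _ ?_
    rcases hσ with ⟨rfl, rfl⟩ | ⟨rfl, rfl⟩
    · constructor <;> linarith [hτ.1, hτ.2]
    · constructor <;> linarith [hτ.1, hτ.2]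
  have hu : deriv c 0 ≠ 0 := by
    have h1 := ((D.contDiff a).differentiable one_ne_zero (s₀ + σ * 0)).hasDerivAt
    have h2 : HasDerivAt (fun τ : ℝ => s₀ + σ * τ) σ 0 := by
      simpa using ((hasDerivAt_id (0 : ℝ)).const_mul σ).const_add s₀
    have h3 : deriv c 0 = σ • deriv (D.γ a) (s₀ + σ * 0) := (h1.scomp 0 h2).deriv
    rw [h3, mul_zero, add_zero]
    refine smul_ne_zero (by rintro rfl; simp at hσσ) (D.immersed a s₀ hs₀)
  have hloc : ∀ N ∈ 𝓝 (0 : ℝ), ∀ᶠ z in 𝓝 (c 0), z ∈ D.trace → ∃ τ ∈ N, τ ≤ 0 ∧ c τ = z := by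
    intro N hN
    have key := eventually_mem_of_trace (D := D) (c 0)
      (fun b => if b = a then (fun s => σ * (s - s₀)) ⁻¹' interior N else ∅) ?_ ?_
    · filter_upwards [key] with z hz
      rintro ⟨b, s, h0, h1, hs⟩
      have hb := hz b s h0 h1 hs
      by_cases hba : b = a
      · subst hba
        rw [if_pos rfl] at hb
        refine ⟨σ * (s - s₀), interior_subset hb, ?_, ?_⟩
        · rcases hσ with ⟨rfl, rfl⟩ | ⟨rfl, rfl⟩ <;> linarith
        · simp only [hc]
          rw [← mul_assoc, hσσ, one_mul, add_sub_cancel, hs]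
      · rw [if_neg hba] at hb
        exact hb.elim
    · intro b
      by_cases hba : b = a
      · simp only [if_pos hba]
        exact isOpen_interior.preimage (by fun_prop)
      · simp only [if_neg hba, isOpen_empty]
    · intro b s h0 h1 hs
      -- Nothing else passes through the end point, as double points lie inside the open disc.
      have hbs : (a, s₀) = (b, s) := by
        by_contra hne
        have hm : D.Meet (a, s₀) (b, s) := by
          refine ⟨⟨hs₀.1, hs₀.2, fun h => absurd h ha⟩, ⟨h0, h1, fun h => ?_⟩, hne, ?_⟩
          · have := D.closed_interior b h s
            rw [hs, hc0, hn] at this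
            exact absurd this (lt_irrefl _)
          · exact (hs.trans hc0).symm
        exact (D.meet_interior _ _ hm).ne hn
      obtain ⟨rfl, rfl⟩ := Prod.mk.inj hbs
      simpa using mem_interior_iff_mem_nhds.2 hN
  obtain ⟨q, h1, h2⟩ := exists_end_colour (col := col) (c := c) (η := 1) hcd (by rw [hc0, hn])
    hin hu (by norm_num) hloc (eventually_circle_notMem_trace _)
  refine ⟨q, ?_, ?_⟩
  · filter_upwards [h1] with τ hτ x' hx'
    exact hτ x' (SideColour.comp_affine (D.contDiff a) (by rwa [one_mul]))
  · simpa only [hc0, one_mul] using h2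

theorem not_isClosedArc_next {a : D.Arc} (ha : ¬ D.IsClosedArc a) : ¬ D.IsClosedArc (D.next a) :=
  fun h => ha (by have := D.next.injective (D.closed_next _ h); rwa [this] at h)

theorem tendsto_reflect : Filter.Tendsto (fun t : ℝ => -t) (𝓝[>] 0) (𝓝[<] 0) := by
  have := tendsto_neg_nhdsGT (a := (0 : ℝ))
  rwa [neg_zero] at this

theorem tendsto_sub_one : Filter.Tendsto (fun t : ℝ => t - 1) (𝓝[<] 1) (𝓝[<] 0) := by
  refine tendsto_nhdsWithin_iff.2 ⟨?_, ?_⟩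
  · have : Continuous fun t : ℝ => t - 1 := by fun_prop
    have := this.tendsto 1
    rw [sub_self] at this
    exact this.mono_left nhdsWithin_le_nhds
  · filter_upwards [self_mem_nhdsWithin] with t (ht : t < 1)
    exact sub_neg.2 ht

theorem eventually_leftColour_end {a : D.Arc} {q : ZMod 2}
    (h : ∀ᶠ τ in 𝓝[<] (0 : ℝ), ∀ x', SideColour col (D.γ a) (1 + 1 * τ) 1 x' → x' = q) :
    ∀ᶠ t in 𝓝[<] (1 : ℝ), leftColour col a t = q := by
  filter_upwards [tendsto_sub_one.eventually h, Ioo_mem_nhdsLT (zero_lt_one' ℝ),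
    nhdsWithin_mono 1 (fun t ht => ne_of_lt ht) (eventually_not_isCrossing a 1)] with t h1 h2 h3
  rw [one_mul, add_sub_cancel] at h1
  exact h1 _ (sideColour_leftColour (Or.inr h2) h3)

/-- At a start the boundary circle gives the colour on the right of the arc; the left has the other
one. -/
theorem eventually_leftColour_start (hcol : ∀ r s, D.Adjacent r s → col r = col s + 1)
    {a : D.Arc} {q : ZMod 2}
    (h : ∀ᶠ τ in 𝓝[<] (0 : ℝ), ∀ x', SideColour col (D.γ a) (0 + -1 * τ) (-1) x' → x' = q) :
    ∀ᶠ t in 𝓝[>] (0 : ℝ), leftColour col a t = q + 1 := by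
  filter_upwards [tendsto_reflect.eventually h, Ioo_mem_nhdsGT (zero_lt_one' ℝ),
    nhdsWithin_mono 0 (fun t ht => ne_of_gt ht) (eventually_not_isCrossing a 0)] with t h1 h2 h3
  rw [show 0 + -1 * -t = t by ring] at h1
  obtain ⟨y, hy⟩ := exists_sideColour_arc (col := col) (Or.inr h2) h3 (-1)
  rw [← h1 y hy]
  exact SideColour.opposite hcol h2 h3 (sideColour_leftColour (Or.inr h2) h3) hy

/-! ### The parity of the number of passages -/

theorem passage_ncard (a : D.Arc) :
    ({p : D.Passage | p.1.1 = a}.ncard : ℕ) = {t | t ∈ Set.Ico (0 : ℝ) 1 ∧ IsCrossing a t}.ncard := by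
  refine Set.ncard_congr (fun p _ => p.1.2) ?_ ?_ ?_
  · rintro ⟨⟨b, t⟩, hp⟩ rfl
    have h0 := Passage.time_nonneg ⟨(b, t), hp⟩
    have h1 := Passage.time_lt_one ⟨(b, t), hp⟩
    refine ⟨⟨h0, h1⟩, ?_⟩
    unfold IsCrossing
    rwa [Int.fract_eq_self.2 ⟨h0, h1⟩]
  · rintro ⟨⟨b, t⟩, hp⟩ ⟨⟨b', t'⟩, hp'⟩ rfl h e
    exact Subtype.ext (Prod.ext h.symm e)
  · rintro t ⟨ht, hX⟩
    unfold IsCrossing at hX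
    rw [Int.fract_eq_self.2 ⟨ht.1, ht.2⟩] at hX
    exact ⟨⟨(a, t), hX⟩, rfl, rfl⟩

theorem finite_isCrossing (a : D.Arc) : {t | t ∈ Set.Ico (0 : ℝ) 1 ∧ IsCrossing a t}.Finite := by
  refine (D.finite_meet.image Prod.snd).subset ?_
  rintro t ⟨ht, hX⟩
  unfold IsCrossing at hX
  rw [Int.fract_eq_self.2 ⟨ht.1, ht.2⟩] at hX
  exact ⟨(a, t), hX, rfl⟩

theorem not_isCrossing_zero {a : D.Arc} (ha : ¬ D.IsClosedArc a) : ¬ IsCrossing a 0 := by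
  rintro ⟨q, hq⟩
  rw [Int.fract_zero] at hq
  exact (D.meet_interior _ _ hq).ne (D.open_start a ha)

/-- The number of passages on an arc is the change of colour along it. -/
theorem leftColour_end_eq (hcol : ∀ r s, D.Adjacent r s → col r = col s + 1) (a : D.Arc)
    {x y : ZMod 2} (hx : ∀ᶠ t in 𝓝[>] (0 : ℝ), leftColour col a t = x)
    (hy : ∀ᶠ t in 𝓝[<] (1 : ℝ), leftColour col a t = y) :
    y = x + ({t | t ∈ Set.Ioo (0 : ℝ) 1 ∧ IsCrossing a t}.ncard : ℕ) := by
  refine eq_add_ncard_of_jumps zero_lt_one ((finite_isCrossing a).subset fun t ht =>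
    ⟨Set.Ioo_subset_Ico_self ht.1, ht.2⟩) (fun t ht => ht.1) (fun t ht => ?_) hx hy
  obtain ⟨q, h1, h2, h3⟩ := exists_leftColour_step hcol (a := a) (Or.inr ht)
  exact ⟨q, h1, fun h => h2 h.2, fun h => h3 fun h' => h ⟨ht, h'⟩⟩

-- `S a` is the colour on the left just after the start of `a`. It changes once for each passage on
-- `a`, and once more when an open arc passes through the boundary circle, where left and right are
-- exchanged.
open Classical in
theorem exists_startColour (hcol : ∀ r s, D.Adjacent r s → col r = col s + 1) :
    ∃ S : D.Arc → ZMod 2, ∀ a, S (D.next a) =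
      S a + ({p : D.Passage | p.1.1 = a}.ncard : ℕ) + if D.IsClosedArc a then 0 else 1 := by
  have hex : ∀ a : D.Arc, ∃ x, ∀ᶠ t in 𝓝[>] (0 : ℝ), leftColour col a t = x := by
    intro a
    by_cases ha : D.IsClosedArc a
    · obtain ⟨q, -, h2, h3⟩ := exists_leftColour_step hcol (a := a) (t := 0) (Or.inl ha)
      by_cases hX : IsCrossing a 0
      · exact ⟨_, h2 hX⟩
      · exact ⟨_, h3 hX⟩
    · obtain ⟨q, h1, -⟩ := exists_end_colour_arc (col := col) ha (Or.inr ⟨rfl, rfl⟩)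
      exact ⟨_, eventually_leftColour_start hcol h1⟩
  choose S hS using hex
  have huniq : ∀ a x, (∀ᶠ t in 𝓝[>] (0 : ℝ), leftColour col a t = x) → S a = x := by
    intro a x hx
    obtain ⟨t, h1, h2⟩ := ((hS a).and hx).exists
    rw [← h1, h2]
  refine ⟨S, fun a => ?_⟩
  rw [passage_ncard]
  by_cases ha : D.IsClosedArc a
  · rw [if_pos ha, add_zero, D.closed_next a ha]
    obtain ⟨q, h1, h2, h3⟩ := exists_leftColour_step hcol (a := a) (t := 0) (Or.inl ha)
    have hy : ∀ᶠ t in 𝓝[<] (1 : ℝ), leftColour col a t = q := by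
      filter_upwards [tendsto_sub_one.eventually h1] with t ht
      rw [← ht, ← leftColour_add_int ha (t - 1) 1]
      simp
    have hend := leftColour_end_eq hcol a (hS a) hy
    -- A crossing at the base point of a closed arc lies outside the open interval; it is counted by
    -- the flip between the end of one period and the start of the next.
    by_cases hX : IsCrossing a 0
    · have e : {t | t ∈ Set.Ico (0 : ℝ) 1 ∧ IsCrossing a t} =
          insert 0 {t | t ∈ Set.Ioo (0 : ℝ) 1 ∧ IsCrossing a t} := by
        ext t
        constructor
        · rintro ⟨ht, h⟩
          rcases eq_or_lt_of_le ht.1 with h0 | h0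
          · exact Or.inl h0.symm
          · exact Or.inr ⟨⟨h0, ht.2⟩, h⟩
        · rintro (rfl | ⟨ht, h⟩)
          · exact ⟨⟨le_rfl, one_pos⟩, hX⟩
          · exact ⟨Set.Ioo_subset_Ico_self ht, h⟩
      have hfin : {t | t ∈ Set.Ioo (0 : ℝ) 1 ∧ IsCrossing a t}.Finite :=
        (finite_isCrossing a).subset fun t ht => ⟨Set.Ioo_subset_Ico_self ht.1, ht.2⟩
      rw [e, Set.ncard_insert_of_notMem (by simp) hfin]
      have hSa := huniq a _ (h2 hX)
      push_cast
      have : ∀ s q n : ZMod 2, q = s + n → s = q + 1 → s = s + (n + 1) := by decide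
      exact this _ _ _ hend hSa
    · have e : {t | t ∈ Set.Ico (0 : ℝ) 1 ∧ IsCrossing a t} =
          {t | t ∈ Set.Ioo (0 : ℝ) 1 ∧ IsCrossing a t} := by
        ext t
        refine ⟨fun ⟨ht, h⟩ => ⟨⟨lt_of_le_of_ne ht.1 ?_, ht.2⟩, h⟩, fun ⟨ht, h⟩ =>
          ⟨Set.Ioo_subset_Ico_self ht, h⟩⟩
        rintro rfl
        exact hX h
      rw [e, ← hend]
      exact huniq a _ (h3 hX)
  · rw [if_neg ha]
    have e : {t | t ∈ Set.Ico (0 : ℝ) 1 ∧ IsCrossing a t} =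
        {t | t ∈ Set.Ioo (0 : ℝ) 1 ∧ IsCrossing a t} := by
      ext t
      refine ⟨fun ⟨ht, h⟩ => ⟨⟨lt_of_le_of_ne ht.1 ?_, ht.2⟩, h⟩, fun ⟨ht, h⟩ =>
        ⟨Set.Ioo_subset_Ico_self ht, h⟩⟩
      rintro rfl
      exact not_isCrossing_zero ha h
    obtain ⟨q, h1, h2⟩ := exists_end_colour_arc (col := col) ha (Or.inl ⟨rfl, rfl⟩)
    obtain ⟨q', h1', h2'⟩ := exists_end_colour_arc (col := col) (not_isClosedArc_next ha)
      (Or.inr ⟨rfl, rfl⟩)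
    -- Points just counterclockwise of the end of `a` and of the start of `next a` are antipodal,
    -- hence equal in the projective plane.
    have hqq : q' = q := by
      obtain ⟨θ, e1, e2⟩ := (h2.and h2').exists
      rw [← e1.2, ← e2.2, D.open_next a ha, neg_mul]
      refine colourAt_neg col ?_ e1.1
      rw [norm_mul, Complex.norm_exp_ofReal_mul_I, D.open_end a ha, mul_one]
    rw [e, ← leftColour_end_eq hcol a (hS a) (eventually_leftColour_end h1), ← hqq]
    exact huniq _ _ (eventually_leftColour_start hcol h1')

open Classical in
theorem ncard_passage_component (c : D.Component) :
    ({p : D.Passage | D.componentOf p.1.1 = c}.ncard : ℕ) =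
      ∑ a : D.Arc with D.componentOf a = c, {p : D.Passage | p.1.1 = a}.ncard := by
  have := Fintype.ofFinite D.Passage
  simp only [Set.ncard_eq_toFinset_card']
  rw [Finset.card_eq_sum_card_fiberwise (f := fun p : D.Passage => p.1.1)
    (t := Finset.univ.filter fun a => D.componentOf a = c)]
  · refine Finset.sum_congr rfl fun a ha => ?_
    congr 1
    ext p
    simp only [Finset.mem_filter, Set.mem_toFinset, Set.mem_ofPred_eq, Finset.mem_univ,
      true_and] at ha ⊢
    refine ⟨fun h => h.2, fun h => ⟨by rw [h, ha], h⟩⟩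
  · intro p hp
    simpa using hp

-- Summing the recursion for `S` over a component, the values of `S` cancel because `next` permutes
-- its arcs; what remains is that passages and open arcs together are even in number.
open Classical in
theorem IsCheckerboardColourable.ncard_passage (hD : D.IsCheckerboardColourable)
    (c : D.Component) :
    (({p : D.Passage | D.componentOf p.1.1 = c}.ncard : ℕ) : ZMod 2) =
      ∑ a : D.Arc with D.componentOf a = c, (if D.IsClosedArc a then 0 else 1) := by
  obtain ⟨colour, hcolour⟩ := hD
  obtain ⟨S, hS⟩ := exists_startColour (D := D) (col := fun r => if colour r then 1 else 0) (by
    intro r s h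
    have := hcolour r s h
    cases h1 : colour r <;> cases h2 : colour s <;> simp_all; decide)
  have h1 := D.sum_component_next c S
  simp only [hS, Finset.sum_add_distrib] at h1
  rw [ncard_passage_component, Nat.cast_sum]
  have : ∀ s n m : ZMod 2, s + n + m = s → n = m := by decide
  exact this _ _ _ h1

end LinkDiagram
end

theorem corollary3p9 (D D' : LinkDiagram)
    (hD : D.IsCheckerboardColourable) (hD' : D'.IsCheckerboardColourable)
    (h : D.ribbonGraphs = D'.ribbonGraphs) :
    D.IsNullHomologous ↔ D'.IsNullHomologous :=
  (D.isNullHomologous_iff_hasEvenCycles hD.ncard_passage).trans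
    ((LinkDiagram.hasEvenCycles_iff_of_ribbonGraphs_eq h).trans
      (D'.isNullHomologous_iff_hasEvenCycles hD'.ncard_passage).symm)
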